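/- **Definitions.** All objects are smooth, after straightening corners. A knotted surface is a closed, possibly disconnected or non-orientable, surface $\mathcal K$ smoothly embedded in $S^4$. For $n\in\{3,4\}$, a collection of disjoint properly embedded $(n-2)$-balls in an $n$-ball $X$ is trivial if all of them are simultaneously isotopic into $\partial X$; equivalently, the pair is diffeomorphic to the unit ball of $\mathbb R^2\times\mathbb R^{n-2}$ together with finitely many parallel flat disks $\{(t_j,0)\}\times\mathbb R^{n-2}$, $-1<t_j<1$. For $n=4$ such a pair with $c$ disks is a trivial $c$-disk system; for $n=3$ such a pair with $b$ arcs is a $b$-strand trivial tangle. A $(b;c_1,c_2,c_3)$-bridge trisection of $\mathcal K$ is a decomposition $(S^4,\mathcal K)=(X_1,\mathcal D_1)\cup(X_2,\mathcal D_2)\cup(X_3,\mathcal D_3)$, where $\mathcal D_i=\mathcal K\cap X_i$, such that 1. $S^4=X_1\cup X_2\cup X_3$ is the standard genus zero trisection up to a diffeomorphism of $S^4$ (so the $X_i$ are $4$-balls, the $X_i\cap X_j$ with $i\neq j$ are $3$-balls, and $X_1\cap X_2\cap X_3$ is a $2$-sphere), 2. each $(X_i,\mathcal D_i)$ is a trivial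 $c_i$-disk system, and 3. for all $i\ne j$, $(X_i,\mathcal D_i)\cap(X_j,\mathcal D_j)$ is a $b$-strand trivial tangle. An element of $\pi_1(S^4\setminus\mathcal K,x_0)$ is meridional if it is represented by a loop consisting of a path from $x_0$, the boundary circle of a smoothly embedded disk that meets $\mathcal K$ transversely in exactly one point, its center, and the reverse of the path. A presentation of the group is meridional if each of its generators is meridional. **Proposition.** Let $\mathcal K\subset S^4$ be a knotted surface admitting a $(b;c_1,c_2,c_3)$-bridge trisection, let $x_0\in S^4\setminus\mathcal K$, and let $i,j\in\{1,2,3\}$ be distinct. Then $c_j\le b$, and $\pi_1(S^4\setminus\mathcal K,x_0)$ has a meridional presentation with $c_i$ generators and $b-c_j$ relations. -/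

import Mathlib

open scoped Manifold ContDiff

noncomputable section

/-- The smooth `4`-sphere, as the unit sphere of `ℝ⁵`. -/
abbrev S4 : Type := Metric.sphere (0 : EuclideanSpace ℝ (Fin 5)) 1

/-- The pieces of the standard genus zero trisection of `S⁴ ⊆ ℝ² × ℝ³`: the piece with index `i`
consists of the points whose projection to `ℝ²` lies in the closed `120°` sector around the
direction `2πi/3`. -/
def standardSector (i : Fin 3) : Set S4 :=
  let h : Fin 3 → S4 → ℝ := fun k x =>
    x.1 0 * Real.cos (2 * Real.pi * (k : ℕ) / 3) + x.1 1 * Real.sin (2 * Real.pi * (k : ℕ) / 3)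
  {x | ∀ k, h k x ≤ h i x}

/-- `X = X₁ ∪ X₂ ∪ X₃` is the standard genus zero trisection of `S⁴`, up to a diffeomorphism of
`S⁴`. -/
def IsGenusZeroTrisection (X : Fin 3 → Set S4) : Prop :=
  ∃ Φ : S4 ≃ₘ⟮𝓡 4, 𝓡 4⟯ S4, ∀ i, X i = Φ '' standardSector i

/-- `(X, K ∩ X)` is an `(n + 2)`-ball in `S⁴` with boundary `bd`, together with a trivial
collection of `m` properly embedded `n`-disks: the pair is diffeomorphic to the unit ball of
`ℝ² × ℝⁿ` together with `m` parallel flat disks `{(tⱼ, 0)} × ℝⁿ`. Translation in the second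
coordinate direction moves these disks, simultaneously and disjointly, into the boundary.

The set `corner` contains the corners of the boundary of `X`. As usual in identifications of a
ball with corners with the round ball, the parametrization is a homeomorphism onto `X` which is
smooth, with injective derivative, away from the corners (up to the boundary). -/
def IsTrivialDiskCollection (n m : ℕ) (K X bd corner : Set S4) : Prop :=
  ∃ (F : EuclideanSpace ℝ (Fin (n + 2)) → S4) (t : Fin m → ℝ),
    ContinuousOn F (Metric.closedBall 0 1) ∧
    Set.InjOn F (Metric.closedBall 0 1) ∧
    F '' Metric.closedBall 0 1 = X ∧
    F '' Metric.sphere 0 1 = bd ∧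
    (∀ x ∈ Metric.closedBall 0 1, F x ∉ corner →
      ContMDiffWithinAt 𝓘(ℝ, EuclideanSpace ℝ (Fin (n + 2))) (𝓡 4) ∞ F
        (Metric.closedBall 0 1) x ∧
      Function.Injective (mfderivWithin 𝓘(ℝ, EuclideanSpace ℝ (Fin (n + 2))) (𝓡 4) F
        (Metric.closedBall 0 1) x)) ∧
    Function.Injective t ∧
    (∀ j, |t j| < 1) ∧
    ∀ x ∈ Metric.closedBall 0 1, F x ∈ K ↔ ∃ j, x 0 = t j ∧ x 1 = 0

/-- The decomposition `(S⁴, K) = ⋃ (Xᵢ, K ∩ Xᵢ)` is a `(b; c₁, c₂, c₃)`-bridge trisection. -/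
structure IsBridgeTrisection (K : Set S4) (b : ℕ) (c : Fin 3 → ℕ) (X : Fin 3 → Set S4) :
    Prop where
  /-- `S⁴ = X₁ ∪ X₂ ∪ X₃` is the standard genus zero trisection. -/
  trisection : IsGenusZeroTrisection X
  /-- `(Xᵢ, K ∩ Xᵢ)` is a trivial `cᵢ`-disk system; the boundary of the `4`-ball `Xᵢ` is the union
  of its intersections with the other two pieces and has a corner along the central sphere. -/
  disks : ∀ i, IsTrivialDiskCollection 2 (c i) K (X i) (⋃ j ∈ {j | j ≠ i}, X i ∩ X j) (⋂ j, X j)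
  /-- `(Xᵢ ∩ Xⱼ, K ∩ Xᵢ ∩ Xⱼ)` is a `b`-strand trivial tangle in a `3`-ball bounded by the central
  sphere. -/
  tangles : ∀ i j, i ≠ j → IsTrivialDiskCollection 1 b K (X i ∩ X j) (⋂ k, X k) ∅

section Meridians

variable {M : Type*} [TopologicalSpace M] [ChartedSpace (EuclideanSpace ℝ (Fin 2)) M]

/-- `d` restricts on the open disk of radius `2` to a smoothly embedded disk in `S⁴` that meets the
surface `f(M)` transversely, exactly in the image of the center. -/
def IsMeridianDisk (f : M → S4) (d : EuclideanSpace ℝ (Fin 2) → S4) : Prop :=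
  ContMDiffOn 𝓘(ℝ, EuclideanSpace ℝ (Fin 2)) (𝓡 4) ∞ d (Metric.ball 0 2) ∧
  Set.InjOn d (Metric.ball 0 2) ∧
  (∀ u ∈ Metric.ball (0 : EuclideanSpace ℝ (Fin 2)) 2,
    Function.Injective (mfderiv 𝓘(ℝ, EuclideanSpace ℝ (Fin 2)) (𝓡 4) d u)) ∧
  (∀ u ∈ Metric.ball (0 : EuclideanSpace ℝ (Fin 2)) 2, d u ∈ Set.range f ↔ u = 0) ∧
  ∃ m : M, f m = d 0 ∧
    let A : EuclideanSpace ℝ (Fin 2) →L[ℝ] EuclideanSpace ℝ (Fin 4) :=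
      mfderiv 𝓘(ℝ, EuclideanSpace ℝ (Fin 2)) (𝓡 4) d 0
    let B : EuclideanSpace ℝ (Fin 2) →L[ℝ] EuclideanSpace ℝ (Fin 4) :=
      mfderiv (𝓡 2) (𝓡 4) f m
    A.range ⊔ B.range = ⊤

/-- An element of the fundamental group of the complement of the surface `f(M)` is meridional if it
is represented by a meridian, that is, by the boundary circle of a meridian disk joined to the base
point by a path. -/
def IsMeridional (f : M → S4) (x₀ : ↥(Set.range f)ᶜ)
    (g : FundamentalGroup ↥(Set.range f)ᶜ x₀) : Prop :=
  ∃ d : EuclideanSpace ℝ (Fin 2) → S4, IsMeridianDisk f d ∧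
    ∃ (y : ↥(Set.range f)ᶜ) (γ : Path x₀ y) (μ : Path y y),
      (∀ s : unitInterval, (μ s : S4) =
        d !₂[Real.cos (2 * Real.pi * s), Real.sin (2 * Real.pi * s)]) ∧
      g = FundamentalGroup.fromPath (Path.Homotopic.Quotient.mk ((γ.trans μ).trans γ.symm))

/-- The fundamental group of the complement of the surface `f(M)` has a presentation with `p`
generators and `q` relations in which every generator is meridional. -/
def HasMeridionalPresentation (f : M → S4) (x₀ : ↥(Set.range f)ᶜ) (p q : ℕ) : Prop :=
  ∃ (r : Fin q → FreeGroup (Fin p))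
    (e : PresentedGroup (Set.range r) ≃* FundamentalGroup ↥(Set.range f)ᶜ x₀),
    ∀ k, IsMeridional f x₀ (e (PresentedGroup.of k))

end Meridians

end

/-! Write `Z` for the complement of the surface and `P`, `Q`, `R` for the pieces with indices `i`,
`j` and the third index. The fundamental groups of `P ∩ Z`, `Q ∩ Z` and `P ∩ Q ∩ Z` are free of
ranks `c i`, `c j` and `b`, the first one on meridians. Inclusion gives `φ : F_b → F_(c j)` and `ψ :
F_b → F_(c i)`.

The map `φ` is onto: paths in `Q ∩ Z` can be pushed into the boundary of `Q`, and there out of `Q ∩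
R` into `P ∩ Q` across the central sphere. A surjection between free groups of finite rank has a
kernel normally generated by as many elements as the ranks differ
(`exists_ker_eq_normalClosure_of_freeGroup_surjective`). Hence `c j ≤ b`, and `ker φ` is normally
generated by `b - c j` elements `r k`. The relations of the presentation are the words `ψ (r k)`.

They hold in `Z` because `r k` dies in `Q`. They suffice (`exists_relations`): `Z` arises from `P`
by attaching `Q ∩ R`, then `Q`, then `R`, and each step is onto on fundamental groups. Two paths in
the central sphere that agree in `Q ∩ R` also agree in `Q`. Closed up to loops, their classes in
`F_b` differ by an element of `ker φ`, so they agree in `P` modulo the relations. Attaching the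
four-balls `Q` and `R` costs nothing more, because the boundary sphere minus an unlink already
detects everything that the ball minus trivial disks identifies (`IsRep.eq_of_repEq_model`).

Instead of groups at base points, the argument uses representations of fundamental groupoids, as
functions on paths in an ambient space. Extending such functions over a union is the theorem of
Seifert and van Kampen (`exists_rep_of_cover`, and `IsRep.exists_attach` for closed pieces with a
collar). The algebra of free groups is Stallings folding: a surjection is encoded by a labelled
graph, and the number of relators is counted while the graph is simplified
(`hasDeficiency_graphHom`). -/

section

open Set

/-! ### Representations of the fundamental groupoid of a subset. -/

section PathReps

variable {A : Type} [TopologicalSpace A]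

/-- The path stays in the set `T`. -/
def InSet (T : Set A) {x y : A} (γ : Path x y) : Prop := ∀ t, γ t ∈ T

/-- A representation of the fundamental groupoid of the subspace `T` in a group, as a function on
all paths of which only the values on paths in `T` matter. The order of multiplication is that of
Mathlib's fundamental group. -/
structure IsRep (T : Set A) {G : Type} [Group G] (Φ : ∀ ⦃x y : A⦄, Path x y → G) : Prop where
  trans : ∀ ⦃x y z : A⦄ (γ : Path x y) (γ' : Path y z), InSet T γ → InSet T γ' →
    Φ (γ.trans γ') = Φ γ' * Φ γ
  hom : ∀ ⦃x y : A⦄ (γ γ' : Path x y) (F : Path.Homotopy γ γ'), (∀ p, F p ∈ T) → Φ γ = Φ γ'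

/-- Two paths in `T` are identified by all representations of the fundamental groupoid of `T`. -/
def RepEq (T : Set A) {x y : A} (γ γ' : Path x y) : Prop :=
  ∀ (G : Type) [Group G] (Φ : ∀ ⦃x y : A⦄, Path x y → G), IsRep T Φ → Φ γ = Φ γ'

theorem InSet.mono {S T : Set A} (h : S ⊆ T) {x y : A} {γ : Path x y} (hγ : InSet S γ) :
    InSet T γ := fun _ => h (hγ _)

theorem InSet.source {T : Set A} {x y : A} {γ : Path x y} (hγ : InSet T γ) : x ∈ T := by
  simpa using hγ 0

theorem InSet.target {T : Set A} {x y : A} {γ : Path x y} (hγ : InSet T γ) : y ∈ T := by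
  simpa using hγ 1

theorem InSet.trans {T : Set A} {x y z : A} {γ : Path x y} {γ' : Path y z} (hγ : InSet T γ)
    (hγ' : InSet T γ') : InSet T (γ.trans γ') := by
  intro t
  rw [Path.trans_apply]
  split_ifs
  exacts [hγ _, hγ' _]

theorem InSet.symm {T : Set A} {x y : A} {γ : Path x y} (hγ : InSet T γ) : InSet T γ.symm :=
  fun _ => hγ _

theorem inSet_refl {T : Set A} {x : A} (hx : x ∈ T) : InSet T (Path.refl x) := fun _ => hx

/-- Endpoints are often equal only propositionally, so that an equation of the paths would not
typecheck. The values of `Φ` can still be compared. -/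
theorem path_fun_congr {G : Type} (Φ : ∀ ⦃x y : A⦄, Path x y → G) {x y x' y' : A} (γ : Path x y)
    (γ' : Path x' y') (h : ∀ t, γ t = γ' t) : Φ γ = Φ γ' := by
  have hx : x = x' := by simpa using h 0
  have hy : y = y' := by simpa using h 1
  subst hx hy
  congr 1
  ext t
  exact h t

namespace IsRep

variable {T : Set A} {G : Type} [Group G] {Φ : ∀ ⦃x y : A⦄, Path x y → G}

theorem mono {S : Set A} (h : S ⊆ T) (hΦ : IsRep T Φ) : IsRep S Φ :=
  ⟨fun _ _ _ γ γ' hγ hγ' => hΦ.trans γ γ' (hγ.mono h) (hγ'.mono h),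
    fun _ _ γ γ' F hF => hΦ.hom γ γ' F fun p => h (hF p)⟩

theorem map_refl (hΦ : IsRep T Φ) {x : A} (hx : x ∈ T) : Φ (Path.refl x) = 1 := by
  have h := hΦ.trans (Path.refl x) (Path.refl x) (inSet_refl hx) (inSet_refl hx)
  rw [Path.refl_trans_refl] at h
  simpa using h

theorem map_const (hΦ : IsRep T Φ) {x y : A} (γ : Path x y) (hγ : InSet T γ)
    (h : ∀ t, γ t = x) : Φ γ = 1 := by
  rw [path_fun_congr Φ γ (Path.refl x) (fun t => by simp [h]), hΦ.map_refl hγ.source]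

theorem map_symm (hΦ : IsRep T Φ) {x y : A} (γ : Path x y) (hγ : InSet T γ) :
    Φ γ.symm = (Φ γ)⁻¹ := by
  have h := hΦ.trans γ γ.symm hγ hγ.symm
  -- The standard contraction of `γ.trans γ.symm` passes only through points of `γ`, hence stays in
  -- `T`.
  have h2 := hΦ.hom _ _ (Path.Homotopy.reflTransSymm γ) (by
    intro p
    have : (Path.Homotopy.reflTransSymm γ) p ∈ Set.range γ := by
      simp only [Path.Homotopy.reflTransSymm]
      exact ⟨_, rfl⟩
    obtain ⟨t, ht⟩ := this
    rw [← ht]; exact hγ t)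
  rw [hΦ.map_refl hγ.source, h] at h2
  exact eq_inv_of_mul_eq_one_left h2.symm

theorem map_conj (hΦ : IsRep T Φ) {x y z w : A} (p : Path x y) (γ : Path y z) (q : Path w z)
    (hp : InSet T p) (hγ : InSet T γ) (hq : InSet T q) :
    Φ ((p.trans γ).trans q.symm) = (Φ q)⁻¹ * Φ γ * Φ p := by
  rw [hΦ.trans _ _ (hp.trans hγ) hq.symm, hΦ.trans _ _ hp hγ, hΦ.map_symm _ hq, mul_assoc]

/-- Two paths that factor through paths in a convex set have the same image. -/
theorem convex {W : Type} [NormedAddCommGroup W] [NormedSpace ℝ W] (hΦ : IsRep T Φ) {D : Set W}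
    (hD : Convex ℝ D) {σ : W → A} (hσ : ContinuousOn σ D) (hT : MapsTo σ D T) {p q : W}
    (γ γ' : Path p q) (hγ : InSet D γ) (hγ' : InSet D γ') {x y x' y' : A} (α : Path x y)
    (α' : Path x' y') (hα : ∀ t, α t = σ (γ t)) (hα' : ∀ t, α' t = σ (γ' t)) : Φ α = Φ α' := by
  have hx : x = x' := by simpa using (hα 0).trans (by simpa using (hα' 0).symm)
  have hy : y = y' := by simpa using (hα 1).trans (by simpa using (hα' 1).symm)
  subst hx hy
  have hmem : ∀ r : unitInterval × unitInterval,
      AffineMap.lineMap (γ r.2) (γ' r.2) (r.1 : ℝ) ∈ D := fun r =>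
    hD.lineMap_mem (hγ _) (hγ' _) ⟨r.1.2.1, r.1.2.2⟩
  refine hΦ.hom α α' ⟨⟨⟨fun r => σ (AffineMap.lineMap (γ r.2) (γ' r.2) (r.1 : ℝ)), ?_⟩, ?_, ?_⟩, ?_⟩
    (fun r => hT (hmem r))
  · refine hσ.comp_continuous ?_ hmem
    simp only [AffineMap.lineMap_apply]
    fun_prop
  · intro t; simp [hα]
  · intro t; simp [hα']
  · intro t s hs
    have hp : σ p = x := by simpa using (hα 0).symm
    have hq : σ q = y := by simpa using (hα 1).symm
    rcases hs with rfl | rfl <;> simp [hp, hq]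

/-- The image of the boundary of a square is trivial. -/
theorem square (hΦ : IsRep T Φ) (F : unitInterval × unitInterval → A) (hF : Continuous F)
    (hT : ∀ p, F p ∈ T) {x y x' y' : A} (a : Path x y) (b : Path x' y') (l : Path x x')
    (r : Path y y') (ha : ∀ t, a t = F (t, 0)) (hb : ∀ t, b t = F (t, 1))
    (hl : ∀ t, l t = F (0, t)) (hr : ∀ t, r t = F (1, t)) : Φ b * Φ l = Φ r * Φ a := by
  have ha' : InSet T a := fun t => by rw [ha]; exact hT _
  have hb' : InSet T b := fun t => by rw [hb]; exact hT _
  have hl' : InSet T l := fun t => by rw [hl]; exact hT _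
  have hr' : InSet T r := fun t => by rw [hr]; exact hT _
  rw [← hΦ.trans _ _ hl' hb', ← hΦ.trans _ _ ha' hr']
  -- Clamping the coordinates extends `F` to the whole plane. The two ways around the square are
  -- then paths with common ends in a convex set.
  let P : ℝ → unitInterval := projIcc 0 1 zero_le_one
  have hP : ∀ t : unitInterval, P t = t := fun t => projIcc_val zero_le_one t
  have hP0 : P 0 = 0 := by simp [P]
  have hP1 : P 1 = 1 := by simp [P]
  have hPc : Continuous P := continuous_projIcc
  let c1 : Path (0 : ℝ) 1 := Path.segment 0 1
  have hc1 : ∀ t : unitInterval, c1 t = t := fun t => by simp [c1, AffineMap.lineMap_apply]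
  refine hΦ.convex (W := ℝ × ℝ) (D := univ) convex_univ (σ := fun v => F (P v.1, P v.2))
    (by fun_prop) (fun v _ => hT _)
    (((Path.refl 0).prod c1).trans (c1.prod (Path.refl 1)))
    ((c1.prod (Path.refl 0)).trans ((Path.refl 1).prod c1))
    (fun _ => trivial) (fun _ => trivial) _ _ ?_ ?_
  · intro t
    rw [Path.trans_apply, Path.trans_apply]
    split_ifs
    · simpa only [Path.prod_coe, Path.refl_apply, hc1, hP0, hl] using
        congrArg (fun s => F (0, s)) (hP _).symm
    · simpa only [Path.prod_coe, Path.refl_apply, hc1, hP1, hb] using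
        congrArg (fun s => F (s, 1)) (hP _).symm
  · intro t
    rw [Path.trans_apply, Path.trans_apply]
    split_ifs
    · simpa only [Path.prod_coe, Path.refl_apply, hc1, hP0, ha] using
        congrArg (fun s => F (s, 0)) (hP _).symm
    · simpa only [Path.prod_coe, Path.refl_apply, hc1, hP1, hr] using
        congrArg (fun s => F (1, s)) (hP _).symm

/-- All three subpaths are images of segments under the extension of `γ` to the line, which is
convex. No order of `a`, `b`, `c` is needed. -/
theorem subpath (hΦ : IsRep T Φ) {x y : A} (γ : Path x y) (hγ : InSet T γ) (a b c : unitInterval) :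
    Φ (γ.subpath a c) = Φ (γ.subpath b c) * Φ (γ.subpath a b) := by
  rw [← hΦ.trans (γ.subpath a b) (γ.subpath b c) (fun t => hγ _) (fun t => hγ _)]
  refine hΦ.convex (W := ℝ) (D := univ) convex_univ (σ := γ.extend) (by fun_prop)
    (fun v _ => hγ _) (Path.segment (a : ℝ) c) ((Path.segment (a : ℝ) b).trans (Path.segment (b : ℝ) c))
    (fun _ => trivial) (fun _ => trivial) _ _ ?_ ?_
  · intro t
    rw [show (Path.segment (a : ℝ) c) t = (Set.Icc.convexComb a c t : unitInterval) by
      simp [AffineMap.lineMap_apply]; ring, Path.extend_extends']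
    rfl
  · intro t
    rw [Path.trans_apply, Path.trans_apply]
    split_ifs
    · rw [show ∀ s : unitInterval, (Path.segment (a : ℝ) b) s = (Set.Icc.convexComb a b s : unitInterval) by
        intro s; simp [AffineMap.lineMap_apply]; ring, Path.extend_extends']
      rfl
    · rw [show ∀ s : unitInterval, (Path.segment (b : ℝ) c) s = (Set.Icc.convexComb b c s : unitInterval) by
        intro s; simp [AffineMap.lineMap_apply]; ring, Path.extend_extends']
      rfl

end IsRep

theorem path_fun_subpath_zero_one {G : Type} (Φ : ∀ ⦃x y : A⦄, Path x y → G) {x y : A}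
    (γ : Path x y) : Φ (γ.subpath 0 1) = Φ γ :=
  path_fun_congr Φ _ _ fun t => by simp

theorem InSet.subpath {T : Set A} {x y : A} {γ : Path x y} (hγ : InSet T γ) (a b : unitInterval) :
    InSet T (γ.subpath a b) := fun _ => hγ _

/-- A property of paths in `T` that is multiplicative and holds locally holds for all paths. -/
theorem path_induction {T : Set A} {ι : Type} {V : ι → Set A} (hV : ∀ i, IsOpen (V i))
    (hT : T ⊆ ⋃ i, V i) (P : ∀ ⦃x y : A⦄, Path x y → Prop)
    (hom : ∀ ⦃x y : A⦄ (γ γ' : Path x y), InSet T γ → InSet T γ' → RepEq T γ γ' → P γ → P γ')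
    (trans : ∀ ⦃x y z : A⦄ (γ : Path x y) (γ' : Path y z), InSet T γ → InSet T γ' → P γ → P γ' →
      P (γ.trans γ'))
    (loc : ∀ i ⦃x y : A⦄ (γ : Path x y), InSet T γ → InSet (V i) γ → P γ) {x y : A} (γ : Path x y)
    (hγ : InSet T γ) : P γ := by
  obtain ⟨t, ht0, htm, ⟨n, hn⟩, ht⟩ := exists_monotone_Icc_subset_open_cover_unitInterval
    (c := fun i => γ ⁻¹' V i) (fun i => (hV i).preimage γ.continuous)
    (fun s _ => by simpa using hT (hγ s))
  -- Each piece between consecutive points of the Lebesgue subdivision lies in one `V i`; the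
  -- initial segments are built from these pieces.
  have key : ∀ k, P (γ.subpath 0 (t k)) := by
    intro k
    induction k with
    | zero =>
      obtain ⟨i, hi⟩ := ht 0
      refine loc i _ (hγ.subpath _ _) fun s => ?_
      rw [ht0, Path.subpath_self]
      have : t 0 ∈ γ ⁻¹' V i := hi ⟨le_rfl, htm (Nat.le_succ 0)⟩
      rw [ht0] at this
      exact this
    | succ k ih =>
      refine hom _ _ ((hγ.subpath 0 (t k)).trans (hγ.subpath (t k) (t (k + 1)))) (hγ.subpath _ _) ?_
        (trans _ _ (hγ.subpath 0 (t k)) (hγ.subpath (t k) (t (k + 1))) ih ?_)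
      · intro G _ Φ hΦ
        rw [hΦ.trans _ _ (hγ.subpath _ _) (hγ.subpath _ _), ← hΦ.subpath γ hγ]
      · obtain ⟨i, hi⟩ := ht k
        refine loc i _ (hγ.subpath _ _) fun s => ?_
        have : (γ.subpath (t k) (t (k + 1))) s ∈ Set.range (γ.subpath (t k) (t (k + 1))) := ⟨s, rfl⟩
        rw [Path.range_subpath_of_le _ _ _ (htm (Nat.le_succ k))] at this
        obtain ⟨u, hu, hu'⟩ := this
        rw [← hu']; exact hi hu
  have h1 := key n
  rw [hn n le_rfl] at h1
  have : ∀ {x' y' : A} (δ : Path x' y'), (∀ t, δ t = γ t) → P δ → P γ := by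
    intro x' y' δ hδ h
    have hx : x' = x := by simpa using hδ 0
    have hy : y' = y := by simpa using hδ 1
    subst hx hy
    rwa [show γ = δ by ext t; exact (hδ t).symm]
  exact this _ (fun t => by simp) h1

end PathReps

/-! ### The theorem of Seifert and van Kampen for open covers, by integration of cocycles. -/

section VanKampen

variable {A : Type} [TopologicalSpace A] {G : Type} [Group G]
variable {W : Type} [NormedAddCommGroup W] [NormedSpace ℝ W]

/-- A cocycle defined for nearby points of a bounded star-shaped set is a coboundary. -/
theorem exists_potential {D : Set W} (hD : ∀ r ∈ Icc (0 : ℝ) 1, ∀ p ∈ D, r • p ∈ D) {R : ℝ}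
    (hR : ∀ p ∈ D, ‖p‖ ≤ R) (c : W → W → G) {δ : ℝ} (hδ : 0 < δ)
    (hc : ∀ p ∈ D, ∀ q ∈ D, ∀ r ∈ D, dist p q < δ → dist q r < δ → dist p r < δ →
      c p r = c q r * c p q) :
    ∃ h : W → G, ∃ ε > 0, ∀ p ∈ D, ∀ q ∈ D, dist p q < ε → h q = c p q * h p := by
  obtain ⟨n, hn⟩ := exists_nat_gt (2 * R / δ)
  let N : ℝ := n + 1
  have hN : 0 < N := by positivity
  -- A radial step has length below `δ / 2`. A quadrilateral formed by two radial steps from points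
  -- closer than `δ / 2` then has sides and diagonals below `δ`, where the cocycle identity applies.
  have hRN : R / N < δ / 2 := by
    rw [div_lt_iff₀ hδ] at hn
    rw [div_lt_iff₀ hN]
    simp only [N]
    nlinarith
  -- Radial integration: the product of the values of `c` along the initial `k` of `N` equal steps
  -- from `0` to `p`.
  let h : ℕ → W → G := fun k p =>
    Nat.rec (motive := fun _ => G) 1 (fun j g => c ((j / N : ℝ) • p) (((j + 1 : ℕ) / N : ℝ) • p) * g) k
  have hsucc : ∀ k p, h (k + 1) p = c ((k / N : ℝ) • p) (((k + 1 : ℕ) / N : ℝ) • p) * h k p :=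
    fun _ _ => rfl
  have hmem : ∀ k : ℕ, k ≤ n + 1 → (k / N : ℝ) ∈ Icc (0 : ℝ) 1 := by
    intro k hk
    refine ⟨by positivity, ?_⟩
    rw [div_le_one hN]
    simp only [N]
    exact_mod_cast hk
  have key : ∀ k : ℕ, k ≤ n + 1 → ∀ p ∈ D, ∀ q ∈ D, dist p q < δ / 2 →
      c ((k / N : ℝ) • p) ((k / N : ℝ) • q) * h k p = h k q := by
    intro k
    induction k with
    | zero =>
      intro hk p hp q hq hpq
      have h0 : (0 : W) ∈ D := by simpa using hD 0 ⟨le_rfl, zero_le_one⟩ p hp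
      have := hc 0 h0 0 h0 0 h0 (by simpa) (by simpa) (by simpa)
      simp only [Nat.cast_zero, zero_div, zero_smul]
      have h1 : c 0 0 = 1 := by simpa using this
      rw [h1, one_mul]
      rfl
    | succ k ih =>
      intro hk p hp q hq hpq
      have hk' : k ≤ n + 1 := by omega
      rw [hsucc, hsucc, ← ih hk' p hp q hq hpq]
      have hd : ∀ j : ℕ, j ≤ n + 1 → dist ((j / N : ℝ) • p) ((j / N : ℝ) • q) < δ / 2 := by
        intro j hj
        rw [dist_smul₀, Real.norm_of_nonneg (hmem j hj).1]
        exact lt_of_le_of_lt (mul_le_of_le_one_left dist_nonneg (hmem j hj).2) hpq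
      have hs : ∀ r ∈ D, dist ((k / N : ℝ) • r) (((k + 1 : ℕ) / N : ℝ) • r) < δ / 2 := by
        intro r hr
        rw [dist_eq_norm, ← sub_smul, norm_smul]
        have : (k / N : ℝ) - ((k + 1 : ℕ) / N : ℝ) = -(1 / N) := by push_cast; ring
        rw [this, norm_neg, Real.norm_of_nonneg (by positivity)]
        calc 1 / N * ‖r‖ ≤ 1 / N * R := by gcongr; exact hR r hr
          _ = R / N := by ring
          _ < δ / 2 := hRN
      have m1 := hD _ (hmem k hk') p hp
      have m2 := hD _ (hmem k hk') q hq
      have m3 := hD _ (hmem (k + 1) hk) p hp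
      have m4 := hD _ (hmem (k + 1) hk) q hq
      have e1 := hc _ m1 _ m3 _ m4 (by linarith [hs p hp]) (by linarith [hd (k + 1) hk])
        (by linarith [hs p hp, hd (k + 1) hk,
          dist_triangle ((k / N : ℝ) • p) (((k + 1 : ℕ) / N : ℝ) • p) (((k + 1 : ℕ) / N : ℝ) • q)])
      have e2 := hc _ m1 _ m2 _ m4 (by linarith [hd k hk']) (by linarith [hs q hq])
        (by linarith [hs q hq, hd k hk',
          dist_triangle ((k / N : ℝ) • p) ((k / N : ℝ) • q) (((k + 1 : ℕ) / N : ℝ) • q)])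
      rw [← mul_assoc, ← e1, e2, mul_assoc]
  refine ⟨h (n + 1), δ / 2, by positivity, fun p hp q hq hpq => ?_⟩
  have := key (n + 1) le_rfl p hp q hq hpq
  have h1 : ((n + 1 : ℕ) / N : ℝ) = 1 := by
    simp only [N]; push_cast; field_simp
  rw [h1, one_smul, one_smul] at this
  exact this.symm

/-- The image in `A` of the segment from `p` to `q`. -/
noncomputable def segPath {σ : W → A} (hσ : Continuous σ) (p q : W) : Path (σ p) (σ q) :=
  (Path.segment p q).map hσ

theorem segPath_apply {σ : W → A} (hσ : Continuous σ) (p q : W) (t : unitInterval) :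
    segPath hσ p q t = σ (AffineMap.lineMap p q (t : ℝ)) := rfl

variable {ι : Type} {T : Set A} {V : ι → Set A} {Φ : ι → ∀ ⦃x y : A⦄, Path x y → G}

/-- The function `h` integrates the local representations along the map `σ` on `D`. -/
def IsPotential (V : ι → Set A) (Φ : ι → ∀ ⦃x y : A⦄, Path x y → G) (D : Set W) (σ : W → A)
    (h : W → G) : Prop :=
  ∃ hσ : Continuous σ, ∃ δ > 0, ∀ p ∈ D, ∀ q ∈ D, dist p q < δ →
    ∀ i, InSet (V i) (segPath hσ p q) → h q = Φ i (segPath hσ p q) * h p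

/-- The segment and the broken path through `q` are homotopic inside the convex set `D`, which `σ`
maps into `S`. -/
theorem segPath_cocycle {S : Set A} {Φ : ∀ ⦃x y : A⦄, Path x y → G} (hΦ : IsRep S Φ) {D : Set W}
    (hD : Convex ℝ D) {σ : W → A} (hσ : Continuous σ) (hT : MapsTo σ D S) {p q r : W}
    (hp : p ∈ D) (hq : q ∈ D) (hr : r ∈ D) :
    Φ (segPath hσ p r) = Φ (segPath hσ q r) * Φ (segPath hσ p q) := by
  have hseg : ∀ {a b : W}, a ∈ D → b ∈ D → InSet D (Path.segment a b) := fun ha hb t =>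
    hD.lineMap_mem ha hb ⟨t.2.1, t.2.2⟩
  rw [← hΦ.trans (segPath hσ p q) (segPath hσ q r) (fun t => hT (hseg hp hq t))
    (fun t => hT (hseg hq hr t))]
  refine hΦ.convex hD hσ.continuousOn hT (Path.segment p r)
    ((Path.segment p q).trans (Path.segment q r)) (hseg hp hr) ((hseg hp hq).trans (hseg hq hr))
    _ _ (fun _ => rfl) fun t => ?_
  rw [Path.trans_apply, Path.trans_apply]
  split_ifs <;> rfl

/-- By a Lebesgue number, small triangles in `D` map into a single `V i`, where the local
representation yields a cocycle on nearby points. A cocycle on a compact convex set has a potential.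
-/
theorem exists_isPotential (hV : ∀ i, IsOpen (V i)) (hTV : T ⊆ ⋃ i, V i)
    (hΦ : ∀ i, IsRep (T ∩ V i) (Φ i))
    (hag : ∀ i j ⦃x y : A⦄ (γ : Path x y), InSet T γ → InSet (V i) γ → InSet (V j) γ →
      Φ i γ = Φ j γ)
    {D : Set W} (hD : Convex ℝ D) (hDc : IsCompact D) (h0 : (0 : W) ∈ D) {σ : W → A}
    (hσ : Continuous σ) (hT : ∀ w, σ w ∈ T) : ∃ h, IsPotential V Φ D σ h := by
  classical
  obtain ⟨δ, hδ, hleb⟩ := lebesgue_number_lemma_of_metric hDc (c := fun i => σ ⁻¹' V i)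
    (fun i => (hV i).preimage hσ) (fun w _ => by simpa using hTV (hT w))
  let c : W → W → G := fun p q =>
    if h : ∃ i, InSet (V i) (segPath hσ p q) then Φ h.choose (segPath hσ p q) else 1
  have hc : ∀ p q i, InSet (V i) (segPath hσ p q) → c p q = Φ i (segPath hσ p q) := by
    intro p q i hi
    have h : ∃ i, InSet (V i) (segPath hσ p q) := ⟨i, hi⟩
    simp only [c, dif_pos h]
    exact hag _ _ _ (fun t => hT _) h.choose_spec hi
  obtain ⟨R, hR⟩ := hDc.isBounded.exists_norm_le
  have hball : ∀ {p q : W} {i : ι}, p ∈ D → ∀ {w : W}, w ∈ Metric.ball p δ → q ∈ Metric.ball p δ →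
      Metric.ball p δ ⊆ σ ⁻¹' V i → InSet (V i) (segPath hσ w q) := by
    intro p q i _ w hw hq hi t
    exact hi ((convex_ball p δ).lineMap_mem hw hq ⟨t.2.1, t.2.2⟩)
  obtain ⟨h, ε, hε, hh⟩ := exists_potential (D := D)
    (fun r hr p hp => hD.smul_mem_of_zero_mem h0 hp hr) hR c hδ (by
      intro p hp q hq r hr hpq hqr hpr
      obtain ⟨i, hi⟩ := hleb p hp
      have mp : p ∈ Metric.ball p δ := Metric.mem_ball_self hδ
      have mq : q ∈ Metric.ball p δ := by rwa [Metric.mem_ball, dist_comm]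
      have mr : r ∈ Metric.ball p δ := by rwa [Metric.mem_ball, dist_comm]
      rw [hc p r i (hball hp mp mr hi), hc q r i (hball hp mq mr hi), hc p q i (hball hp mp mq hi)]
      exact segPath_cocycle (hΦ i) (convex_ball p δ) hσ (fun w hw => ⟨hT w, hi hw⟩) mp mq mr)
  refine ⟨h, hσ, ε, hε, fun p hp q hq hpq i hi => ?_⟩
  rw [hh p hp q hq hpq, hc p q i hi]

theorem IsPotential.comp_affine {W' : Type} [NormedAddCommGroup W'] [NormedSpace ℝ W']
    {D : Set W} {D' : Set W'} {σ : W → A} {h : W → G} (H : IsPotential V Φ D σ h) (a : W' →ᴬ[ℝ] W)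
    (ha : MapsTo a D' D) {K : NNReal} (hK : LipschitzWith K a) :
    IsPotential V Φ D' (σ ∘ a) (h ∘ a) := by
  obtain ⟨hσ, δ, hδ, H⟩ := H
  refine ⟨hσ.comp a.continuous, δ / (K + 1), by positivity, fun p hp q hq hpq i hi => ?_⟩
  have hseg : ∀ t, segPath (hσ.comp a.continuous) p q t = segPath hσ (a p) (a q) t := by
    intro t
    simp only [segPath_apply, Function.comp]
    congr 1
    exact AffineMap.apply_lineMap (a : W' →ᵃ[ℝ] W) p q (t : ℝ)
  rw [path_fun_congr (Φ i) _ _ hseg]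
  refine H (a p) (ha hp) (a q) (ha hq) ?_ i (fun t => hseg t ▸ hi t)
  rw [lt_div_iff₀ (by positivity)] at hpq
  calc dist (a p) (a q) ≤ K * dist p q := hK.dist_le_mul p q
    _ ≤ dist p q * (K + 1) := by nlinarith [dist_nonneg (x := p) (y := q)]
    _ < δ := hpq

theorem IsPotential.congr {D : Set W} (hD : Convex ℝ D) {σ σ' : W → A} {h : W → G}
    (H : IsPotential V Φ D σ h) (hσ' : Continuous σ') (he : EqOn σ σ' D) :
    IsPotential V Φ D σ' h := by
  obtain ⟨hσ, δ, hδ, H⟩ := H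
  refine ⟨hσ', δ, hδ, fun p hp q hq hpq i hi => ?_⟩
  have hseg : ∀ t, segPath hσ p q t = segPath hσ' p q t := fun t =>
    he (hD.lineMap_mem hp hq ⟨t.2.1, t.2.2⟩)
  rw [← path_fun_congr (Φ i) _ _ hseg]
  exact H p hp q hq hpq i fun t => (hseg t).symm ▸ hi t

/-- Nearby values of both potentials are related by the same factor, so `h⁻¹ * h'` is locally
constant along the interval. The total change of a potential is therefore determined by the path. -/
theorem IsPotential.unique (hV : ∀ i, IsOpen (V i)) {σ : ℝ → A} {h h' : ℝ → G}
    (hTV : range σ ⊆ ⋃ i, V i) (H : IsPotential V Φ (Icc 0 1) σ h)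
    (H' : IsPotential V Φ (Icc 0 1) σ h') : h 1 * (h 0)⁻¹ = h' 1 * (h' 0)⁻¹ := by
  obtain ⟨hσ, δ, hδ, H⟩ := H
  obtain ⟨_, δ', hδ', H'⟩ := H'
  obtain ⟨ε, hε, hleb⟩ := lebesgue_number_lemma_of_metric (isCompact_Icc (a := (0 : ℝ)) (b := 1))
    (c := fun i => σ ⁻¹' V i)
    (fun i => (hV i).preimage hσ) (fun w _ => by simpa using hTV ⟨w, rfl⟩)
  have hloc : ∀ p ∈ Icc (0 : ℝ) 1, ∀ q ∈ Icc (0 : ℝ) 1, dist p q < min ε (min δ δ') →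
      (h q)⁻¹ * h' q = (h p)⁻¹ * h' p := by
    intro p hp q hq hpq
    simp only [lt_min_iff] at hpq
    obtain ⟨i, hi⟩ := hleb p hp
    have hin : InSet (V i) (segPath hσ p q) := fun t =>
      hi ((convex_ball p ε).lineMap_mem (Metric.mem_ball_self hε)
        (by rw [Metric.mem_ball, dist_comm]; exact hpq.1) ⟨t.2.1, t.2.2⟩)
    rw [H p hp q hq hpq.2.1 i hin, H' p hp q hq hpq.2.2 i hin]
    group
  set η := min ε (min δ δ') with hη
  have hη0 : 0 < η := by positivity
  obtain ⟨n, hn⟩ := exists_nat_gt (1 / η)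
  have hN : (0 : ℝ) < n + 1 := by positivity
  have key : ∀ k : ℕ, k ≤ n + 1 →
      (h (k / (n + 1)))⁻¹ * h' (k / (n + 1)) = (h 0)⁻¹ * h' 0 := by
    intro k
    induction k with
    | zero => intro _; simp
    | succ k ih =>
      intro hk
      rw [← ih (by omega)]
      have hm : ∀ j : ℕ, j ≤ n + 1 → (j / (n + 1) : ℝ) ∈ Icc (0 : ℝ) 1 := fun j hj =>
        ⟨by positivity, by rw [div_le_one hN]; exact_mod_cast hj⟩
      refine hloc _ (hm k (by omega)) _ (hm (k + 1) hk) ?_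
      rw [dist_comm, Real.dist_eq]
      have : ((k + 1 : ℕ) / (n + 1) : ℝ) - k / (n + 1) = 1 / (n + 1) := by push_cast; ring
      rw [this, abs_of_pos (by positivity), div_lt_iff₀ hN]
      rw [div_lt_iff₀ hη0] at hn
      nlinarith
  have h1 := key (n + 1) le_rfl
  have h2 : (((n + 1 : ℕ) : ℝ) / (n + 1)) = 1 := by push_cast; field_simp
  rw [h2] at h1
  have h3 : h' 1 = h 1 * ((h 0)⁻¹ * h' 0) := by rw [← h1]; group
  rw [h3]; group

/-- Seifert and van Kampen: local representations that agree on overlaps glue. -/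
theorem exists_rep_of_cover (hV : ∀ i, IsOpen (V i)) (hTV : T ⊆ ⋃ i, V i)
    (hΦ : ∀ i, IsRep (T ∩ V i) (Φ i))
    (hag : ∀ i j ⦃x y : A⦄ (γ : Path x y), InSet T γ → InSet (V i) γ → InSet (V j) γ →
      Φ i γ = Φ j γ) :
    ∃ Ψ : ∀ ⦃x y : A⦄, Path x y → G, IsRep T Ψ ∧
      ∀ i ⦃x y : A⦄ (γ : Path x y), InSet T γ → InSet (V i) γ → Ψ γ = Φ i γ := by
  classical
  have hex : ∀ ⦃x y : A⦄ (γ : Path x y), InSet T γ →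
      ∃ h, IsPotential V Φ (Icc (0 : ℝ) 1) γ.extend h := fun x y γ hγ =>
    exists_isPotential hV hTV hΦ hag (convex_Icc 0 1) isCompact_Icc ⟨le_rfl, zero_le_one⟩
      γ.continuous_extend fun w => hγ _
  -- The value on a path is the total change of any potential along it.
  let Ψ : ∀ ⦃x y : A⦄, Path x y → G := fun x y γ =>
    if hγ : InSet T γ then (hex γ hγ).choose 1 * ((hex γ hγ).choose 0)⁻¹ else 1
  have hrange : ∀ ⦃x y : A⦄ (γ : Path x y), InSet T γ → range γ.extend ⊆ ⋃ i, V i := by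
    rintro x y γ hγ _ ⟨t, rfl⟩
    exact hTV (hγ _)
  have hΨ : ∀ ⦃x y : A⦄ (γ : Path x y), InSet T γ → ∀ h,
      IsPotential V Φ (Icc (0 : ℝ) 1) γ.extend h → Ψ γ = h 1 * (h 0)⁻¹ := by
    intro x y γ hγ h hh
    simp only [Ψ, dif_pos hγ]
    exact (hex γ hγ).choose_spec.unique hV (hrange γ hγ) hh
  have hconst : ∀ (x : A) (hx : x ∈ T) (σ : ℝ → A) (hσ : σ = fun _ => x) (h : ℝ → G),
      IsPotential V Φ (Icc (0 : ℝ) 1) σ h → h 1 = h 0 := by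
    intro x hx σ hσ h hh
    have h1 : IsPotential V Φ (Icc (0 : ℝ) 1) σ (fun _ => (1 : G)) := by
      subst hσ
      refine ⟨continuous_const, 1, one_pos, fun p hp q hq _ i hi => ?_⟩
      rw [(hΦ i).map_const _ (fun t => ⟨hx, hi t⟩) fun t => rfl, mul_one]
    have := hh.unique hV (by rintro _ ⟨t, rfl⟩; rw [hσ]; exact hTV hx) h1
    rwa [mul_inv_cancel, mul_inv_eq_one] at this
  refine ⟨Ψ, ⟨?_, ?_⟩, ?_⟩
  · intro x y z γ γ' hγ hγ'
    obtain ⟨h, hh⟩ := hex _ (hγ.trans hγ')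
    rw [hΨ _ (hγ.trans hγ') h hh]
    -- Restricting a potential of the concatenation along the parametrizations `a₁`, `a₂` of the two
    -- halves gives potentials of `γ` and `γ'`.
    let a₁ : ℝ →ᴬ[ℝ] ℝ := (1 / 2 : ℝ) • ContinuousAffineMap.id ℝ ℝ
    let a₂ : ℝ →ᴬ[ℝ] ℝ := (1 / 2 : ℝ) • ContinuousAffineMap.id ℝ ℝ +
      ContinuousAffineMap.const ℝ ℝ (1 / 2 : ℝ)
    have ha₁ : ∀ t, a₁ t = t / 2 := fun t => by simp [a₁]; ring
    have ha₂ : ∀ t, a₂ t = (t + 1) / 2 := fun t => by simp [a₂]; ring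
    have hl₁ : LipschitzWith 1 a₁ := LipschitzWith.of_dist_le_mul fun s t => by
      rw [ha₁, ha₁, Real.dist_eq, Real.dist_eq, ← sub_div, abs_div, abs_two]
      simp only [NNReal.coe_one, one_mul]; linarith [abs_nonneg (s - t)]
    have hl₂ : LipschitzWith 1 a₂ := LipschitzWith.of_dist_le_mul fun s t => by
      rw [ha₂, ha₂, Real.dist_eq, Real.dist_eq, ← sub_div, abs_div, abs_two]
      simp only [NNReal.coe_one, one_mul, add_sub_add_right_eq_sub]; linarith [abs_nonneg (s - t)]
    have p₁ := (hh.comp_affine (D' := Icc 0 1) a₁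
      (fun t ht => by rw [ha₁]; exact ⟨by linarith [ht.1], by linarith [ht.2]⟩) hl₁).congr
      (convex_Icc 0 1) γ.continuous_extend (fun t ht => by
        simp only [Function.comp, ha₁]
        rw [Path.extend_trans_of_le_half _ _ (by linarith [ht.2])]
        congr 1; ring)
    have p₂ := (hh.comp_affine (D' := Icc 0 1) a₂
      (fun t ht => by rw [ha₂]; exact ⟨by linarith [ht.1], by linarith [ht.2]⟩) hl₂).congr
      (convex_Icc 0 1) γ'.continuous_extend (fun t ht => by
        simp only [Function.comp, ha₂]
        rw [Path.extend_trans_of_half_le _ _ (by linarith [ht.1])]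
        congr 1; ring)
    rw [hΨ γ hγ _ p₁, hΨ γ' hγ' _ p₂]
    simp only [Function.comp, ha₁, ha₂]
    norm_num
  · intro x y γ γ' F hF
    have hγ : InSet T γ := fun t => by simpa using hF (0, t)
    have hγ' : InSet T γ' := fun t => by simpa using hF (1, t)
    let P : ℝ → unitInterval := projIcc 0 1 zero_le_one
    have hP0 : P 0 = 0 := by simp [P]
    have hP1 : P 1 = 1 := by simp [P]
    have hPc : Continuous P := continuous_projIcc
    -- A potential over the whole homotopy square restricts to its four edges. It does not change
    -- along the two constant edges, so its changes along `γ` and `γ'` coincide.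
    obtain ⟨h, hh⟩ := exists_isPotential (W := ℝ × ℝ) hV hTV hΦ hag
      (D := Icc (0 : ℝ) 1 ×ˢ Icc (0 : ℝ) 1)
      ((convex_Icc 0 1).prod (convex_Icc 0 1)) (isCompact_Icc.prod isCompact_Icc)
      ⟨⟨le_rfl, zero_le_one⟩, ⟨le_rfl, zero_le_one⟩⟩ (σ := fun v => F (P v.1, P v.2))
      (by fun_prop) (fun w => hF _)
    let v : ℝ → ℝ →ᴬ[ℝ] ℝ × ℝ := fun s =>
      (ContinuousAffineMap.const ℝ ℝ s).prod (ContinuousAffineMap.id ℝ ℝ)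
    let w : ℝ → ℝ →ᴬ[ℝ] ℝ × ℝ := fun s =>
      (ContinuousAffineMap.id ℝ ℝ).prod (ContinuousAffineMap.const ℝ ℝ s)
    have hv : ∀ s t, v s t = (s, t) := fun _ _ => rfl
    have hw : ∀ s t, w s t = (t, s) := fun _ _ => rfl
    have hvl : ∀ s, LipschitzWith 1 (v s) := fun s => LipschitzWith.of_dist_le_mul fun a b => by
      simp [hv, Prod.dist_eq]
    have hwl : ∀ s, LipschitzWith 1 (w s) := fun s => LipschitzWith.of_dist_le_mul fun a b => by
      simp [hw, Prod.dist_eq]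
    have hm : ∀ s ∈ Icc (0 : ℝ) 1, MapsTo (v s) (Icc 0 1) (Icc (0 : ℝ) 1 ×ˢ Icc (0 : ℝ) 1) :=
      fun s hs t ht => ⟨hs, ht⟩
    have hm' : ∀ s ∈ Icc (0 : ℝ) 1, MapsTo (w s) (Icc 0 1) (Icc (0 : ℝ) 1 ×ˢ Icc (0 : ℝ) 1) :=
      fun s hs t ht => ⟨ht, hs⟩
    have m0 : (0 : ℝ) ∈ Icc (0 : ℝ) 1 := ⟨le_rfl, zero_le_one⟩
    have m1 : (1 : ℝ) ∈ Icc (0 : ℝ) 1 := ⟨zero_le_one, le_rfl⟩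
    have b0 := (hh.comp_affine (v 0) (hm 0 m0) (hvl 0)).congr (convex_Icc 0 1) γ.continuous_extend
      (fun t ht => by simp only [Function.comp, hv, hP0]; simp [Path.extend, IccExtend, P])
    have b1 := (hh.comp_affine (v 1) (hm 1 m1) (hvl 1)).congr (convex_Icc 0 1) γ'.continuous_extend
      (fun t ht => by simp only [Function.comp, hv, hP1]; simp [Path.extend, IccExtend, P])
    have c0 := hconst x hγ.source _ (by ext t; simp [hw, hP0])
      _ (hh.comp_affine (w 0) (hm' 0 m0) (hwl 0))
    have c1 := hconst y hγ.target _ (by ext t; simp [hw, hP1])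
      _ (hh.comp_affine (w 1) (hm' 1 m1) (hwl 1))
    rw [hΨ γ hγ _ b0, hΨ γ' hγ' _ b1]
    simp only [Function.comp, hv, hw] at c0 c1 ⊢
    rw [c0, c1]
  · intro i x y γ hγ hi
    have hmap : ∀ w, γ.extend w ∈ T ∩ V i := fun w => ⟨hγ _, hi _⟩
    -- For a path inside one `V i`, a potential is the value of `Φ i` on the segment from the start.
    rw [hΨ γ hγ (fun p => Φ i (segPath γ.continuous_extend 0 p)) ⟨γ.continuous_extend, 1, one_pos, ?_⟩]
    · have h00 : Φ i (segPath γ.continuous_extend (0 : ℝ) 0) = 1 :=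
        (hΦ i).map_const _ (fun t => hmap _) fun t => by simp [segPath_apply]
      rw [h00, inv_one, mul_one]
      exact path_fun_congr (Φ i) _ _ fun t => by
        rw [segPath_apply]
        simp [AffineMap.lineMap_apply]
    · intro p hp q hq _ j hj
      rw [← hag i j (segPath γ.continuous_extend p q) (fun t => hγ _) (fun t => hi _) hj]
      exact segPath_cocycle (hΦ i) convex_univ _ (fun w _ => hmap w) trivial trivial trivial

end VanKampen

/-! ### Attaching a closed piece along a collared boundary. -/

section Attach

variable {A : Type} [TopologicalSpace A]

theorem RepEq.mono {S T : Set A} (h : S ⊆ T) {x y : A} {γ γ' : Path x y} (H : RepEq S γ γ') :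
    RepEq T γ γ' := fun G _ Φ hΦ => H G Φ (hΦ.mono h)

/-- Every path in `T` between points of `S` is equivalent in `T` to a path in `S`. -/
def IsFull (S T : Set A) : Prop :=
  ∀ ⦃x y : A⦄ (γ : Path x y), x ∈ S → y ∈ S → InSet T γ →
    ∃ δ : Path x y, InSet S δ ∧ RepEq T δ γ

theorem IsFull.trans {R S T : Set A} (hRS : R ⊆ S) (hST : S ⊆ T) (h : IsFull R S)
    (h' : IsFull S T) : IsFull R T := by
  intro x y γ hx hy hγ
  obtain ⟨δ, hδ, hδγ⟩ := h' γ (hRS hx) (hRS hy) hγ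
  obtain ⟨η, hη, hηδ⟩ := h δ hx hy hδ
  exact ⟨η, hη, fun G _ Φ hΦ => (hηδ.mono hST G Φ hΦ).trans (hδγ G Φ hΦ)⟩

/-- Since `f` is continuous only on `T`, paths and homotopies are composed with `f` only when they
lie in `T`. -/
theorem IsRep.exists_pullback {A' : Type} [TopologicalSpace A'] {G : Type} [Group G] {S : Set A}
    {T : Set A'} {Φ : ∀ ⦃x y : A⦄, Path x y → G} (hΦ : IsRep S Φ) {f : A' → A}
    (hf : ContinuousOn f T) (hfT : MapsTo f T S) :
    ∃ Ψ : ∀ ⦃x y : A'⦄, Path x y → G, IsRep T Ψ ∧ ∀ ⦃x y : A'⦄ (γ : Path x y), InSet T γ →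
      ∀ ⦃x' y' : A⦄ (δ : Path x' y'), (∀ t, δ t = f (γ t)) → Ψ γ = Φ δ := by
  classical
  have hc : ∀ ⦃x y : A'⦄ (γ : Path x y), InSet T γ → ContinuousOn f (range γ) := fun x y γ hγ =>
    hf.mono (by rintro _ ⟨t, rfl⟩; exact hγ t)
  let Ψ : ∀ ⦃x y : A'⦄, Path x y → G := fun x y γ =>
    if hγ : InSet T γ then Φ (γ.map' (hc γ hγ)) else 1
  have key : ∀ ⦃x y : A'⦄ (γ : Path x y), InSet T γ →
      ∀ ⦃x' y' : A⦄ (δ : Path x' y'), (∀ t, δ t = f (γ t)) → Ψ γ = Φ δ := by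
    intro x y γ hγ x' y' δ hδ
    simp only [Ψ, dif_pos hγ]
    exact path_fun_congr Φ _ _ fun t => (hδ t).symm
  refine ⟨Ψ, ⟨?_, ?_⟩, key⟩
  · intro x y z γ γ' hγ hγ'
    rw [key γ hγ (γ.map' (hc γ hγ)) (fun _ => rfl), key γ' hγ' (γ'.map' (hc γ' hγ')) (fun _ => rfl),
      ← hΦ.trans _ _ (fun t => hfT (hγ t)) (fun t => hfT (hγ' t))]
    refine key _ (hγ.trans hγ') _ fun t => ?_
    rw [Path.trans_apply, Path.trans_apply]
    split_ifs <;> rfl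
  · intro x y γ γ' F hF
    have hγ : InSet T γ := fun t => by simpa using hF (0, t)
    have hγ' : InSet T γ' := fun t => by simpa using hF (1, t)
    rw [key γ hγ (γ.map' (hc γ hγ)) (fun _ => rfl), key γ' hγ' (γ'.map' (hc γ' hγ')) (fun _ => rfl)]
    refine hΦ.hom _ _ ⟨⟨⟨fun p => f (F p), hf.comp_continuous F.continuous hF⟩, ?_, ?_⟩, ?_⟩
      fun p => hfT (hF p)
    · intro t; simp; rfl
    · intro t; simp; rfl
    · intro t s hs
      rcases hs with rfl | rfl <;> simp

/-- The set `B` has a collar of `S` relative to `Z`: away from a closed set disjoint from `S`,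
the set `B ∩ Z` retracts onto `S ∩ Z` along tracks in `B ∩ Z`. -/
def IsCollared (Z B S : Set A) : Prop :=
  ∃ (core : Set A) (H : unitInterval × A → A), IsClosed core ∧ core ⊆ B ∧ Disjoint core S ∧
    ContinuousOn H (univ ×ˢ ((B ∩ Z) \ core)) ∧
    ∀ x ∈ (B ∩ Z) \ core, H (0, x) ∈ S ∧ (∀ s, H (s, x) ∈ B ∩ Z) ∧ H (1, x) = x ∧
      (x ∈ S → ∀ s, H (s, x) = x)

theorem continuousOn_of_closed_cover {α β : Type} [TopologicalSpace α] [TopologicalSpace β]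
    {f : α → β} {s C B : Set α} (hC : IsClosed C) (hB : IsClosed B) (hs : s ⊆ C ∪ B)
    (h1 : ContinuousOn f (s ∩ C)) (h2 : ContinuousOn f (s ∩ B)) : ContinuousOn f s := by
  have aux : ∀ D : Set α, IsClosed D → ContinuousOn f (s ∩ D) → ∀ x ∈ s,
      ContinuousWithinAt f (s ∩ D) x := by
    intro D hD h x hx
    by_cases hxD : x ∈ D
    · exact h x ⟨hx, hxD⟩
    · refine continuousWithinAt_of_notMem_closure fun hcl => hxD ?_
      exact hD.closure_subset_iff.mpr inter_subset_right hcl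
  intro x hx
  have := (aux C hC h1 x hx).union (aux B hB h2 x hx)
  rwa [← inter_union_distrib_left, inter_eq_left.mpr hs] at this

/-- The tracks of the points of `C ∪ B` to `C`. -/
theorem exists_tracks {Z C B : Set A} (hC : IsClosed C) (hB : IsClosed B)
    (hcol : IsCollared Z B (C ∩ B))
    (hjoin : ∀ y ∈ B ∩ Z, ∃ x ∈ C ∩ B ∩ Z, ∃ p : Path x y, InSet (B ∩ Z) p) :
    ∃ (core : Set A) (H : unitInterval × A → A) (ρ : A → A) (p : ∀ y, Path (ρ y) y),
      IsClosed core ∧ Disjoint core C ∧ ContinuousOn H (univ ×ˢ (((C ∪ B) ∩ Z) \ core)) ∧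
      (∀ x ∈ (C ∪ B) ∩ Z, ρ x ∈ C ∩ Z ∧ InSet ((C ∪ B) ∩ Z) (p x)) ∧
      (∀ x ∈ B ∩ Z, ρ x ∈ C ∩ B ∧ InSet (B ∩ Z) (p x)) ∧
      (∀ x ∈ ((C ∪ B) ∩ Z) \ core, H (0, x) ∈ C ∩ Z ∧ (∀ s, H (s, x) ∈ (C ∪ B) ∩ Z) ∧
        ∀ s, p x s = H (s, x)) ∧
      (∀ x ∈ C ∩ Z, ∀ s, H (s, x) = x) ∧
      (∀ x ∈ (B ∩ Z) \ core, H (0, x) ∈ C ∩ B ∧ ∀ s, H (s, x) ∈ B ∩ Z) := by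
  classical
  obtain ⟨core, H, hcore, hcB, hdisj, hH, hprop⟩ := hcol
  -- The collar of `B` is extended by the identity on `C`. The two definitions match because the
  -- collar fixes the points of `C ∩ B`.
  let H' : unitInterval × A → A := fun q => if q.2 ∈ C then q.2 else H q
  have hcC : Disjoint core C := by
    rw [Set.disjoint_left] at hdisj ⊢
    exact fun x hx hxC => hdisj hx ⟨hxC, hcB hx⟩
  have hH'C : ∀ s, ∀ x ∈ C, H' (s, x) = x := fun s x hx => by simp [H', hx]
  have hH'B : ∀ s, ∀ x ∈ (B ∩ Z) \ core, H' (s, x) = H (s, x) := by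
    intro s x hx
    by_cases hxC : x ∈ C
    · rw [hH'C s x hxC, (hprop x hx).2.2.2 ⟨hxC, hx.1.1⟩]
    · simp [H', hxC]
  have hcont : ContinuousOn H' (univ ×ˢ (((C ∪ B) ∩ Z) \ core)) := by
    refine continuousOn_of_closed_cover (C := univ ×ˢ C) (B := univ ×ˢ B) (isClosed_univ.prod hC)
      (isClosed_univ.prod hB) ?_ ?_ ?_
    · rintro ⟨s, x⟩ ⟨-, hx⟩
      rcases hx.1.1 with h | h
      · exact Or.inl ⟨trivial, h⟩
      · exact Or.inr ⟨trivial, h⟩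
    · refine continuousOn_snd.congr ?_
      rintro ⟨s, x⟩ hx
      exact hH'C s x hx.2.2
    · refine (hH.mono ?_).congr ?_
      · rintro ⟨s, x⟩ hx
        exact ⟨trivial, ⟨hx.2.2, hx.1.2.1.2⟩, hx.1.2.2⟩
      · rintro ⟨s, x⟩ hx
        exact hH'B s x ⟨⟨hx.2.2, hx.1.2.1.2⟩, hx.1.2.2⟩
  have hT : ∀ x ∈ ((C ∪ B) ∩ Z) \ core, H' (0, x) ∈ C ∩ Z ∧ (∀ s, H' (s, x) ∈ (C ∪ B) ∩ Z) ∧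
      H' (1, x) = x := by
    intro x hx
    by_cases hxC : x ∈ C
    · simp only [hH'C _ x hxC]
      exact ⟨⟨hxC, hx.1.2⟩, fun _ => hx.1, trivial⟩
    · have hxB : x ∈ (B ∩ Z) \ core := ⟨⟨hx.1.1.resolve_left hxC, hx.1.2⟩, hx.2⟩
      simp only [hH'B _ x hxB]
      obtain ⟨h0, hs, h1, -⟩ := hprop x hxB
      exact ⟨⟨h0.1, (hs 0).2⟩, fun s => ⟨Or.inr (hs s).1, (hs s).2⟩, h1⟩
  have hTB : ∀ x ∈ (B ∩ Z) \ core, H' (0, x) ∈ C ∩ B ∧ ∀ s, H' (s, x) ∈ B ∩ Z := by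
    intro x hx
    simp only [hH'B _ x hx]
    exact ⟨(hprop x hx).1, (hprop x hx).2.1⟩
  have hex : ∀ y, ∃ (x : A) (p : Path x y),
      (y ∈ (C ∪ B) ∩ Z → x ∈ C ∩ Z ∧ InSet ((C ∪ B) ∩ Z) p) ∧
      (y ∈ B ∩ Z → x ∈ C ∩ B ∧ InSet (B ∩ Z) p) ∧
      (y ∈ ((C ∪ B) ∩ Z) \ core → ∀ s, p s = H' (s, y)) := by
    intro y
    by_cases hy : y ∈ (C ∪ B) ∩ Z
    · by_cases hyc : y ∈ core
      · obtain ⟨x, hx, p, hp⟩ := hjoin y ⟨hcB hyc, hy.2⟩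
        exact ⟨x, p, fun _ => ⟨⟨hx.1.1, hx.2⟩, hp.mono (by exact fun z hz => ⟨Or.inr hz.1, hz.2⟩)⟩,
          fun _ => ⟨hx.1, hp⟩, fun h => absurd hyc h.2⟩
      · have hy' : y ∈ ((C ∪ B) ∩ Z) \ core := ⟨hy, hyc⟩
        refine ⟨H' (0, y), ⟨⟨fun s => H' (s, y), ?_⟩, rfl, (hT y hy').2.2⟩, fun _ => ?_, fun h => ?_,
          fun _ _ => rfl⟩
        · exact hcont.comp_continuous (f := fun s => (s, y)) (by fun_prop) fun s => mk_mem_prod trivial hy'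
        · exact ⟨(hT y hy').1, fun s => (hT y hy').2.1 s⟩
        · exact ⟨(hTB y ⟨h, hyc⟩).1, fun s => (hTB y ⟨h, hyc⟩).2 s⟩
    · exact ⟨y, Path.refl y, fun h => absurd h hy, fun h => absurd ⟨Or.inr h.1, h.2⟩ hy,
        fun h => absurd h.1 hy⟩
  choose ρ p h1 h2 h3 using hex
  exact ⟨core, H', ρ, p, hcore, hcC, hcont, h1, h2,
    fun x hx => ⟨(hT x hx).1, (hT x hx).2.1, h3 x hx⟩, fun x hx s => hH'C s x hx.1, hTB⟩

/-- Correct a path at both ends by tracks to `C`; the result is shown to be equivalent to a path in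
`C`. This is multiplicative, so it may be checked on the open cover by the complements of the core
and of `C`: near `C` the collar retracts the path, and inside `B` fullness of the attaching region
applies. -/
theorem IsFull.attach {Z C B : Set A} (hC : IsClosed C) (hB : IsClosed B)
    (hcol : IsCollared Z B (C ∩ B))
    (hjoin : ∀ y ∈ B ∩ Z, ∃ x ∈ C ∩ B ∩ Z, ∃ p : Path x y, InSet (B ∩ Z) p)
    (hfull : IsFull (C ∩ B ∩ Z) (B ∩ Z)) : IsFull (C ∩ Z) ((C ∪ B) ∩ Z) := by
  obtain ⟨core, H, ρ, p, hcore, hcC, hcont, h1, h2, h3, h4, h5⟩ := exists_tracks hC hB hcol hjoin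
  have hBY : B ∩ Z ⊆ (C ∪ B) ∩ Z := fun x hx => ⟨Or.inr hx.1, hx.2⟩
  have key : ∀ ⦃y z : A⦄ (γ : Path y z), InSet ((C ∪ B) ∩ Z) γ →
      ∃ δ : Path (ρ y) (ρ z), InSet (C ∩ Z) δ ∧ ∀ (G : Type) [Group G]
        (Φ : ∀ ⦃x y : A⦄, Path x y → G), IsRep ((C ∪ B) ∩ Z) Φ →
          Φ δ = (Φ (p z))⁻¹ * Φ γ * Φ (p y) := by
    intro y z γ hγ
    refine path_induction (V := fun b : Bool => bif b then Cᶜ else coreᶜ) ?_ ?_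
      (fun y z γ => ∃ δ : Path (ρ y) (ρ z), InSet (C ∩ Z) δ ∧ ∀ (G : Type) [Group G]
        (Φ : ∀ ⦃x y : A⦄, Path x y → G), IsRep ((C ∪ B) ∩ Z) Φ →
          Φ δ = (Φ (p z))⁻¹ * Φ γ * Φ (p y)) ?_ ?_ ?_ γ hγ
    · rintro (_ | _)
      exacts [hcore.isOpen_compl, hC.isOpen_compl]
    · intro x _
      by_cases hx : x ∈ C
      · exact mem_iUnion.2 ⟨false, fun h => Set.disjoint_left.1 hcC h hx⟩
      · exact mem_iUnion.2 ⟨true, hx⟩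
    · rintro x y γ γ' - - he ⟨δ, hδ, h⟩
      exact ⟨δ, hδ, fun G _ Φ hΦ => by rw [h G Φ hΦ, he G Φ hΦ]⟩
    · rintro x y z γ γ' hγ hγ' ⟨δ, hδ, h⟩ ⟨δ', hδ', h'⟩
      refine ⟨δ.trans δ', hδ.trans hδ', fun G _ Φ hΦ => ?_⟩
      have hsub : C ∩ Z ⊆ (C ∪ B) ∩ Z := fun x hx => ⟨Or.inl hx.1, hx.2⟩
      rw [hΦ.trans _ _ (hδ.mono hsub) (hδ'.mono hsub), hΦ.trans _ _ hγ hγ', h G Φ hΦ, h' G Φ hΦ]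
      group
    · rintro (_ | _) x y γ hγ hi
      -- Off the core, the tracks sweep out a square between `γ` and its retraction into `C`.
      · have hγ' : ∀ t, γ t ∈ ((C ∪ B) ∩ Z) \ core := fun t => ⟨hγ t, hi t⟩
        have hF : Continuous fun q : unitInterval × unitInterval => H (q.2, γ q.1) :=
          hcont.comp_continuous (f := fun q : unitInterval × unitInterval => (q.2, γ q.1))
            (by fun_prop) fun q => mk_mem_prod trivial (hγ' q.1)
        have hx : x ∈ ((C ∪ B) ∩ Z) \ core := by simpa using hγ' 0
        have hy : y ∈ ((C ∪ B) ∩ Z) \ core := by simpa using hγ' 1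
        have ex : H (0, x) = ρ x := by simpa using ((h3 x hx).2.2 0).symm
        have ey : H (0, y) = ρ y := by simpa using ((h3 y hy).2.2 0).symm
        let δ : Path (ρ x) (ρ y) := ⟨⟨fun t => H (0, γ t),
          hF.comp (by fun_prop : Continuous fun t : unitInterval => (t, (0 : unitInterval)))⟩,
          by simpa using ex, by simpa using ey⟩
        refine ⟨δ, fun t => (h3 _ (hγ' t)).1, fun G _ Φ hΦ => ?_⟩
        have hone : ∀ t, H (1, γ t) = γ t := fun t => by
          rw [← (h3 _ (hγ' t)).2.2 1]; simp
        have := hΦ.square (fun q => H (q.2, γ q.1)) hF (fun q => (h3 _ (hγ' q.1)).2.1 q.2) δ γ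
          (p x) (p y) (fun t => rfl) (fun t => (hone t).symm) (fun t => by simpa using (h3 x hx).2.2 t)
          (fun t => by simpa using (h3 y hy).2.2 t)
        rw [mul_assoc, this]; group
      · have hγ' : InSet (B ∩ Z) γ := fun t => ⟨(hγ t).1.resolve_left (hi t), (hγ t).2⟩
        obtain ⟨hx, hpx⟩ := h2 x hγ'.source
        obtain ⟨hy, hpy⟩ := h2 y hγ'.target
        obtain ⟨δ, hδ, h⟩ := hfull (((p x).trans γ).trans (p y).symm)
          ⟨hx, hpx.source.2⟩ ⟨hy, hpy.source.2⟩ ((hpx.trans hγ').trans hpy.symm)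
        refine ⟨δ, hδ.mono (by exact fun z hz => ⟨hz.1.1, hz.2⟩), fun G _ Φ hΦ => ?_⟩
        rw [h G Φ (hΦ.mono hBY), (hΦ.mono hBY).map_conj _ _ _ hpx hγ' hpy]
  intro x y γ hx hy hγ
  obtain ⟨δ, hδ, h⟩ := key γ hγ
  have hcx : ∀ z ∈ C ∩ Z, ∀ s, p z s = z := fun z hz s => by
    rw [(h3 z ⟨⟨Or.inl hz.1, hz.2⟩, fun h => Set.disjoint_left.1 hcC h hz.1⟩).2.2 s, h4 z hz]
  have e : ∀ z ∈ C ∩ Z, z = ρ z := fun z hz => by simpa using (hcx z hz 0).symm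
  refine ⟨δ.cast (e x hx) (e y hy), hδ, fun G _ Φ hΦ => ?_⟩
  have hc1 : ∀ z ∈ C ∩ Z, Φ (p z) = 1 := fun z hz =>
    hΦ.map_const _ (h1 z ⟨Or.inl hz.1, hz.2⟩).2 fun t => by rw [hcx z hz t]; exact e z hz
  rw [path_fun_congr Φ (δ.cast (e x hx) (e y hy)) δ (fun _ => rfl), h G Φ hΦ, hc1 x hx, hc1 y hy]
  simp

/-- On `B`, a path is evaluated by moving it with tracks to a path in `C ∩ B` and applying `Φ`;
`hker` is exactly what makes this well defined. Off the core, `Φ` is pulled back along the collar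
retraction. Both prescriptions agree where both apply, so they glue. -/
theorem IsRep.exists_attach {Z C B : Set A} {G : Type} [Group G]
    {Φ : ∀ ⦃x y : A⦄, Path x y → G} (hΦ : IsRep (C ∩ Z) Φ) (hC : IsClosed C) (hB : IsClosed B)
    (hcol : IsCollared Z B (C ∩ B))
    (hjoin : ∀ y ∈ B ∩ Z, ∃ x ∈ C ∩ B ∩ Z, ∃ p : Path x y, InSet (B ∩ Z) p)
    (hfull : IsFull (C ∩ B ∩ Z) (B ∩ Z))
    (hker : ∀ ⦃x y : A⦄ (γ γ' : Path x y), InSet (C ∩ B ∩ Z) γ → InSet (C ∩ B ∩ Z) γ' →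
      RepEq (B ∩ Z) γ γ' → Φ γ = Φ γ') :
    ∃ Ψ : ∀ ⦃x y : A⦄, Path x y → G, IsRep ((C ∪ B) ∩ Z) Ψ ∧
      ∀ ⦃x y : A⦄ (γ : Path x y), InSet (C ∩ Z) γ → Ψ γ = Φ γ := by
  classical
  obtain ⟨core, H, ρ, p, hcore, hcC, hcont, h1, h2, h3, h4, h5⟩ := exists_tracks hC hB hcol hjoin
  obtain ⟨Φ₂, hΦ₂, hΦ₂'⟩ := hΦ.exists_pullback (T := ((C ∪ B) ∩ Z) \ core) (f := fun x => H (0, x))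
    (hcont.comp (f := fun x => ((0 : unitInterval), x)) (by fun_prop) fun x hx => mk_mem_prod trivial hx) (fun x hx => (h3 x hx).1)
  have hSC : C ∩ B ∩ Z ⊆ C ∩ Z := fun x hx => ⟨hx.1.1, hx.2⟩
  have hSB : C ∩ B ∩ Z ⊆ B ∩ Z := fun x hx => ⟨hx.1.2, hx.2⟩
  have hδ : ∀ ⦃y z : A⦄ (γ : Path y z), InSet (B ∩ Z) γ → ∃ δ : Path (ρ y) (ρ z),
      InSet (C ∩ B ∩ Z) δ ∧ RepEq (B ∩ Z) δ (((p y).trans γ).trans (p z).symm) := by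
    intro y z γ hγ
    obtain ⟨hx, hpx⟩ := h2 y hγ.source
    obtain ⟨hy, hpy⟩ := h2 z hγ.target
    exact hfull (((p y).trans γ).trans (p z).symm)
      ⟨hx, hpx.source.2⟩ ⟨hy, hpy.source.2⟩ ((hpx.trans hγ).trans hpy.symm)
  let Φ₁ : ∀ ⦃x y : A⦄, Path x y → G := fun x y γ =>
    if h : InSet (B ∩ Z) γ then Φ (hδ γ h).choose else 1
  have hΦ₁ : ∀ ⦃y z : A⦄ (γ : Path y z), InSet (B ∩ Z) γ → ∀ δ : Path (ρ y) (ρ z),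
      InSet (C ∩ B ∩ Z) δ → (∀ (G : Type) [Group G]
        (Φ : ∀ ⦃x y : A⦄, Path x y → G), IsRep (B ∩ Z) Φ → Φ δ = (Φ (p z))⁻¹ * Φ γ * Φ (p y)) →
      Φ₁ γ = Φ δ := by
    intro y z γ hγ δ hδS hd
    simp only [Φ₁, dif_pos hγ]
    have hs := (hδ γ hγ).choose_spec
    refine hker _ _ hs.1 hδS fun G _ Φ' hΦ' => ?_
    rw [hs.2 G Φ' hΦ', hd G Φ' hΦ', hΦ'.map_conj _ _ _ (h2 y hγ.source).2 hγ (h2 z hγ.target).2]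
  have hΦ₁r : IsRep (B ∩ Z) Φ₁ := by
    constructor
    · intro x y z γ γ' hγ hγ'
      obtain ⟨δ, hδS, hd⟩ := hδ γ hγ
      obtain ⟨δ', hδS', hd'⟩ := hδ γ' hγ'
      have px := (h2 x hγ.source).2
      have py := (h2 y hγ.target).2
      have pz := (h2 z hγ'.target).2
      rw [hΦ₁ γ hγ δ hδS (fun G _ Φ' hΦ' => by rw [hd G Φ' hΦ', hΦ'.map_conj _ _ _ px hγ py]),
        hΦ₁ γ' hγ' δ' hδS' (fun G _ Φ' hΦ' => by rw [hd' G Φ' hΦ', hΦ'.map_conj _ _ _ py hγ' pz]),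
        ← hΦ.trans _ _ (hδS.mono hSC) (hδS'.mono hSC)]
      refine hΦ₁ _ (hγ.trans hγ') _ (hδS.trans hδS') fun G _ Φ' hΦ' => ?_
      rw [hΦ'.trans _ _ (hδS.mono hSB) (hδS'.mono hSB), hd G Φ' hΦ', hd' G Φ' hΦ',
        hΦ'.map_conj _ _ _ px hγ py, hΦ'.map_conj _ _ _ py hγ' pz, hΦ'.trans _ _ hγ hγ']
      group
    · intro x y γ γ' F hF
      have hγ : InSet (B ∩ Z) γ := fun t => by simpa using hF (0, t)
      have hγ' : InSet (B ∩ Z) γ' := fun t => by simpa using hF (1, t)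
      obtain ⟨δ, hδS, hd⟩ := hδ γ hγ
      have px := (h2 x hγ.source).2
      have py := (h2 y hγ.target).2
      rw [hΦ₁ γ hγ δ hδS (fun G _ Φ' hΦ' => by rw [hd G Φ' hΦ', hΦ'.map_conj _ _ _ px hγ py]),
        hΦ₁ γ' hγ' δ hδS (fun G _ Φ' hΦ' => by
          rw [hd G Φ' hΦ', hΦ'.map_conj _ _ _ px hγ py, hΦ'.hom γ γ' F hF])]
  -- The collar retraction of `γ` is itself an admissible replacement in the definition of `Φ₁`, by
  -- the square of its tracks.
  have hag : ∀ ⦃x y : A⦄ (γ : Path x y), InSet (B ∩ Z) γ → InSet coreᶜ γ → Φ₁ γ = Φ₂ γ := by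
    intro x y γ hγ hi
    have hBT : ∀ z ∈ (B ∩ Z) \ core, z ∈ ((C ∪ B) ∩ Z) \ core :=
      fun z hz => ⟨⟨Or.inr hz.1.1, hz.1.2⟩, hz.2⟩
    have hγ' : ∀ t, γ t ∈ (B ∩ Z) \ core := fun t => ⟨hγ t, hi t⟩
    have hF : Continuous fun q : unitInterval × unitInterval => H (q.2, γ q.1) :=
      hcont.comp_continuous (f := fun q : unitInterval × unitInterval => (q.2, γ q.1))
            (by fun_prop) fun q => mk_mem_prod trivial (hBT _ (hγ' q.1))
    have hx : x ∈ (B ∩ Z) \ core := by simpa using hγ' 0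
    have hy : y ∈ (B ∩ Z) \ core := by simpa using hγ' 1
    have px := (h3 x (hBT x hx)).2.2
    have py := (h3 y (hBT y hy)).2.2
    have ex : H (0, x) = ρ x := by simpa using (px 0).symm
    have ey : H (0, y) = ρ y := by simpa using (py 0).symm
    let δ : Path (ρ x) (ρ y) := ⟨⟨fun t => H (0, γ t),
      hF.comp (by fun_prop : Continuous fun t : unitInterval => (t, (0 : unitInterval)))⟩,
      by simpa using ex, by simpa using ey⟩
    rw [hΦ₂' γ (fun t => hBT _ (hγ' t)) δ fun _ => rfl]
    refine hΦ₁ γ hγ δ (fun t => ⟨(h5 _ (hγ' t)).1, ((h5 _ (hγ' t)).2 0).2⟩) fun G _ Φ' hΦ' => ?_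
    have hone : ∀ t, H (1, γ t) = γ t := fun t => by
      rw [← (h3 _ (hBT _ (hγ' t))).2.2 1]; simp
    have := hΦ'.square (fun q => H (q.2, γ q.1)) hF (fun q => (h5 _ (hγ' q.1)).2 q.2) δ γ
      (p x) (p y) (fun t => rfl) (fun t => (hone t).symm) (fun t => by simpa using px t)
      (fun t => by simpa using py t)
    rw [mul_assoc, this]; group
  obtain ⟨Ψ, hΨ, hΨ'⟩ := exists_rep_of_cover (T := (C ∪ B) ∩ Z)
    (V := fun b : Bool => bif b then Cᶜ else coreᶜ)
    (Φ := fun b : Bool => match b with | true => Φ₁ | false => Φ₂)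
    (by rintro (_ | _); exacts [hcore.isOpen_compl, hC.isOpen_compl])
    (by
      intro x _
      by_cases hx : x ∈ C
      · exact mem_iUnion.2 ⟨false, fun h => Set.disjoint_left.1 hcC h hx⟩
      · exact mem_iUnion.2 ⟨true, hx⟩)
    (by
      rintro (_ | _)
      · exact hΦ₂
      · exact hΦ₁r.mono (by exact fun x hx => ⟨hx.1.1.resolve_left hx.2, hx.1.2⟩))
    (by
      have aux : ∀ ⦃x y : A⦄ (γ : Path x y), InSet ((C ∪ B) ∩ Z) γ → InSet Cᶜ γ →
          InSet (B ∩ Z) γ := fun x y γ h h' t => ⟨(h t).1.resolve_left (h' t), (h t).2⟩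
      rintro (_ | _) (_ | _) x y γ hγ hi hj
      · rfl
      · exact (hag γ (aux γ hγ hj) hi).symm
      · exact hag γ (aux γ hγ hi) hj
      · rfl)
  refine ⟨Ψ, hΨ, fun x y γ hγ => ?_⟩
  have hcn : InSet coreᶜ γ := fun t h => Set.disjoint_left.1 hcC h (hγ t).1
  have hin : InSet ((C ∪ B) ∩ Z) γ := hγ.mono (by exact fun x hx => ⟨Or.inl hx.1, hx.2⟩)
  rw [hΨ' false γ hin hcn]
  exact hΦ₂' γ (fun t => ⟨hin t, hcn t⟩) γ fun t => (h4 _ (hγ t) 0).symm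

end Attach

/-! ### Homomorphisms presented by finitely many relators. -/

section Relators

/-- The homomorphism `Θ` is the quotient map by `d` relators. -/
def HasRelators {G H : Type} [Group G] [Group H] (Θ : G →* H) (d : ℕ) : Prop :=
  ∃ r : Fin d → G, (∀ i, Θ (r i) = 1) ∧
    ∃ σ : H →* G ⧸ Subgroup.normalClosure (range r), ∀ g, σ (Θ g) = (g : G ⧸ _)

theorem HasRelators.exists_ker_eq {G H : Type} [Group G] [Group H] {Θ : G →* H} {d : ℕ}
    (h : HasRelators Θ d) : ∃ r : Fin d → G, Θ.ker = Subgroup.normalClosure (range r) := by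
  obtain ⟨r, hr, σ, hσ⟩ := h
  refine ⟨r, le_antisymm (fun g hg => ?_) (Subgroup.normalClosure_le_normal ?_)⟩
  · rw [← QuotientGroup.eq_one_iff, ← hσ, MonoidHom.mem_ker.1 hg, map_one]
  · rintro _ ⟨i, rfl⟩
    exact hr i

theorem exists_quotient_map {G G' : Type} [Group G] [Group G'] (lam : G' →* G) {d d' : ℕ}
    (r' : Fin d' → G') (r : Fin d → G)
    (h : ∀ i, lam (r' i) ∈ Subgroup.normalClosure (range r)) :
    ∃ m : G' ⧸ Subgroup.normalClosure (range r') →* G ⧸ Subgroup.normalClosure (range r),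
      ∀ g : G', m (g : G' ⧸ _) = (lam g : G ⧸ _) := by
  refine ⟨QuotientGroup.map _ _ lam (Subgroup.normalClosure_le_normal ?_), fun g => rfl⟩
  rintro _ ⟨i, rfl⟩
  exact h i

/-- If `Θ` is a retract of `Θ'`, relators of `Θ'` are carried to relators of `Θ` by `lam`. Because
`lam` splits `nu`, no new ones are needed, so their number is preserved under changes of the graph.
-/
theorem HasRelators.of_retract {G H G' H' : Type} [Group G] [Group H] [Group G'] [Group H']
    {Θ : G →* H} {Θ' : G' →* H'} {d : ℕ} (h : HasRelators Θ' d) (lam : G' →* G) (nu : G →* G')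
    (kap : H' →* H) (mu : H →* H') (h1 : ∀ g, lam (nu g) = g) (h2 : ∀ g, Θ (lam g) = kap (Θ' g))
    (h3 : ∀ g, mu (Θ g) = Θ' (nu g)) : HasRelators Θ d := by
  obtain ⟨r, hr, σ, hσ⟩ := h
  obtain ⟨m, hm⟩ := exists_quotient_map lam r (fun i => lam (r i))
    fun i => Subgroup.subset_normalClosure ⟨i, rfl⟩
  refine ⟨fun i => lam (r i), fun i => by rw [h2, hr, map_one], (m.comp σ).comp mu, fun g => ?_⟩
  simp only [MonoidHom.comp_apply]
  rw [h3, hσ, hm, h1]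

end Relators

/-! ### Labelled graphs with surjective homomorphism: deleting or contracting trivial edges. -/

section Folding

variable {T I V : Type}

/-- The homomorphism attached to a based graph with vertices `V` and edges `I`, labelled by elements
of a free group: the extra generator goes to the base vertex. -/
def graphHom (v₀ : V) (s t : I → V) (w : I → FreeGroup T) :
    FreeGroup (Option I) →* FreeGroup (T ⊕ V) :=
  FreeGroup.lift fun o => o.elim (FreeGroup.of (Sum.inr v₀)) fun i =>
    FreeGroup.of (Sum.inr (s i)) * FreeGroup.map Sum.inl (w i) * (FreeGroup.of (Sum.inr (t i)))⁻¹

@[simp] theorem graphHom_none (v₀ : V) (s t : I → V) (w : I → FreeGroup T) :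
    graphHom v₀ s t w (FreeGroup.of none) = FreeGroup.of (Sum.inr v₀) := by
  simp [graphHom]

@[simp] theorem graphHom_some (v₀ : V) (s t : I → V) (w : I → FreeGroup T) (i : I) :
    graphHom v₀ s t w (FreeGroup.of (some i)) =
      FreeGroup.of (Sum.inr (s i)) * FreeGroup.map Sum.inl (w i) *
        (FreeGroup.of (Sum.inr (t i)))⁻¹ := by
  simp [graphHom]

theorem freeGroup_hom_congr {α G : Type} [Group G] {f g : FreeGroup α →* G}
    (h : ∀ a, f (FreeGroup.of a) = g (FreeGroup.of a)) (x : FreeGroup α) : f x = g x :=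
  DFunLike.congr_fun (FreeGroup.ext_hom _ _ h) x

/-- The graph homomorphism is the quotient by as many relators as the ranks predict. -/
def HasDeficiency [Fintype T] [Fintype I] [Fintype V] (Θ : FreeGroup (Option I) →* FreeGroup (T ⊕ V)) :
    Prop :=
  ∃ d, Fintype.card I + 1 = d + Fintype.card T + Fintype.card V ∧ HasRelators Θ d

/-- The generator of such a loop maps to `1`, so it is a relator by itself. Deleting it lowers the
number of edges and the number of relators by one. -/
theorem hasDeficiency_of_trivial_loop [Fintype T] [Fintype I] [Fintype V] [DecidableEq I] (v₀ : V)
    (s t : I → V) (w : I → FreeGroup T) (j : I) (hw : w j = 1) (hst : s j = t j)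
    (hsurj : Function.Surjective (graphHom v₀ s t w))
    (IH : ∀ s' t' : {i // i ≠ j} → V,
      Function.Surjective (graphHom v₀ s' t' (fun i => w i)) →
      HasDeficiency (graphHom v₀ s' t' (fun i => w i))) :
    HasDeficiency (graphHom v₀ s t w) := by
  set Θ' := graphHom v₀ (fun i : {i // i ≠ j} => s i) (fun i => t i) (fun i => w i) with hΘ'
  let nu : FreeGroup (Option I) →* FreeGroup (Option {i // i ≠ j}) :=
    FreeGroup.lift fun o => o.elim (FreeGroup.of none) fun i =>
      if h : i = j then 1 else FreeGroup.of (some ⟨i, h⟩)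
  have hnu : ∀ g, Θ' (nu g) = graphHom v₀ s t w g := by
    refine freeGroup_hom_congr (f := Θ'.comp nu) fun o => ?_
    rcases o with _ | i
    · simp [nu, hΘ']
    · by_cases h : i = j
      · subst h; simp [nu, hw, hst]
      · simp [nu, h, hΘ']
  obtain ⟨d, hd, r, hr, σ, hσ⟩ := IH (fun i => s i) (fun i => t i) (fun h => by
    obtain ⟨g, hg⟩ := hsurj h
    exact ⟨nu g, by rw [← hΘ', hnu, hg]⟩)
  rw [← hΘ'] at hr hσ
  let lam : FreeGroup (Option {i // i ≠ j}) →* FreeGroup (Option I) :=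
    FreeGroup.map (Option.map Subtype.val)
  have hlam : ∀ g, graphHom v₀ s t w (lam g) = Θ' g := by
    refine freeGroup_hom_congr (f := (graphHom v₀ s t w).comp lam) fun o => ?_
    rcases o with _ | i <;> simp [lam, hΘ']
  let R : Fin (d + 1) → FreeGroup (Option I) :=
    Fin.cons (FreeGroup.of (some j)) fun i => lam (r i)
  obtain ⟨m, hm⟩ := exists_quotient_map lam r R
    fun i => Subgroup.subset_normalClosure ⟨i.succ, by simp [R]⟩
  refine ⟨d + 1, ?_, R, ?_, m.comp σ, ?_⟩
  · have := Fintype.card_subtype_compl (fun i : I => i = j)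
    simp only [Fintype.card_subtype_eq] at this
    have hpos : 0 < Fintype.card I := Fintype.card_pos_iff.2 ⟨j⟩
    rw [show Fintype.card {i // i ≠ j} = Fintype.card I - 1 from this] at hd
    omega
  · intro i
    refine Fin.cases ?_ (fun i => ?_) i
    · simp [R, hw, hst]
    · simp only [R, Fin.cons_succ]
      rw [hlam, hr]
  · refine freeGroup_hom_congr (f := (m.comp σ).comp (graphHom v₀ s t w))
      (g := QuotientGroup.mk' (Subgroup.normalClosure (range R))) fun o => ?_
    have hgen : ∀ g, m (σ (graphHom v₀ s t w (lam g))) = (lam g : FreeGroup (Option I) ⧸ _) :=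
      fun g => by rw [hlam, hσ, hm]
    rcases o with _ | i
    · simpa [lam] using hgen (FreeGroup.of none)
    · by_cases h : i = j
      · subst h
        have h1 : graphHom v₀ s t w (FreeGroup.of (some i)) = 1 := by simp [hw, hst]
        simp only [MonoidHom.comp_apply, h1, map_one]
        refine ((QuotientGroup.eq_one_iff _).2 ?_).symm
        exact Subgroup.subset_normalClosure ⟨0, by simp [R]⟩
      · simpa [lam] using hgen (FreeGroup.of (some ⟨i, h⟩))

/-- Contracting the edge removes one edge and one vertex, so the number of relators stays the same.
The relators are lifted by inserting the contracted edge at the end `t j` wherever a remaining edge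
starts or stops there. -/
theorem hasDeficiency_of_trivial_edge [Fintype T] [Fintype I] [Fintype V] [DecidableEq I]
    [DecidableEq V] (v₀ : V)
    (s t : I → V) (w : I → FreeGroup T) (j : I) (hw : w j = 1) (hst : s j ≠ t j)
    (hsurj : Function.Surjective (graphHom v₀ s t w))
    (IH : ∀ (v' : {v // v ≠ t j}) (s' t' : {i // i ≠ j} → {v // v ≠ t j}),
      Function.Surjective (graphHom v' s' t' (fun i => w i)) →
      HasDeficiency (graphHom v' s' t' (fun i => w i))) :
    HasDeficiency (graphHom v₀ s t w) := by
  let q : V → {v // v ≠ t j} := fun v => if h : v = t j then ⟨s j, hst⟩ else ⟨v, h⟩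
  have hqt : q (t j) = ⟨s j, hst⟩ := by simp [q]
  have hqs : q (s j) = ⟨s j, hst⟩ := by simp [q, hst]
  set Θ := graphHom v₀ s t w with hΘ
  set Θ' := graphHom (q v₀) (fun i : {i // i ≠ j} => q (s i)) (fun i => q (t i)) (fun i => w i)
    with hΘ'
  let nu : FreeGroup (Option I) →* FreeGroup (Option {i // i ≠ j}) :=
    FreeGroup.lift fun o => o.elim (FreeGroup.of none) fun i =>
      if h : i = j then 1 else FreeGroup.of (some ⟨i, h⟩)
  let pr : FreeGroup (T ⊕ V) →* FreeGroup (T ⊕ {v // v ≠ t j}) := FreeGroup.map (Sum.map id q)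
  have hprinl : ∀ x : FreeGroup T, pr (FreeGroup.map Sum.inl x) = FreeGroup.map Sum.inl x := by
    refine freeGroup_hom_congr (f := pr.comp (FreeGroup.map Sum.inl)) fun a => ?_
    simp [pr]
  have hnu : ∀ g, Θ' (nu g) = pr (Θ g) := by
    refine freeGroup_hom_congr (f := Θ'.comp nu) (g := pr.comp Θ) fun o => ?_
    rcases o with _ | i
    · simp [nu, hΘ', hΘ, pr]
    · by_cases h : i = j
      · subst h; simp [nu, hw, hΘ, pr, hqt, hqs]
      · simp only [MonoidHom.comp_apply, hΘ, graphHom_some, map_mul, hprinl]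
        simp [nu, h, hΘ', pr]
  have hprs : Function.Surjective pr := by
    let sec : FreeGroup (T ⊕ {v // v ≠ t j}) →* FreeGroup (T ⊕ V) :=
      FreeGroup.map (Sum.map id Subtype.val)
    intro x
    refine ⟨sec x, freeGroup_hom_congr (f := pr.comp sec) (g := MonoidHom.id _) (fun a => ?_) x⟩
    rcases a with a | ⟨v, hv⟩
    · simp [pr, sec]
    · simp [pr, sec, q, hv]
  obtain ⟨d, hd, r, hr, σ, hσ⟩ := IH (q v₀) (fun i => q (s i)) (fun i => q (t i)) (fun h => by
    obtain ⟨g, hg⟩ := (hprs.comp hsurj) h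
    exact ⟨nu g, by rw [← hΘ', hnu]; exact hg⟩)
  rw [← hΘ'] at hr hσ
  let z : FreeGroup (Option I) := FreeGroup.of (some j)
  -- The correction `a v` is the path from the image of `v` in the contracted graph to `v`: the edge
  -- `j` if `v = t j`, and trivial otherwise.
  let a : V → FreeGroup (Option I) := fun v => if v = t j then z else 1
  have hat : a (t j) = z := by simp [a]
  have has : a (s j) = 1 := by simp [a, hst]
  let inc : FreeGroup (T ⊕ {v // v ≠ t j}) →* FreeGroup (T ⊕ V) :=
    FreeGroup.map (Sum.map id Subtype.val)
  have hincl : ∀ x : FreeGroup T, inc (FreeGroup.map Sum.inl x) = FreeGroup.map Sum.inl x := by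
    refine freeGroup_hom_congr (f := inc.comp (FreeGroup.map Sum.inl)) fun a => ?_
    simp [inc]
  have ha : ∀ v, Θ (a v) * FreeGroup.of (Sum.inr v) = inc (FreeGroup.of (Sum.inr (q v))) := by
    intro v
    by_cases h : v = t j
    · subst h
      simp [a, z, hΘ, hw, hqt, inc]
    · simp [a, h, q, inc]
  have ha' : ∀ v, Θ (a v) = inc (FreeGroup.of (Sum.inr (q v))) * (FreeGroup.of (Sum.inr v))⁻¹ :=
    fun v => by rw [← ha, mul_inv_cancel_right]
  let lam : FreeGroup (Option {i // i ≠ j}) →* FreeGroup (Option I) :=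
    FreeGroup.lift fun o => o.elim (a v₀ * FreeGroup.of none) fun i =>
      a (s i) * FreeGroup.of (some i.1) * (a (t i))⁻¹
  have hlam0 : lam (FreeGroup.of none) = a v₀ * FreeGroup.of none := by simp [lam]
  have hlam1 : ∀ i : {i // i ≠ j}, lam (FreeGroup.of (some i)) =
      a (s i) * FreeGroup.of (some i.1) * (a (t i))⁻¹ := fun i => by simp [lam]
  have hlam : ∀ g, Θ (lam g) = inc (Θ' g) := by
    refine freeGroup_hom_congr (f := Θ.comp lam) (g := inc.comp Θ') fun o => ?_
    rcases o with _ | i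
    · simp only [MonoidHom.comp_apply, hlam0, map_mul, ha', hΘ', graphHom_none]
      simp [hΘ]
    · simp only [MonoidHom.comp_apply, hlam1, map_mul, map_inv, ha', hΘ', graphHom_some, hincl]
      simp only [hΘ, graphHom_some]
      group
  obtain ⟨m, hm⟩ := exists_quotient_map lam r (fun i => lam (r i))
    fun i => Subgroup.subset_normalClosure ⟨i, rfl⟩
  let Q := FreeGroup (Option I) ⧸ Subgroup.normalClosure (range fun i => lam (r i))
  let mk : FreeGroup (Option I) →* Q := QuotientGroup.mk' _
  let M := m.comp σ
  have hM : ∀ g, M (Θ' g) = mk (lam g) := fun g => by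
    simp only [M, MonoidHom.comp_apply]; rw [hσ, hm]; rfl
  -- The value at `v` is forced by `ha`, which expresses `v` through its image under the contraction
  -- and the correction `a v`.
  let τ : FreeGroup (T ⊕ V) →* Q := FreeGroup.lift (Sum.elim
    (fun x => M (FreeGroup.of (Sum.inl x)))
    (fun v => (mk (a v))⁻¹ * M (FreeGroup.of (Sum.inr (q v)))))
  have hτl : ∀ x : FreeGroup T, τ (FreeGroup.map Sum.inl x) = M (FreeGroup.map Sum.inl x) := by
    refine freeGroup_hom_congr (f := τ.comp (FreeGroup.map Sum.inl))
      (g := M.comp (FreeGroup.map Sum.inl)) fun a => ?_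
    simp [τ]
  have hτr : ∀ v, τ (FreeGroup.of (Sum.inr v)) =
      (mk (a v))⁻¹ * M (FreeGroup.of (Sum.inr (q v))) := fun v => by simp [τ]
  refine ⟨d, ?_, fun i => lam (r i), fun i => by rw [hlam, hr, map_one], τ, ?_⟩
  · have h1 := Fintype.card_subtype_compl (fun i : I => i = j)
    have h2 := Fintype.card_subtype_compl (fun v : V => v = t j)
    simp only [Fintype.card_subtype_eq] at h1 h2
    have hpos : 0 < Fintype.card I := Fintype.card_pos_iff.2 ⟨j⟩
    have hpos' : 0 < Fintype.card V := Fintype.card_pos_iff.2 ⟨t j⟩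
    rw [show Fintype.card {i // i ≠ j} = Fintype.card I - 1 from h1,
      show Fintype.card {v // v ≠ t j} = Fintype.card V - 1 from h2] at hd
    omega
  · refine freeGroup_hom_congr (f := τ.comp Θ) (g := mk) fun o => ?_
    rcases o with _ | i
    · have := hM (FreeGroup.of none)
      rw [hlam0, hΘ', graphHom_none, map_mul] at this
      simp only [MonoidHom.comp_apply, hΘ, graphHom_none, hτr, this]
      group
    · by_cases h : i = j
      · subst h
        simp only [MonoidHom.comp_apply, hΘ, graphHom_some, map_mul, map_inv, hτr, hw, map_one,
          hqs, hqt, has, hat]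
        simp only [z]
        group
      · have := hM (FreeGroup.of (some ⟨i, h⟩))
        rw [hlam1, hΘ', graphHom_some] at this
        simp only [map_mul, map_inv] at this
        simp only [MonoidHom.comp_apply, hΘ, graphHom_some, map_mul, map_inv, hτr, hτl]
        have h2 : M (FreeGroup.of (Sum.inr (q (s i)))) * M (FreeGroup.map Sum.inl (w i)) *
            (M (FreeGroup.of (Sum.inr (q (t i)))))⁻¹ =
            mk (a (s i)) * mk (FreeGroup.of (some i)) * (mk (a (t i)))⁻¹ := this
        rw [mul_inv_rev, inv_inv]
        calc _ = (mk (a (s i)))⁻¹ * (M (FreeGroup.of (Sum.inr (q (s i)))) *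
              M (FreeGroup.map Sum.inl (w i)) * (M (FreeGroup.of (Sum.inr (q (t i)))))⁻¹) *
              mk (a (t i)) := by group
          _ = _ := by rw [h2]; group

end Folding

/-! ### Folding, subdivision, and the kernel of a surjection between free groups. -/

section Nielsen

variable {T I V : Type}

theorem HasDeficiency.of_edge_moves [Fintype T] [Fintype I] [Fintype V] {v₀ : V}
    {s t : I → V} {w : I → FreeGroup T} {s' t' : I → V} {w' : I → FreeGroup T}
    (lam nu : FreeGroup (Option I) →* FreeGroup (Option I)) (h1 : ∀ g, lam (nu g) = g)
    (h2 : ∀ g, graphHom v₀ s t w (lam g) = graphHom v₀ s' t' w' g)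
    (h3 : ∀ g, graphHom v₀ s t w g = graphHom v₀ s' t' w' (nu g))
    (hsurj : Function.Surjective (graphHom v₀ s t w))
    (IH : Function.Surjective (graphHom v₀ s' t' w') → HasDeficiency (graphHom v₀ s' t' w')) :
    HasDeficiency (graphHom v₀ s t w) := by
  obtain ⟨d, hd, h⟩ := IH fun x => by
    obtain ⟨g, hg⟩ := hsurj x
    exact ⟨nu g, by rw [← h3, hg]⟩
  exact ⟨d, hd, h.of_retract lam nu (MonoidHom.id _) (MonoidHom.id _) h1 h2 h3⟩

/-- Changing one edge by replacing its generator. -/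
theorem HasDeficiency.of_edge_move [Fintype T] [Fintype I] [Fintype V] [DecidableEq I] {v₀ : V}
    {s t : I → V} {w : I → FreeGroup T} (j : I) (a b : V) (x : FreeGroup T)
    (l n : FreeGroup (Option I))
    (hl : graphHom v₀ s t w l =
      FreeGroup.of (Sum.inr a) * FreeGroup.map Sum.inl x * (FreeGroup.of (Sum.inr b))⁻¹)
    (hln : FreeGroup.lift (fun o => if o = some j then l else FreeGroup.of o) n =
      FreeGroup.of (some j))
    (hsurj : Function.Surjective (graphHom v₀ s t w))
    (IH : Function.Surjective (graphHom v₀ (Function.update s j a) (Function.update t j b)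
        (Function.update w j x)) →
      HasDeficiency (graphHom v₀ (Function.update s j a) (Function.update t j b)
        (Function.update w j x))) :
    HasDeficiency (graphHom v₀ s t w) := by
  let lam : FreeGroup (Option I) →* FreeGroup (Option I) :=
    FreeGroup.lift fun o => if o = some j then l else FreeGroup.of o
  let nu : FreeGroup (Option I) →* FreeGroup (Option I) :=
    FreeGroup.lift fun o => if o = some j then n else FreeGroup.of o
  have h1 : ∀ g, lam (nu g) = g := by
    refine freeGroup_hom_congr (f := lam.comp nu) (g := MonoidHom.id _) fun o => ?_
    by_cases h : o = some j
    · subst h; simpa [nu] using hln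
    · simp [nu, lam, h]
  have h2 : ∀ g, graphHom v₀ s t w (lam g) = graphHom v₀ (Function.update s j a)
      (Function.update t j b) (Function.update w j x) g := by
    refine freeGroup_hom_congr (f := (graphHom v₀ s t w).comp lam) fun o => ?_
    rcases o with _ | i
    · simp [lam]
    · by_cases h : i = j
      · subst h; simp [lam, hl]
      · simp [lam, h]
  exact HasDeficiency.of_edge_moves lam nu h1 h2 (fun g => by rw [← h2, h1]) hsurj IH

theorem hasDeficiency_of_remove [Fintype T] [Fintype I] [Fintype V] [DecidableEq I]
    (v₀ : V) (s t : I → V) (w : I → FreeGroup T) (j : I) (hw : w j = 1)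
    (hsurj : Function.Surjective (graphHom v₀ s t w))
    (IH : ∀ (V' : Type) [Fintype V'] (v' : V') (s' t' : {i // i ≠ j} → V'),
      Function.Surjective (graphHom v' s' t' (fun i => w i)) →
      HasDeficiency (graphHom v' s' t' (fun i => w i))) :
    HasDeficiency (graphHom v₀ s t w) := by
  classical
  by_cases hst : s j = t j
  · exact hasDeficiency_of_trivial_loop v₀ s t w j hw hst hsurj fun s' t' => IH V v₀ s' t'
  · exact hasDeficiency_of_trivial_edge v₀ s t w j hw hst hsurj fun v' s' t' => IH _ v' s' t'

/-- In a folded graph each letter acts as a partial injection of the vertices. Extended to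
permutations, with vertices acting by transpositions with `v₀`, the image of the graph homomorphism
fixes `v₀`. Surjectivity then forces a single vertex with exactly one loop per letter, and no
relators are needed. -/
theorem hasDeficiency_of_folded [Fintype T] [Fintype I] [Fintype V] (v₀ : V) (s t : I → V)
    (lab : I → T) (hs : ∀ i j, lab i = lab j → s i = s j → i = j)
    (ht : ∀ i j, lab i = lab j → t i = t j → i = j)
    (hsurj : Function.Surjective (graphHom v₀ s t fun i => FreeGroup.of (lab i))) :
    HasDeficiency (graphHom v₀ s t fun i => FreeGroup.of (lab i)) := by
  classical
  -- The extra point `none` leaves room to move `v₀` away whenever no edge with label `x` ends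
  -- there; this later shows that every letter occurs. Foldedness gives the injectivity needed for
  -- the extension.
  have hπ : ∀ x : T, ∃ π : Equiv.Perm (Option V), (∀ i, lab i = x → π (some (t i)) = some (s i)) ∧
      ((¬ ∃ i, lab i = x ∧ t i = v₀) → π (some v₀) = none) := by
    intro x
    let f : Option V → Option V := fun o =>
      if h : ∃ i, lab i = x ∧ some (t i) = o then some (s h.choose) else none
    have hf : ∀ i, lab i = x → f (some (t i)) = some (s i) := by
      intro i hi
      have h : ∃ k, lab k = x ∧ some (t k) = some (t i) := ⟨i, hi, rfl⟩
      simp only [f, dif_pos h]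
      have := ht h.choose i (h.choose_spec.1.trans hi.symm) (Option.some_injective _ h.choose_spec.2)
      rw [this]
    have hf' : (¬ ∃ i, lab i = x ∧ t i = v₀) → f (some v₀) = none := by
      intro h
      simp only [f]
      rw [dif_neg]
      rintro ⟨i, hi, hi'⟩
      exact h ⟨i, hi, Option.some_injective _ hi'⟩
    let S : Set (Option V) := {o | (∃ i, lab i = x ∧ some (t i) = o) ∨ o = some v₀}
    have hinj : Set.InjOn f S := by
      have aux : ∀ o, (∃ i, lab i = x ∧ some (t i) = o) → ∃ i, lab i = x ∧ some (t i) = o ∧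
          f o = some (s i) := by
        rintro _ ⟨i, hi, rfl⟩; exact ⟨i, hi, rfl, hf i hi⟩
      have aux2 : ∀ o ∈ S, (¬ ∃ i, lab i = x ∧ some (t i) = o) → o = some v₀ ∧ f o = none := by
        rintro o (ho | rfl) h
        · exact absurd ho h
        · exact ⟨rfl, by simp only [f]; rw [dif_neg h]⟩
      intro o ho o' ho' hoo
      by_cases h : ∃ i, lab i = x ∧ some (t i) = o
      · obtain ⟨i, hi, hio, hfi⟩ := aux o h
        by_cases h' : ∃ i, lab i = x ∧ some (t i) = o'
        · obtain ⟨i', hi', hio', hfi'⟩ := aux o' h'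
          rw [hfi, hfi'] at hoo
          have := hs i i' (hi.trans hi'.symm) (Option.some_injective _ hoo)
          rw [← hio, ← hio', this]
        · rw [hfi, (aux2 o' ho' h').2] at hoo
          cases hoo
      · by_cases h' : ∃ i, lab i = x ∧ some (t i) = o'
        · obtain ⟨i', hi', hio', hfi'⟩ := aux o' h'
          rw [hfi', (aux2 o ho h).2] at hoo
          cases hoo
        · rw [(aux2 o ho h).1, (aux2 o' ho' h').1]
    obtain ⟨g, hg⟩ := Finset.exists_equiv_extend_of_card_eq (t := (Finset.univ : Finset (Option V)))
      (s := Finset.univ.filter (· ∈ S)) (f := f) (by simp) (Finset.subset_univ _)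
      (fun o ho o' ho' h => hinj (by simpa using ho) (by simpa using ho') h)
    refine ⟨g.trans (Equiv.subtypeUnivEquiv (by simp)), fun i hi => ?_, fun h => ?_⟩
    · have := hg (some (t i)) (by simp only [Finset.mem_filter, Finset.mem_univ, true_and]
                                  exact Or.inl ⟨i, hi, rfl⟩)
      simpa [hf i hi] using this
    · have := hg (some v₀) (by simp [S])
      simpa [hf' h] using this
  choose π hπ1 hπ2 using hπ
  let kap : FreeGroup (T ⊕ V) →* Equiv.Perm (Option V) :=
    FreeGroup.lift (Sum.elim π fun v => Equiv.swap (some v₀) (some v))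
  -- An edge acts by `v₀ ↦ t i ↦ s i ↦ v₀`.
  have hfix : ∀ h, kap h (some v₀) = some v₀ := by
    intro h
    obtain ⟨g, rfl⟩ := hsurj h
    induction g using FreeGroup.induction_on with
    | C1 => simp
    | of o =>
      rcases o with _ | i
      · simp [kap]
      · simp [kap, Equiv.swap_inv, hπ1]
    | inv_of o ih => rw [map_inv, map_inv, Equiv.Perm.inv_eq_iff_eq, ih]
    | mul x y hx hy => rw [map_mul, map_mul, Equiv.Perm.mul_apply, hy, hx]
  have hV : ∀ v, v = v₀ := fun v => by
    have := hfix (FreeGroup.of (Sum.inr v))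
    simp only [kap, FreeGroup.lift_apply_of, Sum.elim_inr, Equiv.swap_apply_left] at this
    exact Option.some_injective _ this
  have hT : ∀ x, ∃ i, lab i = x := by
    intro x
    by_contra h
    have h1 := hπ2 x (fun ⟨i, hi, _⟩ => h ⟨i, hi⟩)
    have := hfix (FreeGroup.of (Sum.inl x))
    simp [kap, h1] at this
  have hinj : Function.Injective lab := fun i j h => hs i j h ((hV _).trans (hV _).symm)
  have hcT : Fintype.card I = Fintype.card T := Fintype.card_of_bijective ⟨hinj, hT⟩
  have hcV : Fintype.card V = 1 := Fintype.card_eq_one_iff.2 ⟨v₀, hV⟩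
  refine ⟨0, by omega, Fin.elim0, fun i => i.elim0, ?_⟩
  choose e he using hT
  let mk := QuotientGroup.mk' (Subgroup.normalClosure
    (range (Fin.elim0 : Fin 0 → FreeGroup (Option I))))
  let σ : FreeGroup (T ⊕ V) →* _ := FreeGroup.lift (Sum.elim
    (fun x => mk ((FreeGroup.of none)⁻¹ * FreeGroup.of (some (e x)) * FreeGroup.of none))
    fun _ => mk (FreeGroup.of none))
  refine ⟨σ, freeGroup_hom_congr (f := σ.comp (graphHom v₀ s t _)) (g := mk) fun o => ?_⟩
  rcases o with _ | i
  · simp [σ]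
  · have : e (lab i) = i := hinj (he (lab i))
    simp only [MonoidHom.comp_apply, graphHom_some, map_mul, map_inv, FreeGroup.map.of, σ,
      FreeGroup.lift_apply_of, Sum.elim_inl, Sum.elim_inr, this]
    group

/-- Two distinct edges with the same letter and a common end are folded: replacing one of them by
their quotient gives an edge labelled `1`, which can be removed. The number of edges drops until the
graph is folded. -/
theorem hasDeficiency_of_letters [Fintype T] : ∀ (n : ℕ) (I V : Type) [Fintype I] [Fintype V]
    (v₀ : V) (s t : I → V) (lab : I → T), Fintype.card I = n →
    Function.Surjective (graphHom v₀ s t fun i => FreeGroup.of (lab i)) →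
    HasDeficiency (graphHom v₀ s t fun i => FreeGroup.of (lab i)) := by
  classical
  intro n
  induction n with
  | zero =>
    intro I V _ _ v₀ s t lab hI hsurj
    have := Fintype.card_eq_zero_iff.1 hI
    exact hasDeficiency_of_folded v₀ s t lab (fun i => isEmptyElim i) (fun i => isEmptyElim i) hsurj
  | succ n ih =>
    intro I V _ _ v₀ s t lab hI hsurj
    have hcard : ∀ j : I, Fintype.card {i // i ≠ j} = n := fun j => by
      have := Fintype.card_subtype_compl (fun i : I => i = j)
      simp only [Fintype.card_subtype_eq] at this
      exact this.trans (by omega)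
    have hremove : ∀ (j : I) (a b : V), Function.Surjective (graphHom v₀ (Function.update s j a)
          (Function.update t j b) (Function.update (fun i => FreeGroup.of (lab i)) j 1)) →
        HasDeficiency (graphHom v₀ (Function.update s j a)
          (Function.update t j b) (Function.update (fun i => FreeGroup.of (lab i)) j 1)) := by
      intro j a b h
      refine hasDeficiency_of_remove v₀ _ _ _ j (by simp) h fun V' _ v' s' t' => ?_
      have : (fun i : {i // i ≠ j} => Function.update (fun i => FreeGroup.of (lab i)) j 1 i.1) =
          fun i : {i // i ≠ j} => FreeGroup.of (lab i) := by
        ext1 i; simp [i.2]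
      rw [this]
      exact ih {i // i ≠ j} V' v' s' t' (fun i => lab i) (hcard j)
    by_cases hs : ∀ i j, lab i = lab j → s i = s j → i = j
    · by_cases ht : ∀ i j, lab i = lab j → t i = t j → i = j
      · exact hasDeficiency_of_folded v₀ s t lab hs ht hsurj
      · push Not at ht
        obtain ⟨i, j, hl, hij, hne⟩ := ht
        -- With a common target, the product of edge `i` and the inverse of edge `j` runs from `s i`
        -- to `s j`, and the labels cancel.
        refine HasDeficiency.of_edge_move j (s i) (s j) 1
          (FreeGroup.of (some i) * (FreeGroup.of (some j))⁻¹)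
          ((FreeGroup.of (some j))⁻¹ * FreeGroup.of (some i)) ?_ ?_ hsurj (hremove j _ _)
        · simp only [map_mul, map_inv, graphHom_some, hl, hij, map_one]; group
        · simp [hne]
    · push Not at hs
      obtain ⟨i, j, hl, hij, hne⟩ := hs
      -- With a common source, the inverse of edge `i` followed by edge `j` runs from `t i` to `t
      -- j`, and the labels cancel.
      refine HasDeficiency.of_edge_move j (t i) (t j) 1
        ((FreeGroup.of (some i))⁻¹ * FreeGroup.of (some j))
        (FreeGroup.of (some i) * FreeGroup.of (some j)) ?_ ?_ hsurj (hremove j _ _)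
      · simp only [map_mul, map_inv, graphHom_some, hl, hij, map_one]; group
      · simp [hne]

/-- Subdivision of an edge. -/
theorem hasDeficiency_of_subdivide [Fintype T] [Fintype I] [Fintype V] [DecidableEq I] (v₀ : V)
    (s t : I → V) (w : I → FreeGroup T) (j : I) (x y : FreeGroup T) (hxy : w j = x * y)
    (hsurj : Function.Surjective (graphHom v₀ s t w))
    (IH : ∀ (s' t' : Option I → Option V),
      Function.Surjective (graphHom (some v₀) s' t' (fun o => o.elim x (Function.update w j y))) →
      HasDeficiency (graphHom (some v₀) s' t' (fun o => o.elim x (Function.update w j y)))) :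
    HasDeficiency (graphHom v₀ s t w) := by
  -- The half labelled `x` is the new edge `none`, ending at the new vertex `none`. The half
  -- labelled `y` keeps the name `j` and starts there.
  let s' : Option I → Option V := fun o =>
    o.elim (some (s j)) (Function.update (fun i => some (s i)) j none)
  let t' : Option I → Option V := fun o => o.elim none fun i => some (t i)
  set Θ' := graphHom (some v₀) s' t' (fun o => o.elim x (Function.update w j y)) with hΘ'
  set Θ := graphHom v₀ s t w with hΘ
  let lam : FreeGroup (Option (Option I)) →* FreeGroup (Option I) :=
    FreeGroup.lift fun o => o.elim (FreeGroup.of none) fun o => o.elim 1 fun i => FreeGroup.of (some i)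
  let nu : FreeGroup (Option I) →* FreeGroup (Option (Option I)) :=
    FreeGroup.lift fun o => o.elim (FreeGroup.of none) fun i =>
      if i = j then FreeGroup.of (some none) * FreeGroup.of (some (some i))
      else FreeGroup.of (some (some i))
  -- The new vertex goes to `s j` followed by `x`, which makes the new edge trivial, in accordance
  -- with `lam`.
  let kap : FreeGroup (T ⊕ Option V) →* FreeGroup (T ⊕ V) :=
    FreeGroup.lift (Sum.elim (fun a => FreeGroup.of (Sum.inl a)) fun o =>
      o.elim (FreeGroup.of (Sum.inr (s j)) * FreeGroup.map Sum.inl x) fun v =>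
        FreeGroup.of (Sum.inr v))
  let mu : FreeGroup (T ⊕ V) →* FreeGroup (T ⊕ Option V) := FreeGroup.map (Sum.map id some)
  have hkl : ∀ u : FreeGroup T, kap (FreeGroup.map Sum.inl u) = FreeGroup.map Sum.inl u := by
    refine freeGroup_hom_congr (f := kap.comp (FreeGroup.map Sum.inl)) fun a => ?_
    simp [kap]
  have hml : ∀ u : FreeGroup T, mu (FreeGroup.map Sum.inl u) = FreeGroup.map Sum.inl u := by
    refine freeGroup_hom_congr (f := mu.comp (FreeGroup.map Sum.inl)) fun a => ?_
    simp [mu]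
  have hmr : ∀ v, mu (FreeGroup.of (Sum.inr v)) = FreeGroup.of (Sum.inr (some v)) := fun v => by
    simp [mu]
  have hkr : ∀ v, kap (FreeGroup.of (Sum.inr (some v))) = FreeGroup.of (Sum.inr v) := fun v => by
    simp [kap]
  have hkn : kap (FreeGroup.of (Sum.inr none)) =
      FreeGroup.of (Sum.inr (s j)) * FreeGroup.map Sum.inl x := by simp [kap]
  have h1 : ∀ g, lam (nu g) = g := by
    refine freeGroup_hom_congr (f := lam.comp nu) (g := MonoidHom.id _) fun o => ?_
    rcases o with _ | i
    · simp [lam, nu]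
    · by_cases h : i = j <;> simp [lam, nu, h]
  have h2 : ∀ g, Θ (lam g) = kap (Θ' g) := by
    refine freeGroup_hom_congr (f := Θ.comp lam) (g := kap.comp Θ') fun o => ?_
    rcases o with _ | _ | i
    · simp [lam, hΘ, hΘ', hkr]
    · simp only [MonoidHom.comp_apply, lam, hΘ', graphHom_some, map_mul, map_inv, hkl, s', t',
        Option.elim_none, Option.elim_some, hkr, hkn, FreeGroup.lift_apply_of]
      simp
    · by_cases h : i = j
      · subst h
        simp only [MonoidHom.comp_apply, lam, hΘ', graphHom_some, map_mul, map_inv, hkl, s', t',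
          Option.elim_some, hkr, hkn, FreeGroup.lift_apply_of, Function.update_self, hΘ, hxy]
        group
      · simp only [MonoidHom.comp_apply, lam, hΘ', graphHom_some, map_mul, map_inv, hkl, s', t',
          Option.elim_some, hkr, FreeGroup.lift_apply_of, ne_eq, h, not_false_eq_true,
          Function.update_of_ne, hΘ]
  have h3 : ∀ g, mu (Θ g) = Θ' (nu g) := by
    refine freeGroup_hom_congr (f := mu.comp Θ) (g := Θ'.comp nu) fun o => ?_
    rcases o with _ | i
    · simp [nu, hΘ, hΘ', hmr]
    · by_cases h : i = j
      · subst h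
        simp only [MonoidHom.comp_apply, nu, hΘ, hΘ', graphHom_some, map_mul, map_inv, hml, hmr, s',
          t', Option.elim_some, Option.elim_none, FreeGroup.lift_apply_of, if_true,
          Function.update_self, hxy]
        group
      · simp only [MonoidHom.comp_apply, nu, hΘ, hΘ', graphHom_some, map_mul, map_inv, hml, hmr, s',
          t', Option.elim_some, FreeGroup.lift_apply_of, h, if_false, ne_eq, not_false_eq_true,
          Function.update_of_ne]
  have hsurj' : Function.Surjective Θ' := by
    have hrange : ∀ h, mu h ∈ Θ'.range := fun h => by
      obtain ⟨g, rfl⟩ := hsurj h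
      exact ⟨nu g, (h3 g).symm⟩
    rw [← MonoidHom.range_eq_top, eq_top_iff]
    intro h _
    induction h using FreeGroup.induction_on with
    | C1 => exact one_mem _
    | of a =>
      rcases a with a | _ | v
      · simpa [mu] using hrange (FreeGroup.of (Sum.inl a))
      · have e : Θ' (FreeGroup.of (some none)) = mu (FreeGroup.of (Sum.inr (s j))) *
            mu (FreeGroup.map Sum.inl x) * (FreeGroup.of (Sum.inr none))⁻¹ := by
          rw [hmr, hml, hΘ', graphHom_some]; rfl
        have e2 : (FreeGroup.of (Sum.inr none) : FreeGroup (T ⊕ Option V)) =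
            (Θ' (FreeGroup.of (some none)))⁻¹ * (mu (FreeGroup.of (Sum.inr (s j))) *
            mu (FreeGroup.map Sum.inl x)) := by rw [e]; group
        rw [e2]
        exact mul_mem (inv_mem ⟨_, rfl⟩) (mul_mem (hrange _) (hrange _))
      · simpa [mu] using hrange (FreeGroup.of (Sum.inr v))
    | inv_of a ih => exact inv_mem (ih trivial)
    | mul a b ha hb => exact mul_mem (ha trivial) (hb trivial)
  obtain ⟨d, hd, h⟩ := IH s' t' hsurj'
  refine ⟨d, ?_, h.of_retract lam nu kap mu h1 h2 h3⟩
  simp only [Fintype.card_option] at hd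
  omega

open Classical in
/-- The number of steps needed to bring an edge with the given label into a positive letter. -/
noncomputable def labelWeight (x : FreeGroup T) : ℕ :=
  if ∃ a, x = FreeGroup.of a then 0 else if x = 1 then 1 else 2 * x.toWord.length - 1

theorem labelWeight_of (a : T) : labelWeight (FreeGroup.of a) = 0 := by
  simp [labelWeight]

/-- Induction on the total weight of the labels. Trivial edges are removed, inverse letters are
reversed, and longer words are split. Splitting a word of length `ℓ ≥ 2` replaces the weight `2ℓ -
1` by at most `1 + (2(ℓ - 1) - 1)`, so the weight drops at every step. -/
theorem hasDeficiency_graphHom [Fintype T] : ∀ (n : ℕ) (I V : Type) [Fintype I] [Fintype V]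
    (v₀ : V) (s t : I → V) (w : I → FreeGroup T), ∑ i, labelWeight (w i) = n →
    Function.Surjective (graphHom v₀ s t w) → HasDeficiency (graphHom v₀ s t w) := by
  classical
  intro n
  induction n using Nat.strong_induction_on with
  | _ n ih =>
  intro I V _ _ v₀ s t w hn hsurj
  by_cases hpos : ∀ i, ∃ a, w i = FreeGroup.of a
  · choose lab hlab using hpos
    obtain rfl : w = fun i => FreeGroup.of (lab i) := funext hlab
    exact hasDeficiency_of_letters _ I V v₀ s t lab rfl hsurj
  push Not at hpos
  obtain ⟨j, hj⟩ := hpos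
  have hsum : ∑ i, labelWeight (w i) =
      labelWeight (w j) + ∑ i : {i // i ≠ j}, labelWeight (w i) := by
    rw [← Finset.add_sum_erase _ _ (Finset.mem_univ j),
      ← Finset.sum_subtype (p := fun i => i ≠ j) (Finset.univ.erase j) (by simp)
        (fun i => labelWeight (w i))]
  have hwj : labelWeight (w j) = if w j = 1 then 1 else 2 * (w j).toWord.length - 1 := by
    simp [labelWeight, hj]
  by_cases h1 : w j = 1
  · rw [if_pos h1] at hwj
    exact hasDeficiency_of_remove v₀ s t w j h1 hsurj fun V' _ v' s' t' h =>
      ih _ (by omega) _ _ v' s' t' (fun i => w i) rfl h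
  rw [if_neg h1] at hwj
  have hupd : ∀ y, ∑ i, labelWeight (Function.update w j y i) =
      labelWeight y + ∑ i : {i // i ≠ j}, labelWeight (w i) := by
    intro y
    rw [← Finset.add_sum_erase _ _ (Finset.mem_univ j), Function.update_self,
      ← Finset.sum_subtype (p := fun i => i ≠ j) (Finset.univ.erase j) (by simp)
        (fun i => labelWeight (w i))]
    congr 1
    refine Finset.sum_congr rfl fun i hi => ?_
    rw [Function.update_of_ne (Finset.ne_of_mem_erase hi)]
  match hword : (w j).toWord with
  | [] => exact absurd (FreeGroup.toWord_eq_nil_iff.1 hword) h1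
  | [(a, true)] =>
    refine absurd ?_ (hj a)
    rw [← FreeGroup.mk_toWord (x := w j), hword]; rfl
  | [(a, false)] =>
    have hwa : w j = (FreeGroup.of a)⁻¹ := by
      rw [← FreeGroup.mk_toWord (x := w j), hword]; rfl
    refine HasDeficiency.of_edge_move j (t j) (s j) (FreeGroup.of a) (FreeGroup.of (some j))⁻¹
      (FreeGroup.of (some j))⁻¹ ?_ (by simp) hsurj (ih _ ?_ _ _ _ _ _ _ rfl)
    · rw [map_inv, graphHom_some, hwa, map_inv]; group
    · rw [hupd, labelWeight_of, ← hn, hsum, hwj, hword]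
      simp
  | (a, b) :: p :: L =>
    have hxy : w j = FreeGroup.mk [(a, b)] * FreeGroup.mk (p :: L) := by
      rw [← FreeGroup.mk_toWord (x := w j), hword, FreeGroup.mul_mk]; rfl
    refine hasDeficiency_of_subdivide v₀ s t w j _ _ hxy hsurj fun s' t' h =>
      ih _ ?_ _ _ _ _ _ _ rfl h
    have hx : labelWeight (FreeGroup.mk [(a, b)] : FreeGroup T) ≤ 1 := by
      unfold labelWeight
      split_ifs
      · omega
      · omega
      · have := FreeGroup.norm_mk_le (L₁ := [(a, b)])
        simp only [FreeGroup.norm, List.length_singleton] at this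
        omega
    have hy : labelWeight (FreeGroup.mk (p :: L) : FreeGroup T) ≤ 2 * (L.length + 1) - 1 := by
      unfold labelWeight
      split_ifs
      · omega
      · omega
      · have := FreeGroup.norm_mk_le (L₁ := p :: L)
        simp only [FreeGroup.norm, List.length_cons] at this
        omega
    rw [Fintype.sum_option]
    simp only [Option.elim_none, Option.elim_some]
    rw [hupd, ← hn, hsum, hwj, hword]
    simp only [List.length_cons]
    omega

/-- A surjection between free groups of finite rank is the quotient by as many relators as the
ranks predict. -/
theorem exists_ker_eq_normalClosure_of_freeGroup_surjective {m n : ℕ}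
    (φ : FreeGroup (Fin m) →* FreeGroup (Fin n)) (hφ : Function.Surjective φ) :
    n ≤ m ∧ ∃ r : Fin (m - n) → FreeGroup (Fin m), φ.ker = Subgroup.normalClosure (range r) := by
  let w : Fin m → FreeGroup (Fin n) := fun i => φ (FreeGroup.of i)
  let Θ := graphHom () (fun _ : Fin m => ()) (fun _ => ()) w
  let b : FreeGroup (Fin n ⊕ Unit) := FreeGroup.of (Sum.inr ())
  -- For a bouquet with one vertex `v`, edge `i` maps to the conjugate of `w i` by `v`, and `none`
  -- maps to `v`. Conjugating back recovers `φ`; the vertex adds one to the rank of both sides.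
  let nu : FreeGroup (Fin m) →* FreeGroup (Option (Fin m)) :=
    FreeGroup.lift fun i => (FreeGroup.of none)⁻¹ * FreeGroup.of (some i) * FreeGroup.of none
  let lam : FreeGroup (Option (Fin m)) →* FreeGroup (Fin m) :=
    FreeGroup.lift fun o => o.elim 1 FreeGroup.of
  let kap : FreeGroup (Fin n ⊕ Unit) →* FreeGroup (Fin n) :=
    FreeGroup.lift (Sum.elim FreeGroup.of fun _ => 1)
  have hk : ∀ x, kap (FreeGroup.map Sum.inl x) = x :=
    freeGroup_hom_congr (f := kap.comp (FreeGroup.map Sum.inl)) (g := MonoidHom.id _) fun a => by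
      simp [kap]
  have hkb : kap b = 1 := by simp [kap, b]
  have h1 : ∀ g, lam (nu g) = g :=
    freeGroup_hom_congr (f := lam.comp nu) (g := MonoidHom.id _) fun i => by simp [lam, nu]
  have h2 : ∀ g, φ (lam g) = kap (Θ g) :=
    freeGroup_hom_congr (f := φ.comp lam) (g := kap.comp Θ) fun o => by
      rcases o with _ | i
      · simp only [MonoidHom.comp_apply, Θ, graphHom_none, lam, FreeGroup.lift_apply_of,
          Option.elim_none, map_one]
        exact hkb.symm
      · simp only [MonoidHom.comp_apply, Θ, graphHom_some, map_mul, map_inv, hk]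
        rw [show kap (FreeGroup.of (Sum.inr ())) = 1 from hkb]
        simp [lam, w]
  have h3 : ∀ g, FreeGroup.map Sum.inl (φ g) = Θ (nu g) :=
    freeGroup_hom_congr (f := (FreeGroup.map Sum.inl).comp φ) (g := Θ.comp nu) fun i => by
      simp only [MonoidHom.comp_apply, nu, FreeGroup.lift_apply_of, map_mul, map_inv, Θ,
        graphHom_some, graphHom_none, w]
      group
  have hsurj : Function.Surjective Θ := by
    rw [← MonoidHom.range_eq_top, eq_top_iff]
    intro h _
    induction h using FreeGroup.induction_on with
    | C1 => exact one_mem _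
    | of a =>
      rcases a with a | v
      · obtain ⟨g, hg⟩ := hφ (FreeGroup.of a)
        exact ⟨nu g, by rw [← h3, hg, FreeGroup.map.of]⟩
      · exact ⟨FreeGroup.of none, by simp [Θ]⟩
    | inv_of a ih => exact inv_mem (ih trivial)
    | mul a b ha hb => exact mul_mem (ha trivial) (hb trivial)
  obtain ⟨d, hd, h⟩ := hasDeficiency_graphHom _ _ _ _ _ _ w rfl hsurj
  simp only [Fintype.card_fin, Fintype.card_unit] at hd
  obtain rfl : d = m - n := by omega
  exact ⟨by omega, (h.of_retract lam nu kap (FreeGroup.map Sum.inl) h1 h2 h3).exists_ker_eq⟩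

end Nielsen

/-! ### The round ball minus flat disks: collar of the sphere and connectedness. -/

section Model

variable {n m : ℕ}

/-- The complement of the flat disks `{(tⱼ, 0)} × ℝⁿ`. -/
def flatCompl (n : ℕ) (t : Fin m → ℝ) : Set (EuclideanSpace ℝ (Fin (n + 2))) :=
  {x | ∀ j, ¬ (x 0 = t j ∧ x 1 = 0)}

theorem norm_sq_eq_add (x : EuclideanSpace ℝ (Fin (n + 2))) :
    ‖x‖ ^ 2 = x 0 ^ 2 + ∑ i : Fin (n + 1), x i.succ ^ 2 := by
  rw [EuclideanSpace.real_norm_sq_eq, Fin.sum_univ_succ]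

/-- Stretching by `1 + s * k` in the first coordinate and by `1 + s` in the others. -/
noncomputable def stretch (x : EuclideanSpace ℝ (Fin (n + 2))) (k s : ℝ) :
    EuclideanSpace ℝ (Fin (n + 2)) :=
  WithLp.toLp 2 (Fin.cons (x 0 * (1 + s * k)) fun i : Fin (n + 1) => x i.succ * (1 + s))

theorem stretch_zero_apply (x : EuclideanSpace ℝ (Fin (n + 2))) (k s : ℝ) :
    stretch x k s 0 = x 0 * (1 + s * k) := rfl

theorem stretch_one_apply (x : EuclideanSpace ℝ (Fin (n + 2))) (k s : ℝ) :
    stretch x k s 1 = x 1 * (1 + s) := rfl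

theorem stretch_norm_sq (x : EuclideanSpace ℝ (Fin (n + 2))) (k s : ℝ) :
    ‖stretch x k s‖ ^ 2 = ‖x‖ ^ 2 + 2 * (x 0 ^ 2 * k + ∑ i : Fin (n + 1), x i.succ ^ 2) * s +
      (x 0 ^ 2 * k ^ 2 + ∑ i : Fin (n + 1), x i.succ ^ 2) * s ^ 2 := by
  rw [norm_sq_eq_add, norm_sq_eq_add]
  simp only [stretch, Fin.cons_zero, Fin.cons_succ, mul_pow]
  rw [← Finset.sum_mul]
  ring

theorem stretch_self (x : EuclideanSpace ℝ (Fin (n + 2))) (k : ℝ) : stretch x k 0 = x := by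
  ext i
  refine Fin.cases ?_ (fun i => ?_) i <;> simp [stretch]

theorem continuous_stretch {α : Type*} [TopologicalSpace α] {f : α → EuclideanSpace ℝ (Fin (n + 2))}
    {k s : α → ℝ} {S : Set α} (hf : ContinuousOn f S) (hk : ContinuousOn k S)
    (hs : ContinuousOn s S) : ContinuousOn (fun a => stretch (f a) (k a) (s a)) S := by
  refine (PiLp.continuous_toLp 2 _).comp_continuousOn (continuousOn_pi.2 fun i => ?_)
  have hc : ∀ i, ContinuousOn (fun a => f a i) S := fun i =>
    (EuclideanSpace.proj (𝕜 := ℝ) i).continuous.comp_continuousOn hf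
  refine Fin.cases ?_ (fun i => ?_) i
  · simp only [Fin.cons_zero]
    have := hc 0
    fun_prop
  · simp only [Fin.cons_succ]
    have := hc i.succ
    fun_prop

theorem exists_bound_lt_one (t : Fin m → ℝ) (ht : ∀ j, |t j| < 1) :
    ∃ τ, 0 ≤ τ ∧ τ < 1 ∧ ∀ j, |t j| ≤ τ := by
  rcases isEmpty_or_nonempty (Fin m) with h | h
  · exact ⟨0, le_rfl, one_pos, fun j => isEmptyElim j⟩
  · obtain ⟨j, hj⟩ := Finite.exists_max fun j => |t j|
    exact ⟨|t j|, abs_nonneg _, ht j, hj⟩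

theorem mem_closedBall_iff_norm_sq {x : EuclideanSpace ℝ (Fin (n + 2))} :
    x ∈ Metric.closedBall (0 : EuclideanSpace ℝ (Fin (n + 2))) 1 ↔ ‖x‖ ^ 2 ≤ 1 := by
  rw [mem_closedBall_zero_iff, sq_le_one_iff₀ (norm_nonneg _)]

theorem mem_sphere_iff_norm_sq {x : EuclideanSpace ℝ (Fin (n + 2))} :
    x ∈ Metric.sphere (0 : EuclideanSpace ℝ (Fin (n + 2))) 1 ↔ ‖x‖ ^ 2 = 1 := by
  rw [mem_sphere_zero_iff_norm, ← sq_eq_sq₀ (norm_nonneg x) zero_le_one, one_pow]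

/-- The positive root of `a s² + 2 b s = c`. -/
theorem quadratic_root {a b c : ℝ} (ha : 0 ≤ a) (hb : 0 < b) (hc : 0 ≤ c) :
    a * (c / (b + √(b ^ 2 + a * c))) ^ 2 + 2 * b * (c / (b + √(b ^ 2 + a * c))) = c := by
  set D := √(b ^ 2 + a * c) with hD
  have hD0 : 0 ≤ D := Real.sqrt_nonneg _
  have hD2 : D ^ 2 = b ^ 2 + a * c := Real.sq_sqrt (by positivity)
  have hbD : 0 < b + D := by positivity
  field_simp
  linear_combination -c * hD2

/-- Points are stretched outwards until they reach the sphere. A purely radial stretch could run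
into a disk, so the coordinate `x 0` is moved only where `|x 0|` exceeds all `|t j|`; there it moves
further away from the disks. -/
theorem isCollared_model (t : Fin m → ℝ) (ht : ∀ j, |t j| < 1) :
    IsCollared (flatCompl n t) (Metric.closedBall 0 1) (Metric.sphere 0 1) := by
  obtain ⟨τ, hτ0, hτ1, hτ⟩ := exists_bound_lt_one t ht
  let R : EuclideanSpace ℝ (Fin (n + 2)) → ℝ := fun x => ∑ i : Fin (n + 1), x i.succ ^ 2
  let χ : EuclideanSpace ℝ (Fin (n + 2)) → ℝ := fun x => max 0 (|x 0| - τ)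
  let a : EuclideanSpace ℝ (Fin (n + 2)) → ℝ := fun x => x 0 ^ 2 * χ x ^ 2 + R x
  let b : EuclideanSpace ℝ (Fin (n + 2)) → ℝ := fun x => x 0 ^ 2 * χ x + R x
  -- The stretch that reaches norm `1`: a root of a quadratic equation, in the form that is
  -- continuous wherever `b` is positive.
  let S : EuclideanSpace ℝ (Fin (n + 2)) → ℝ := fun x =>
    (1 - ‖x‖ ^ 2) / (b x + √(b x ^ 2 + a x * (1 - ‖x‖ ^ 2)))
  have hRc : Continuous R := by fun_prop
  have hχc : Continuous χ := by fun_prop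
  have hac : Continuous a := by fun_prop
  have hbc : Continuous b := by fun_prop
  have hR : ∀ x, 0 ≤ R x := fun x => Finset.sum_nonneg fun i _ => sq_nonneg _
  have hχ : ∀ x, 0 ≤ χ x := fun x => le_max_left _ _
  have ha : ∀ x, 0 ≤ a x := fun x => by have := hR x; positivity
  have hN : ∀ x, ‖x‖ ^ 2 = x 0 ^ 2 + R x := norm_sq_eq_add
  -- The core consists of the points that the stretch does not move.
  refine ⟨Metric.closedBall 0 1 ∩ {x | b x ≤ 0},
    fun q => stretch q.2 (χ q.2) ((1 - (q.1 : ℝ)) * S q.2),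
    Metric.isClosed_closedBall.inter (isClosed_le hbc continuous_const), inter_subset_left, ?_, ?_,
    ?_⟩
  · rw [Set.disjoint_left]
    rintro x ⟨-, hx⟩ hxS
    rw [mem_sphere_iff_norm_sq, hN] at hxS
    have h1 : 0 ≤ x 0 ^ 2 * χ x := mul_nonneg (sq_nonneg _) (hχ x)
    have h2 : x 0 ^ 2 * χ x + R x ≤ 0 := hx
    have h3 : R x = 0 := by linarith [hR x]
    have h4 : x 0 ^ 2 = 1 := by linarith
    have h5 : |x 0| = 1 := by rw [← sq_eq_sq₀ (abs_nonneg _) zero_le_one, sq_abs, h4, one_pow]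
    have h6 : 1 - τ ≤ χ x := by simp only [χ, h5]; exact le_max_right _ _
    rw [h4] at h2
    linarith
  · have hb : ∀ q ∈ (univ : Set unitInterval) ×ˢ ((Metric.closedBall 0 1 ∩ flatCompl n t) \
        (Metric.closedBall 0 1 ∩ {x | b x ≤ 0})), 0 < b q.2 := by
      rintro q ⟨-, hq⟩
      by_contra h
      exact hq.2 ⟨hq.1.1, not_lt.1 h⟩
    refine continuous_stretch continuousOn_snd (by fun_prop) ?_
    refine ContinuousOn.mul (by fun_prop) (ContinuousOn.div (by fun_prop) (by fun_prop) ?_)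
    intro q hq
    have := hb q hq
    positivity
  · intro x hx
    have hb : 0 < b x := by
      by_contra h
      exact hx.2 ⟨hx.1.1, not_lt.1 h⟩
    have hx1 := mem_closedBall_iff_norm_sq.1 hx.1.1
    have hroot := quadratic_root (ha x) hb (sub_nonneg.2 hx1)
    have hS0 : 0 ≤ S x := by
      have : 0 ≤ 1 - ‖x‖ ^ 2 := sub_nonneg.2 hx1
      positivity
    have hnorm : ∀ s, ‖stretch x (χ x) s‖ ^ 2 = ‖x‖ ^ 2 + (a x * s ^ 2 + 2 * b x * s) := fun s => by
      rw [stretch_norm_sq]; simp only [a, b, R]; ring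
    refine ⟨?_, ?_, ?_, ?_⟩
    · rw [mem_sphere_iff_norm_sq, hnorm]
      simp only [Icc.coe_zero, sub_zero, one_mul]
      linarith
    · intro s
      set r := (1 - (s : ℝ)) * S x with hr
      have hr0 : 0 ≤ r := mul_nonneg (by linarith [s.2.2]) hS0
      have hr1 : r ≤ S x := mul_le_of_le_one_left hS0 (by linarith [s.2.1])
      refine ⟨?_, ?_⟩
      · rw [mem_closedBall_iff_norm_sq, hnorm]
        have : a x * r ^ 2 + 2 * b x * r ≤ a x * S x ^ 2 + 2 * b x * S x := by
          have := ha x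
          gcongr
        have hroot' : a x * S x ^ 2 + 2 * b x * S x = 1 - ‖x‖ ^ 2 := hroot
        linarith
      · rintro j ⟨h0, h1⟩
        dsimp only at h0 h1
        rw [← hr] at h0 h1
        rw [stretch_zero_apply] at h0
        rw [stretch_one_apply] at h1
        have hx1 : x 1 = 0 := by
          rcases mul_eq_zero.1 h1 with h | h
          · exact h
          · linarith
        have hxj : x 0 ≠ t j := fun h => hx.1.2 j ⟨h, hx1⟩
        -- For small `|x 0|` this coordinate is unchanged; for large `|x 0|` it stays beyond every
        -- `t j`.
        rcases le_or_gt |x 0| τ with h | h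
        · have : χ x = 0 := max_eq_left (by linarith)
          rw [this] at h0
          apply hxj
          linarith
        · have h2 := hτ j
          rw [← h0, abs_mul] at h2
          have h3 : 1 ≤ |1 + r * χ x| := by
            have := mul_nonneg hr0 (hχ x)
            rw [abs_of_nonneg (by linarith)]; linarith
          nlinarith [abs_nonneg (x 0)]
    · simp [stretch_self]
    · intro hxS s
      have : S x = 0 := by
        simp only [S]
        rw [mem_sphere_iff_norm_sq.1 hxS]
        simp
      simp [this, stretch_self]

/-- The north pole. -/
noncomputable def pole (n : ℕ) : EuclideanSpace ℝ (Fin (n + 2)) := EuclideanSpace.single 1 1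

theorem pole_zero : pole n 0 = 0 := by simp [pole]

theorem pole_one : pole n 1 = 1 := by simp [pole]

theorem norm_pole : ‖pole n‖ = 1 := by simp [pole]

theorem mem_flatCompl_of_ne {t : Fin m → ℝ} {x : EuclideanSpace ℝ (Fin (n + 2))} (h : x 1 ≠ 0) :
    x ∈ flatCompl n t := fun _ hj => h hj.2

/-- The normalized point. -/
noncomputable def toSphere (x : EuclideanSpace ℝ (Fin (n + 2))) : EuclideanSpace ℝ (Fin (n + 2)) :=
  ‖x‖⁻¹ • x

theorem toSphere_mem {x : EuclideanSpace ℝ (Fin (n + 2))} (h : x ≠ 0) :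
    toSphere x ∈ Metric.sphere (0 : EuclideanSpace ℝ (Fin (n + 2))) 1 := by
  rw [mem_sphere_zero_iff_norm, toSphere, norm_smul, norm_inv, norm_norm,
    inv_mul_cancel₀ (norm_ne_zero_iff.2 h)]

theorem toSphere_of_norm {x : EuclideanSpace ℝ (Fin (n + 2))} (h : ‖x‖ = 1) : toSphere x = x := by
  simp [toSphere, h]

/-- The great circle arc from a point of the upper or lower closed hemisphere to the pole. -/
theorem exists_arc (t : Fin m → ℝ) {x : EuclideanSpace ℝ (Fin (n + 2))}
    (hx : x ∈ Metric.sphere 0 1 ∩ flatCompl n t) {c : ℝ} (hc : c = 1 ∨ c = -1) (hxc : 0 ≤ c * x 1) :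
    ∃ p : Path x (c • pole n), InSet (Metric.sphere 0 1 ∩ flatCompl n t) p := by
  have hxn : ‖x‖ = 1 := by simpa using hx.1
  have hcc : c * c = 1 := by rcases hc with rfl | rfl <;> norm_num
  let f : unitInterval → EuclideanSpace ℝ (Fin (n + 2)) :=
    fun s => (1 - (s : ℝ)) • x + (s : ℝ) • c • pole n
  have hf1 : ∀ s, c * f s 1 = (1 - s) * (c * x 1) + s := fun s => by
    simp only [f, PiLp.add_apply, PiLp.smul_apply, pole_one, smul_eq_mul, mul_one]
    linear_combination (s : ℝ) * hcc
  have hpos : ∀ s : unitInterval, s ≠ 0 → f s 1 ≠ 0 := by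
    intro s hs h
    have h1 := hf1 s
    rw [h, mul_zero] at h1
    have : 0 < (s : ℝ) := unitInterval.pos_iff_ne_zero.2 hs
    have h2 : 0 ≤ (1 - (s : ℝ)) * (c * x 1) := mul_nonneg (by linarith [s.2.2]) hxc
    linarith
  have hf0 : f 0 = x := by simp [f]
  have hfone : f 1 = c • pole n := by simp [f]
  have hne : ∀ s, f s ≠ 0 := by
    intro s h
    by_cases hs : s = 0
    · rw [hs, hf0] at h
      rw [h, norm_zero] at hxn
      exact zero_ne_one hxn
    · exact hpos s hs (by rw [h]; rfl)
  have hfc : Continuous f := by fun_prop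
  have hcn : ‖c • pole n‖ = 1 := by
    rw [norm_smul, norm_pole, mul_one]; rcases hc with rfl | rfl <;> simp
  refine ⟨⟨⟨fun s => toSphere (f s), ?_⟩, ?_, ?_⟩, fun s => ⟨toSphere_mem (hne s), ?_⟩⟩
  · exact (hfc.norm.inv₀ fun s => norm_ne_zero_iff.2 (hne s)).smul hfc
  · simp only [hf0]; exact toSphere_of_norm hxn
  · simp only [hfone]; exact toSphere_of_norm hcn
  · by_cases hs : s = 0
    · subst hs
      show toSphere (f 0) ∈ _
      rw [hf0, toSphere_of_norm hxn]
      exact hx.2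
    · refine mem_flatCompl_of_ne ?_
      show (‖f s‖⁻¹ • f s) 1 ≠ 0
      rw [PiLp.smul_apply, smul_eq_mul]
      exact mul_ne_zero (inv_ne_zero (norm_ne_zero_iff.2 (hne s))) (hpos s hs)

theorem pole_mem (t : Fin m → ℝ) {c : ℝ} (hc : c = 1 ∨ c = -1) :
    c • pole n ∈ Metric.sphere 0 1 ∩ flatCompl n t := by
  refine ⟨?_, mem_flatCompl_of_ne ?_⟩
  · rw [mem_sphere_zero_iff_norm, norm_smul, norm_pole]
    rcases hc with rfl | rfl <;> simp
  · rw [PiLp.smul_apply, pole_one]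
    rcases hc with rfl | rfl <;> simp

theorem exists_path_to_pole (t : Fin m → ℝ) (ht : ∀ j, |t j| < 1)
    {x : EuclideanSpace ℝ (Fin (n + 2))} (hx : x ∈ Metric.sphere 0 1 ∩ flatCompl n t) :
    ∃ p : Path (pole n) x, InSet (Metric.sphere 0 1 ∩ flatCompl n t) p := by
  rcases le_total 0 (x 1) with h | h
  · obtain ⟨p, hp⟩ := exists_arc t hx (c := 1) (Or.inl rfl) (by linarith)
    exact ⟨(p.cast rfl (by simp)).symm, InSet.symm (fun s => hp s)⟩
  · obtain ⟨p, hp⟩ := exists_arc t hx (c := -1) (Or.inr rfl) (by linarith)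
    -- This half circle joins the poles through the first unit vector. It has `x 1 = 0` only at that
    -- vector, which is off all disks because `|t j| < 1`.
    let q : Path (pole n) ((-1 : ℝ) • pole n) :=
      ⟨⟨fun s => Real.cos (Real.pi * s) • pole n + Real.sin (Real.pi * s) • EuclideanSpace.single 0 1,
        by fun_prop⟩, by simp, by simp⟩
    have hq : ∀ s, q s = Real.cos (Real.pi * s) • pole n +
      Real.sin (Real.pi * s) • EuclideanSpace.single 0 1 := fun s => rfl
    have hq0 : ∀ s, q s 0 = Real.sin (Real.pi * s) := fun s => by simp [hq, pole_zero]
    have hq1 : ∀ s, q s 1 = Real.cos (Real.pi * s) := fun s => by simp [hq, pole_one]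
    refine ⟨q.trans p.symm, InSet.trans (fun s => ⟨?_, ?_⟩) hp.symm⟩
    · rw [mem_sphere_iff_norm_sq, norm_sq_eq_add, Fin.sum_univ_succ, hq0]
      have h1 : q s (Fin.succ 0) = Real.cos (Real.pi * s) := hq1 s
      have h2 : ∀ i : Fin n, q s i.succ.succ = 0 := fun i => by
        have e1 : i.succ.succ ≠ (1 : Fin (n + 2)) := fun h => by
          have := congrArg Fin.val h; simp at this
        have e0 : i.succ.succ ≠ (0 : Fin (n + 2)) := Fin.succ_ne_zero _
        rw [hq, PiLp.add_apply, PiLp.smul_apply, PiLp.smul_apply, pole, PiLp.single_apply,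
          PiLp.single_apply, if_neg e1, if_neg e0]
        simp
      rw [h1, Finset.sum_eq_zero fun i _ => by rw [h2 i]; ring]
      linarith [Real.sin_sq_add_cos_sq (Real.pi * s)]
    · rintro j ⟨h0, h1⟩
      rw [hq0] at h0
      rw [hq1] at h1
      have := Real.sin_sq_add_cos_sq (Real.pi * s)
      rw [h0, h1] at this
      have h2 := ht j
      have h3 : |t j| ^ 2 = 1 := by rw [sq_abs]; linarith
      nlinarith [abs_nonneg (t j)]

/-- Every point of the ball off the disks can be joined to a point of the sphere. -/
theorem exists_path_to_sphere (t : Fin m → ℝ) {y : EuclideanSpace ℝ (Fin (n + 2))}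
    (hy : y ∈ Metric.closedBall 0 1 ∩ flatCompl n t) :
    ∃ x ∈ Metric.sphere 0 1 ∩ flatCompl n t, ∃ p : Path x y,
      InSet (Metric.closedBall 0 1 ∩ flatCompl n t) p := by
  obtain ⟨c, hc, hyc⟩ : ∃ c : ℝ, (c = 1 ∨ c = -1) ∧ 0 ≤ c * y 1 := by
    rcases le_total 0 (y 1) with h | h
    exacts [⟨1, Or.inl rfl, by linarith⟩, ⟨-1, Or.inr rfl, by linarith⟩]
  have hcc : c * c = 1 := by rcases hc with rfl | rfl <;> norm_num
  refine ⟨c • pole n, pole_mem t hc, Path.segment _ _, fun s => ⟨?_, ?_⟩⟩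
  · exact (convex_closedBall _ _).lineMap_mem (Metric.sphere_subset_closedBall (pole_mem t hc).1)
      hy.1 ⟨s.2.1, s.2.2⟩
  · by_cases hs : s = 1
    · subst hs
      simpa using hy.2
    · refine mem_flatCompl_of_ne fun h => ?_
      have hs1 : (s : ℝ) < 1 := lt_of_le_of_ne s.2.2 fun h => hs (Subtype.ext h)
      have h1 : c * (Path.segment (c • pole n) y s) 1 = (1 - s) + s * (c * y 1) := by
        rw [Path.segment_apply, AffineMap.lineMap_apply_module]
        simp only [PiLp.add_apply, PiLp.smul_apply, pole_one, smul_eq_mul, mul_one]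
        linear_combination (1 - (s : ℝ)) * hcc
      rw [h, mul_zero] at h1
      have := mul_nonneg s.2.1 hyc
      linarith

end Model

/-! ### Pushing paths in the model ball into the sphere. -/

section ModelFull

variable {n m : ℕ}

/-- The section over the first two coordinates with values in the sphere. -/
noncomputable def sphereSection (x : EuclideanSpace ℝ (Fin (n + 1 + 2))) :
    EuclideanSpace ℝ (Fin (n + 1 + 2)) :=
  WithLp.toLp 2 (Fin.cons (x 0) (Fin.cons (x 1)
    (Fin.cons (√(1 - x 0 ^ 2 - x 1 ^ 2)) (0 : Fin n → ℝ))))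

theorem sphereSection_zero (x : EuclideanSpace ℝ (Fin (n + 1 + 2))) : sphereSection x 0 = x 0 := rfl

theorem sphereSection_one (x : EuclideanSpace ℝ (Fin (n + 1 + 2))) : sphereSection x 1 = x 1 := rfl

theorem continuous_sphereSection : Continuous (sphereSection (n := n)) := by
  refine (PiLp.continuous_toLp 2 _).comp (continuous_pi fun i => ?_)
  refine Fin.cases ?_ (fun i => ?_) i
  · simp only [Fin.cons_zero]; fun_prop
  refine Fin.cases ?_ (fun i => ?_) i
  · simp only [Fin.cons_zero, Fin.cons_succ]; fun_prop
  refine Fin.cases ?_ (fun i => ?_) i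
  · simp only [Fin.cons_zero, Fin.cons_succ]; fun_prop
  · simp only [Fin.cons_succ, Pi.zero_apply]; fun_prop

theorem sq_add_sq_le_norm_sq (x : EuclideanSpace ℝ (Fin (n + 2))) :
    x 0 ^ 2 + x 1 ^ 2 ≤ ‖x‖ ^ 2 := by
  rw [norm_sq_eq_add, Fin.sum_univ_succ, Fin.succ_zero_eq_one]
  have : 0 ≤ ∑ i : Fin n, x i.succ.succ ^ 2 := Finset.sum_nonneg fun i _ => sq_nonneg _
  linarith

theorem sphereSection_mem {x : EuclideanSpace ℝ (Fin (n + 1 + 2))}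
    (hx : x ∈ Metric.closedBall 0 1) : sphereSection x ∈ Metric.sphere 0 1 := by
  have h1 := sq_add_sq_le_norm_sq x
  have h2 := mem_closedBall_iff_norm_sq.1 hx
  rw [mem_sphere_iff_norm_sq, EuclideanSpace.real_norm_sq_eq, Fin.sum_univ_succ, Fin.sum_univ_succ,
    Fin.sum_univ_succ]
  simp only [sphereSection, Fin.cons_zero, Fin.cons_succ, Pi.zero_apply]
  rw [Real.sq_sqrt (by linarith)]
  simp

theorem sphereSection_pole : sphereSection (pole (n + 1)) = pole (n + 1) := by
  ext i
  refine Fin.cases ?_ (fun i => ?_) i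
  · rfl
  refine Fin.cases ?_ (fun i => ?_) i
  · rfl
  have e1 : i.succ.succ ≠ (1 : Fin (n + 1 + 2)) := fun h => by
    have := congrArg Fin.val h; simp at this
  rw [show pole (n + 1) i.succ.succ = 0 by rw [pole, PiLp.single_apply, if_neg e1]]
  refine Fin.cases ?_ (fun i => ?_) i
  · change √(1 - pole (n + 1) 0 ^ 2 - pole (n + 1) 1 ^ 2) = 0
    simp [pole_zero, pole_one]
  · rfl

theorem sphereSection_mapsTo (t : Fin m → ℝ) : MapsTo (sphereSection (n := n))
    (Metric.closedBall 0 1 ∩ flatCompl (n + 1) t) (Metric.sphere 0 1 ∩ flatCompl (n + 1) t) :=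
  fun _ hx => ⟨sphereSection_mem hx.1, hx.2⟩

/-- Membership in the disks depends only on `x 0` and `x 1`. The straight homotopy to the section
keeps both coordinates, so it stays in the ball and off the disks. -/
theorem isFull_model (t : Fin m → ℝ) (ht : ∀ j, |t j| < 1) :
    IsFull (Metric.sphere 0 1 ∩ flatCompl (n + 1) t)
      (Metric.closedBall 0 1 ∩ flatCompl (n + 1) t) := by
  intro y z γ hy hz hγ
  obtain ⟨a, ha⟩ := exists_path_to_pole t ht hy
  obtain ⟨b, hb⟩ := exists_path_to_pole t ht hz
  have hsub : Metric.sphere 0 1 ∩ flatCompl (n + 1) t ⊆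
      Metric.closedBall 0 1 ∩ flatCompl (n + 1) t := fun x hx =>
    ⟨Metric.sphere_subset_closedBall hx.1, hx.2⟩
  -- The path is closed up at the pole inside the sphere. The section fixes the pole, so loops there
  -- remain loops.
  let lp : Path (pole (n + 1)) (pole (n + 1)) := (a.trans γ).trans b.symm
  have hlp : InSet (Metric.closedBall 0 1 ∩ flatCompl (n + 1) t) lp :=
    ((ha.mono hsub).trans hγ).trans (hb.mono hsub).symm
  let δ : Path (pole (n + 1)) (pole (n + 1)) :=
    (lp.map continuous_sphereSection).cast sphereSection_pole.symm sphereSection_pole.symm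
  have hδ : InSet (Metric.sphere 0 1 ∩ flatCompl (n + 1) t) δ := fun s =>
    sphereSection_mapsTo t (hlp s)
  refine ⟨(a.symm.trans δ).trans b, (ha.symm.trans hδ).trans hb, fun G _ Φ hΦ => ?_⟩
  have hF : Continuous fun q : unitInterval × unitInterval =>
      AffineMap.lineMap (lp q.1) (sphereSection (lp q.1)) (q.2 : ℝ) := by
    have := continuous_sphereSection (n := n)
    simp only [AffineMap.lineMap_apply]
    fun_prop
  have hkey := hΦ.square (fun q => AffineMap.lineMap (lp q.1) (sphereSection (lp q.1)) (q.2 : ℝ)) hF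
    (fun q => ⟨(convex_closedBall _ _).lineMap_mem (hlp q.1).1
      (Metric.sphere_subset_closedBall (sphereSection_mapsTo t (hlp q.1)).1) ⟨q.2.2.1, q.2.2.2⟩, by
        have h0 : ∀ s : ℝ, (AffineMap.lineMap (lp q.1) (sphereSection (lp q.1)) s) 0 = lp q.1 0 :=
          fun s => by
            rw [AffineMap.lineMap_apply_module, PiLp.add_apply, PiLp.smul_apply, PiLp.smul_apply,
              sphereSection_zero]; simp only [smul_eq_mul]; ring
        have h1 : ∀ s : ℝ, (AffineMap.lineMap (lp q.1) (sphereSection (lp q.1)) s) 1 = lp q.1 1 :=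
          fun s => by
            rw [AffineMap.lineMap_apply_module, PiLp.add_apply, PiLp.smul_apply, PiLp.smul_apply,
              sphereSection_one]; simp only [smul_eq_mul]; ring
        intro j
        dsimp only
        rw [h0, h1]
        exact (hlp q.1).2 j⟩)
    lp δ (Path.refl _) (Path.refl _) (fun s => by simp)
    (fun s => by simp; rfl) (fun s => by simp [sphereSection_pole])
    (fun s => by simp [sphereSection_pole])
  rw [hΦ.map_refl (hsub (ha.source)), mul_one, one_mul] at hkey
  rw [hΦ.trans _ _ ((ha.symm.trans hδ).mono hsub) (hb.mono hsub),
    hΦ.trans _ _ (ha.symm.mono hsub) (hδ.mono hsub), hΦ.map_symm _ (ha.mono hsub), hkey,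
    hΦ.map_conj _ _ _ (ha.mono hsub) hγ (hb.mono hsub)]
  group

end ModelFull

/-! ### Slits below the disks and circles around them. -/

section ModelFree

variable {n m : ℕ}

/-- A family of loops in `T` at `x` is a free basis of the fundamental group of `T` at `x`, in terms
of representations: there is a representation `Φ` that detects the expression of a loop as a word
in the family. -/
def IsFreeBasis {A : Type} [TopologicalSpace A] (T : Set A) {x : A} (g : Fin m → Path x x) : Prop :=
  ∃ Φ : ∀ ⦃x y : A⦄, Path x y → FreeGroup (Fin m), IsRep T Φ ∧ (∀ k, InSet T (g k)) ∧
    (∀ k, Φ (g k) = FreeGroup.of k) ∧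
    ∀ (G : Type) [Group G] (Φ' : ∀ ⦃x y : A⦄, Path x y → G), IsRep T Φ' →
      ∀ γ : Path x x, InSet T γ → Φ' γ = FreeGroup.lift (fun k => Φ' (g k)) (Φ γ)

/-- The point `(a, b, 0)`. -/
noncomputable def planePt (n : ℕ) (a b : ℝ) : EuclideanSpace ℝ (Fin (n + 2)) :=
  WithLp.toLp 2 (Fin.cons a (Fin.cons b (0 : Fin n → ℝ)))

theorem planePt_zero (a b : ℝ) : planePt n a b 0 = a := rfl

theorem planePt_one (a b : ℝ) : planePt n a b 1 = b := rfl

theorem norm_planePt_sq (a b : ℝ) : ‖planePt n a b‖ ^ 2 = a ^ 2 + b ^ 2 := by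
  rw [EuclideanSpace.real_norm_sq_eq, Fin.sum_univ_succ, Fin.sum_univ_succ]
  simp [planePt]

theorem planePt_eq (a b : ℝ) : planePt n a b =
    a • EuclideanSpace.single 0 1 + b • EuclideanSpace.single 1 1 := by
  ext i
  refine Fin.cases ?_ (fun i => ?_) i
  · simp [planePt]
  refine Fin.cases ?_ (fun i => ?_) i
  · simp [planePt]
  have e1 : i.succ.succ ≠ (1 : Fin (n + 2)) := fun h => by
    have := congrArg Fin.val h; simp at this
  have e0 : i.succ.succ ≠ (0 : Fin (n + 2)) := Fin.succ_ne_zero _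
  rw [PiLp.add_apply, PiLp.smul_apply, PiLp.smul_apply, PiLp.single_apply, PiLp.single_apply,
    if_neg e1, if_neg e0]
  simp [planePt]

/-- The circle of radius `ε` around `(a, 0, 0)` in the plane of the first two coordinates. -/
noncomputable def planeCircle (n : ℕ) (a ε : ℝ) : Path (planePt n (a + ε) 0) (planePt n (a + ε) 0) where
  toFun s := planePt n (a + ε * Real.cos (2 * Real.pi * s)) (ε * Real.sin (2 * Real.pi * s))
  continuous_toFun := by simp only [planePt_eq]; fun_prop
  source' := by simp
  target' := by simp

theorem planeCircle_apply (a ε : ℝ) (s : unitInterval) : planeCircle n a ε s =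
    planePt n (a + ε * Real.cos (2 * Real.pi * s)) (ε * Real.sin (2 * Real.pi * s)) := rfl

/-- The bound `8 * ε` keeps the slit neighborhoods of width `3 * ε` disjoint and the circles of
radius `ε` off foreign slits. The margin `2 * ε` leaves room for meridian disks of twice that
radius. -/
theorem exists_separation (t : Fin m → ℝ) (hinj : Function.Injective t) (ht : ∀ j, |t j| < 1) :
    ∃ ε > 0, (∀ k l, k ≠ l → 8 * ε < |t k - t l|) ∧ ∀ k, |t k| + 2 * ε < 1 := by
  have h1 : ∀ᶠ ε in nhdsWithin (0 : ℝ) (Ioi 0), ∀ k l, k ≠ l → 8 * ε < |t k - t l| := by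
    rw [Filter.eventually_all]; intro k
    rw [Filter.eventually_all]; intro l
    by_cases hkl : k = l
    · exact Filter.Eventually.of_forall fun _ h => absurd hkl h
    have hpos : 0 < |t k - t l| := abs_pos.2 (sub_ne_zero.2 fun h => hkl (hinj h))
    filter_upwards [nhdsWithin_le_nhds (Iio_mem_nhds (show (0 : ℝ) < |t k - t l| / 8 by positivity))]
      with ε hε _
    rw [mem_Iio, lt_div_iff₀ (by norm_num)] at hε
    linarith
  have h2 : ∀ᶠ ε in nhdsWithin (0 : ℝ) (Ioi 0), ∀ k, |t k| + 2 * ε < 1 := by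
    rw [Filter.eventually_all]; intro k
    filter_upwards [nhdsWithin_le_nhds (Iio_mem_nhds
      (show (0 : ℝ) < (1 - |t k|) / 2 by linarith [ht k]))] with ε hε
    rw [mem_Iio, lt_div_iff₀ (by norm_num)] at hε
    linarith
  obtain ⟨ε, ⟨h, h'⟩, hε⟩ := ((h1.and h2).and self_mem_nhdsWithin).exists
  exact ⟨ε, hε, h, h'⟩

/-- The signed horizontal distance to the line through the pole and `(a, 0)`. -/
noncomputable def lineSlope (a : ℝ) (x : EuclideanSpace ℝ (Fin (n + 2))) : ℝ := x 0 - a * (1 - x 1)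

/-- The complement of the slits below the points `(tₖ, 0)` on the lines through the pole. -/
def slitCompl (n : ℕ) (t : Fin m → ℝ) : Set (EuclideanSpace ℝ (Fin (n + 2))) :=
  {x | ∀ k, 0 < x 1 ∨ lineSlope (t k) x ≠ 0}

/-- A convex neighborhood of a slit. -/
def slitNhd (n : ℕ) (δ a : ℝ) : Set (EuclideanSpace ℝ (Fin (n + 2))) :=
  {x | x 1 < 0 ∧ lineSlope a x < δ * (1 - x 1) ∧ - lineSlope a x < δ * (1 - x 1)}

theorem continuous_lineSlope (a : ℝ) : Continuous (lineSlope (n := n) a) := by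
  unfold lineSlope; fun_prop

theorem lineSlope_lineMap (a : ℝ) (x y : EuclideanSpace ℝ (Fin (n + 2))) (s : ℝ) :
    lineSlope a (AffineMap.lineMap x y s) = (1 - s) * lineSlope a x + s * lineSlope a y := by
  simp only [lineSlope, AffineMap.lineMap_apply_module, PiLp.add_apply, PiLp.smul_apply, smul_eq_mul]
  ring

theorem lineMap_one_apply (x y : EuclideanSpace ℝ (Fin (n + 2))) (s : ℝ) :
    (AffineMap.lineMap x y s : EuclideanSpace ℝ (Fin (n + 2))) 1 = (1 - s) * x 1 + s * y 1 := by
  simp only [AffineMap.lineMap_apply_module, PiLp.add_apply, PiLp.smul_apply, smul_eq_mul]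

theorem lineSlope_pole (a : ℝ) : lineSlope a (pole n) = 0 := by simp [lineSlope, pole_zero, pole_one]

theorem isOpen_slitCompl (t : Fin m → ℝ) : IsOpen (slitCompl n t) := by
  have : slitCompl n t = ⋂ k, ({x | 0 < x 1} ∪ {x | lineSlope (t k) x ≠ 0}) := by
    ext x; simp [slitCompl]
  rw [this]
  refine isOpen_iInter_of_finite fun k => IsOpen.union ?_ ?_
  · exact isOpen_lt continuous_const (by fun_prop)
  · exact isOpen_ne_fun (continuous_lineSlope _) continuous_const

theorem isOpen_slitNhd (δ a : ℝ) : IsOpen (slitNhd n δ a) := by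
  have h1 := continuous_lineSlope (n := n) a
  have h2 : Continuous fun x : EuclideanSpace ℝ (Fin (n + 2)) => x 1 := by fun_prop
  have h3 : Continuous fun x : EuclideanSpace ℝ (Fin (n + 2)) => δ * (1 - x 1) := by fun_prop
  exact (isOpen_lt h2 continuous_const).inter ((isOpen_lt h1 h3).inter (isOpen_lt h1.neg h3))

theorem convex_slitNhd (δ a : ℝ) : Convex ℝ (slitNhd n δ a) := by
  rw [convex_iff_forall_pos]
  rintro x ⟨hx1, hx2, hx3⟩ y ⟨hy1, hy2, hy3⟩ p q hp hq hpq
  have e : p • x + q • y = AffineMap.lineMap x y q := by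
    rw [AffineMap.lineMap_apply_module, ← hpq]; simp
  have h1 : ∀ u v u' v' : ℝ, u < v → u' < v' → p * u + q * u' < p * v + q * v' :=
    fun u v u' v' h h' => by nlinarith
  obtain rfl : p = 1 - q := by linarith
  rw [e]
  refine ⟨?_, ?_, ?_⟩
  · rw [lineMap_one_apply]; nlinarith [h1 _ _ _ _ hx1 hy1]
  · rw [lineMap_one_apply, lineSlope_lineMap]; nlinarith [h1 _ _ _ _ hx2 hy2]
  · rw [lineMap_one_apply, lineSlope_lineMap]; nlinarith [h1 _ _ _ _ hx3 hy3]

theorem slitCompl_subset_flatCompl (t : Fin m → ℝ) : slitCompl n t ⊆ flatCompl n t := by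
  rintro x hx j ⟨h0, h1⟩
  rcases hx j with h | h
  · linarith
  · exact h (by simp [lineSlope, h0, h1])

theorem slitNhd_subset_flatCompl (t : Fin m → ℝ) (δ a : ℝ) : slitNhd n δ a ⊆ flatCompl n t :=
  fun _ hx => mem_flatCompl_of_ne hx.1.ne

/-- The slits lie on lines through the pole, where `lineSlope` vanishes, so `lineSlope` is just
scaled along a segment from the pole. Thus the slit complement is star-shaped about the pole. -/
theorem lineMap_pole_mem_slitCompl {t : Fin m → ℝ} {y : EuclideanSpace ℝ (Fin (n + 2))}
    (hy : y ∈ slitCompl n t) (s : unitInterval) :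
    AffineMap.lineMap (pole n) y (s : ℝ) ∈ slitCompl n t := by
  intro k
  rw [lineMap_one_apply, lineSlope_lineMap, lineSlope_pole, pole_one]
  by_cases hs : s = 0
  · subst hs; left; simp
  have hs0 : 0 < (s : ℝ) := unitInterval.pos_iff_ne_zero.2 hs
  rcases hy k with h | h
  · left; nlinarith [s.2.2]
  · right
    rw [mul_zero, zero_add]
    exact mul_ne_zero hs0.ne' h

theorem flatCompl_subset_iUnion (t : Fin m → ℝ) {δ : ℝ} (hδ : 0 < δ) :
    flatCompl n t ⊆ ⋃ o : Option (Fin m), o.elim (slitCompl n t) fun k => slitNhd n δ (t k) := by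
  intro x hx
  by_cases h : x ∈ slitCompl n t
  · exact mem_iUnion.2 ⟨none, h⟩
  · simp only [slitCompl, mem_ofPred_eq, not_forall, not_or, not_lt, not_not] at h
    obtain ⟨k, h1, h2⟩ := h
    have h3 : x 1 ≠ 0 := fun h => hx k ⟨by simpa [lineSlope, h, sub_eq_zero] using h2, h⟩
    have h4 : x 1 < 0 := lt_of_le_of_ne h1 h3
    refine mem_iUnion.2 ⟨some k, h4, ?_, ?_⟩ <;> rw [h2] <;> nlinarith

/-- The two slopes differ by `(t k - t l) * (1 - x 1)`, while each is below `3 * ε * (1 - x 1)` in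
size. -/
theorem slitNhd_disjoint {t : Fin m → ℝ} {ε : ℝ}
    (hsep : ∀ k l, k ≠ l → 8 * ε < |t k - t l|) {k l : Fin m}
    {x : EuclideanSpace ℝ (Fin (n + 2))} (hk : x ∈ slitNhd n (3 * ε) (t k))
    (hl : x ∈ slitNhd n (3 * ε) (t l)) : k = l := by
  by_contra hkl
  obtain ⟨h1, h2, h3⟩ := hk
  obtain ⟨-, h4, h5⟩ := hl
  have hs := hsep k l hkl
  have e : lineSlope (t l) x - lineSlope (t k) x = (t k - t l) * (1 - x 1) := by simp only [lineSlope]; ring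
  have hpos : 0 < 1 - x 1 := by linarith
  have h6 : |(t k - t l) * (1 - x 1)| < 6 * ε * (1 - x 1) := by
    rw [← e, abs_lt]; constructor <;> linarith
  rw [abs_mul, abs_of_pos hpos] at h6
  have h7 := lt_of_mul_lt_mul_right h6 hpos.le
  have : 0 < ε := by
    by_contra h
    have : 3 * ε * (1 - x 1) ≤ 0 := mul_nonpos_of_nonpos_of_nonneg (by linarith) hpos.le
    linarith
  linarith

theorem planePt_mem_closedBall {a u v ε : ℝ} (ha : |a| + ε ≤ 1) (hε : 0 ≤ ε)
    (huv : u ^ 2 + v ^ 2 ≤ ε ^ 2) : planePt n (a + u) v ∈ Metric.closedBall 0 1 := by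
  rw [mem_closedBall_iff_norm_sq, norm_planePt_sq]
  have h1 : |u| ≤ ε := abs_le_of_sq_le_sq (by nlinarith [sq_nonneg v]) hε
  have h2 : a * u ≤ |a| * ε := by
    calc a * u ≤ |a * u| := le_abs_self _
      _ = |a| * |u| := abs_mul _ _
      _ ≤ |a| * ε := by gcongr
  nlinarith [sq_abs a, abs_nonneg a]

theorem planeCircle_mem_closedBall {a ε : ℝ} (ha : |a| + 2 * ε < 1) (hε : 0 < ε) :
    InSet (Metric.closedBall 0 1) (planeCircle n a ε) := by
  intro s
  rw [planeCircle_apply]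
  refine planePt_mem_closedBall (ε := ε) (by linarith) hε.le (le_of_eq ?_)
  rw [mul_pow, mul_pow, ← mul_add, Real.cos_sq_add_sin_sq, mul_one]

/-- As `|t k| < 1`, the line of the slit makes an angle below `π / 4` with the vertical. Hence the
circle can meet its own slit only on the lower arc between the parameters `5/8` and `7/8`; the other
slits are too far away. -/
theorem planePt_mem_slitCompl {t : Fin m → ℝ} (ht : ∀ j, |t j| < 1) {ε : ℝ} (hε : 0 < ε)
    (hsep : ∀ k l, k ≠ l → 8 * ε < |t k - t l|) (k : Fin m) (φ : ℝ)
    (hφ : 0 < Real.sin φ ∨ 0 ≤ Real.cos (2 * φ)) :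
    planePt n (t k + ε * Real.cos φ) (ε * Real.sin φ) ∈ slitCompl n t := by
  have hsc := Real.sin_sq_add_cos_sq φ
  intro l
  rw [planePt_one]
  rcases hφ with h | h
  · exact Or.inl (by positivity)
  right
  simp only [lineSlope, planePt_zero, planePt_one]
  intro h0
  by_cases hkl : k = l
  · subst hkl
    have h1 : Real.cos φ = - (t k * Real.sin φ) := by
      have : ε * (Real.cos φ + t k * Real.sin φ) = 0 := by linarith
      have := (mul_eq_zero.1 this).resolve_left hε.ne'
      linarith
    rw [Real.cos_two_mul'] at h
    have h2 : t k ^ 2 < 1 := by rw [← sq_abs]; nlinarith [ht k, abs_nonneg (t k)]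
    have h3 : Real.cos φ ^ 2 = t k ^ 2 * Real.sin φ ^ 2 := by rw [h1]; ring
    nlinarith [sq_nonneg (Real.sin φ)]
  · have h1 := hsep k l hkl
    have h2 : t k - t l = - (ε * Real.cos φ + t l * (ε * Real.sin φ)) := by linarith
    rw [h2, abs_neg] at h1
    have h3 : |ε * Real.cos φ + t l * (ε * Real.sin φ)| ≤ ε * 1 + 1 * (ε * 1) := by
      refine (abs_add_le _ _).trans (add_le_add ?_ ?_)
      · rw [abs_mul, abs_of_pos hε]; gcongr; exact Real.abs_cos_le_one _
      · rw [abs_mul, abs_mul, abs_of_pos hε]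
        gcongr
        · exact (ht l).le
        · exact Real.abs_sin_le_one _
    linarith

theorem planePt_mem_slitNhd {a ε : ℝ} (ha : |a| < 1) (hε : 0 < ε) (φ : ℝ) (hφ : Real.sin φ < 0) :
    planePt n (a + ε * Real.cos φ) (ε * Real.sin φ) ∈ slitNhd n (3 * ε) a := by
  have h1 : |ε * Real.cos φ + a * (ε * Real.sin φ)| ≤ ε * 1 + 1 * (ε * 1) := by
    refine (abs_add_le _ _).trans (add_le_add ?_ ?_)
    · rw [abs_mul, abs_of_pos hε]; gcongr; exact Real.abs_cos_le_one _
    · rw [abs_mul, abs_mul, abs_of_pos hε]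
      gcongr
      exact Real.abs_sin_le_one _
  have h2 : ε * Real.sin φ < 0 := mul_neg_of_pos_of_neg hε hφ
  have e : lineSlope a (planePt n (a + ε * Real.cos φ) (ε * Real.sin φ)) =
      ε * Real.cos φ + a * (ε * Real.sin φ) := by
    simp only [lineSlope, planePt_zero, planePt_one]; ring
  rw [abs_le] at h1
  refine ⟨h2, ?_, ?_⟩ <;> rw [e, planePt_one] <;> nlinarith

/-- The parameter `5/8`. -/
noncomputable def fiveEighths : unitInterval := ⟨5 / 8, by norm_num, by norm_num⟩

/-- The parameter `7/8`. -/
noncomputable def sevenEighths : unitInterval := ⟨7 / 8, by norm_num, by norm_num⟩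

theorem convexComb_mem_Icc {a b : unitInterval} (h : a ≤ b) (s : unitInterval) :
    (a : ℝ) ≤ Set.Icc.convexComb a b s ∧ (Set.Icc.convexComb a b s : ℝ) ≤ b := by
  have h' : (a : ℝ) ≤ b := h
  rw [Set.Icc.coe_convexComb]
  constructor <;> nlinarith [s.2.1, s.2.2]

theorem planeCircle_arc_one {t : Fin m → ℝ} (ht : ∀ j, |t j| < 1) {ε : ℝ} (hε : 0 < ε)
    (hsep : ∀ k l, k ≠ l → 8 * ε < |t k - t l|) (k : Fin m) (s : unitInterval) :
    (planeCircle n (t k) ε).subpath 0 fiveEighths s ∈ slitCompl n t := by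
  have hs := convexComb_mem_Icc (a := 0) (b := fiveEighths) (by simp [fiveEighths]) s
  refine planePt_mem_slitCompl ht hε hsep k _ ?_
  set u : ℝ := ((Set.Icc.convexComb 0 fiveEighths s : unitInterval) : ℝ) with hu
  simp only [fiveEighths, Icc.coe_zero] at hs
  have hp := Real.pi_pos
  rcases hs.1.eq_or_lt with h | h
  · right; rw [← h]; simp
  rcases lt_or_ge u (1 / 2) with h' | h'
  · left
    exact Real.sin_pos_of_pos_of_lt_pi (by positivity) (by nlinarith)
  · right
    rw [← Real.cos_sub_two_pi]
    exact Real.cos_nonneg_of_neg_pi_div_two_le_of_le (by nlinarith) (by nlinarith [hs.2])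

theorem planeCircle_arc_three {t : Fin m → ℝ} (ht : ∀ j, |t j| < 1) {ε : ℝ} (hε : 0 < ε)
    (hsep : ∀ k l, k ≠ l → 8 * ε < |t k - t l|) (k : Fin m) (s : unitInterval) :
    (planeCircle n (t k) ε).subpath sevenEighths 1 s ∈ slitCompl n t := by
  have hs := convexComb_mem_Icc (a := sevenEighths) (b := 1) sevenEighths.2.2 s
  refine planePt_mem_slitCompl ht hε hsep k _ (Or.inr ?_)
  set u : ℝ := ((Set.Icc.convexComb sevenEighths 1 s : unitInterval) : ℝ) with hu
  simp only [sevenEighths, Icc.coe_one] at hs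
  have hp := Real.pi_pos
  rw [← Real.cos_sub_two_pi, ← Real.cos_sub_two_pi]
  exact Real.cos_nonneg_of_neg_pi_div_two_le_of_le (by nlinarith [hs.1]) (by nlinarith [hs.2])

end ModelFree

/-! ### Circles around the flat disks form a free basis. -/

section ModelBasis

variable {n m : ℕ}

section FreeBasis

variable {A : Type} [TopologicalSpace A] {T : Set A}

theorem IsFreeBasis.congr {x : A} {g g' : Fin m → Path x x} (h : IsFreeBasis T g)
    (hg' : ∀ k, InSet T (g' k)) (he : ∀ k, RepEq T (g k) (g' k)) : IsFreeBasis T g' := by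
  obtain ⟨Φ, hΦ, hg, hone, hgen⟩ := h
  refine ⟨Φ, hΦ, hg', fun k => (he k _ Φ hΦ).symm.trans (hone k), fun G _ Φ' hΦ' γ hγ => ?_⟩
  rw [hgen G Φ' hΦ' γ hγ]
  congr 2
  funext k
  exact he k G Φ' hΦ'

/-- Conjugating the detecting representation by the constant `Φ q` compensates for the conjugation
of the loops by `q`. -/
theorem IsFreeBasis.baseChange {x y : A} {g : Fin m → Path y y} (h : IsFreeBasis T g)
    (q : Path x y) (hq : InSet T q) : IsFreeBasis T fun k => (q.trans (g k)).trans q.symm := by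
  obtain ⟨Φ, hΦ, hg, hone, hgen⟩ := h
  refine ⟨fun _ _ γ => Φ q * Φ γ * (Φ q)⁻¹, ⟨fun x y z γ γ' hγ hγ' => ?_, fun x y γ γ' F hF => ?_⟩,
    fun k => (hq.trans (hg k)).trans hq.symm, fun k => ?_, fun G _ Φ' hΦ' γ hγ => ?_⟩
  · rw [hΦ.trans _ _ hγ hγ']; group
  · rw [hΦ.hom _ _ F hF]
  · change Φ q * Φ ((q.trans (g k)).trans q.symm) * (Φ q)⁻¹ = _
    rw [hΦ.map_conj _ _ _ hq (hg k) hq, hone]; group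
  · have h1 := hgen G Φ' hΦ' ((q.symm.trans γ).trans q) ((hq.symm.trans hγ).trans hq)
    rw [hΦ.trans _ _ (hq.symm.trans hγ) hq, hΦ.trans _ _ hq.symm hγ, hΦ.map_symm _ hq,
      hΦ'.trans _ _ (hq.symm.trans hγ) hq, hΦ'.trans _ _ hq.symm hγ, hΦ'.map_symm _ hq] at h1
    have h2 : (FreeGroup.lift fun k => Φ' ((q.trans (g k)).trans q.symm)) =
        (MulAut.conj (Φ' q)⁻¹).toMonoidHom.comp (FreeGroup.lift fun k => Φ' (g k)) := by
      refine FreeGroup.ext_hom _ _ fun k => ?_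
      simp [hΦ'.map_conj _ _ _ hq (hg k) hq]
    rw [h2, MonoidHom.comp_apply]
    simp only [← mul_assoc] at h1
    rw [← h1]
    simp [mul_assoc]

end FreeBasis

/-- The potential of the local representation near a slit. -/
noncomputable def sideWord (t : Fin m → ℝ) (k : Fin m) (x : EuclideanSpace ℝ (Fin (n + 2))) :
    FreeGroup (Fin m) :=
  open Classical in if 0 < lineSlope (t k) x then FreeGroup.of k else 1

theorem pos_iff_pos_of_path_ne_zero {A : Type} [TopologicalSpace A] {f : A → ℝ} (hf : Continuous f)
    {x y : A} (γ : Path x y) (h : ∀ s, f (γ s) ≠ 0) : 0 < f x ↔ 0 < f y := by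
  have key : ∀ {x y : A} (γ : Path x y), (∀ s, f (γ s) ≠ 0) → 0 < f x → 0 < f y := by
    intro x y γ h hx
    by_contra hy
    have hmem : (0 : ℝ) ∈ Icc (f (γ 1)) (f (γ 0)) := by
      rw [γ.source, γ.target]; exact ⟨not_lt.1 hy, hx.le⟩
    obtain ⟨s, hs⟩ := mem_range_of_exists_le_of_exists_ge (hf.comp γ.continuous)
      ⟨1, hmem.1⟩ ⟨0, hmem.2⟩
    exact h s hs
  exact ⟨key γ h, key γ.symm fun s => h _⟩

theorem sideWord_eq (t : Fin m → ℝ) (k : Fin m) {x y : EuclideanSpace ℝ (Fin (n + 2))}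
    (γ : Path x y) (h : ∀ s, lineSlope (t k) (γ s) ≠ 0) : sideWord t k x = sideWord t k y := by
  unfold sideWord
  simp only [pos_iff_pos_of_path_ne_zero (continuous_lineSlope (t k)) γ h]

theorem lineSlope_ne_zero {t : Fin m → ℝ} {x : EuclideanSpace ℝ (Fin (n + 2))} {δ : ℝ} {k : Fin m}
    (h : x ∈ slitCompl n t) (h' : x ∈ slitNhd n δ (t k)) : lineSlope (t k) x ≠ 0 :=
  (h k).resolve_left (not_lt.2 h'.1.le)

theorem mem_slitCompl_of_lineSlope_ne_zero {t : Fin m → ℝ} {ε : ℝ} (hε : 0 < ε)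
    (hsep : ∀ k l, k ≠ l → 8 * ε < |t k - t l|) {x : EuclideanSpace ℝ (Fin (n + 2))} {k : Fin m}
    (h : x ∈ slitNhd n (3 * ε) (t k)) (h' : lineSlope (t k) x ≠ 0) : x ∈ slitCompl n t := by
  intro l
  right
  intro h0
  have hpos : 0 < 3 * ε * (1 - x 1) := mul_pos (by positivity) (by linarith [h.1])
  have hl : x ∈ slitNhd n (3 * ε) (t l) := ⟨h.1, by rw [h0]; exact hpos, by rw [h0]; linarith⟩
  obtain rfl := slitNhd_disjoint hsep h hl
  exact h' h0

/-- The representation of the complement of the flat disks that counts crossings with slits. -/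
theorem exists_slit_rep {t : Fin m → ℝ} {ε : ℝ} (hε : 0 < ε)
    (hsep : ∀ k l, k ≠ l → 8 * ε < |t k - t l|) :
    ∃ Φ : ∀ ⦃x y : EuclideanSpace ℝ (Fin (n + 2))⦄, Path x y → FreeGroup (Fin m),
      IsRep (Metric.closedBall 0 1 ∩ flatCompl n t) Φ ∧
      (∀ ⦃x y⦄ (γ : Path x y), InSet (Metric.closedBall 0 1 ∩ flatCompl n t) γ →
        InSet (slitCompl n t) γ → Φ γ = 1) ∧
      ∀ k ⦃x y⦄ (γ : Path x y), InSet (Metric.closedBall 0 1 ∩ flatCompl n t) γ →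
        InSet (slitNhd n (3 * ε) (t k)) γ → Φ γ = sideWord t k y * (sideWord t k x)⁻¹ := by
  -- The local representation is trivial off the slits and records the change of side near a slit.
  -- On an overlap `lineSlope` has no zero, so the side does not change; neighborhoods of different
  -- slits are disjoint.
  obtain ⟨Φ, hΦ, h⟩ := exists_rep_of_cover (G := FreeGroup (Fin m))
    (T := Metric.closedBall 0 1 ∩ flatCompl n t)
    (V := fun o : Option (Fin m) => o.elim (slitCompl n t) fun k => slitNhd n (3 * ε) (t k))
    (Φ := fun o x y _ => o.elim 1 fun k => sideWord t k y * (sideWord t k x)⁻¹)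
    (by rintro (_ | k); exacts [isOpen_slitCompl t, isOpen_slitNhd _ _])
    (inter_subset_right.trans (flatCompl_subset_iUnion t (by positivity)))
    (by
      rintro (_ | k)
      · exact ⟨fun _ _ _ _ _ _ _ => by simp, fun _ _ _ _ _ _ => rfl⟩
      · exact ⟨fun _ _ _ _ _ _ _ => by simp, fun _ _ _ _ _ _ => rfl⟩)
    (by
      rintro (_ | k) (_ | l) x y γ hγ hi hj
      · rfl
      · simp only [Option.elim]
        rw [sideWord_eq t l γ fun s => lineSlope_ne_zero (hi s) (hj s), mul_inv_cancel]
      · simp only [Option.elim]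
        rw [sideWord_eq t k γ fun s => lineSlope_ne_zero (hj s) (hi s), mul_inv_cancel]
      · obtain rfl := slitNhd_disjoint hsep (hi 0) (hj 0)
        rfl)
  exact ⟨Φ, hΦ, fun x y γ hγ h' => h none γ hγ h', fun k x y γ hγ h' => h (some k) γ hγ h'⟩

theorem planeCircle_arc_two {t : Fin m → ℝ} (ht : ∀ j, |t j| < 1) {ε : ℝ} (hε : 0 < ε)
    (k : Fin m) (s : unitInterval) :
    (planeCircle n (t k) ε).subpath fiveEighths sevenEighths s ∈ slitNhd n (3 * ε) (t k) := by
  have hs := convexComb_mem_Icc (a := fiveEighths) (b := sevenEighths)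
    (by simp [fiveEighths, sevenEighths, ← Subtype.coe_le_coe]; norm_num) s
  refine planePt_mem_slitNhd (ht k) hε _ ?_
  set u : ℝ := ((Set.Icc.convexComb fiveEighths sevenEighths s : unitInterval) : ℝ) with hu
  simp only [fiveEighths, sevenEighths] at hs
  have hp := Real.pi_pos
  rw [← Real.sin_sub_two_pi]
  exact Real.sin_neg_of_neg_of_neg_pi_lt (by nlinarith [hs.2]) (by nlinarith [hs.1])

theorem lineSlope_planePt (a φ ε : ℝ) :
    lineSlope a (planePt n (a + ε * Real.cos φ) (ε * Real.sin φ)) =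
      ε * (Real.cos φ + a * Real.sin φ) := by
  simp only [lineSlope, planePt_zero, planePt_one]; ring

theorem lineSlope_fiveEighths {a : ℝ} (ha : |a| < 1) {ε : ℝ} (hε : 0 < ε) :
    lineSlope a (planeCircle n a ε fiveEighths) < 0 := by
  rw [planeCircle_apply, lineSlope_planePt a]
  have e : 2 * Real.pi * (fiveEighths : ℝ) = Real.pi / 4 + Real.pi := by simp [fiveEighths]; ring
  rw [e, Real.cos_add_pi, Real.sin_add_pi, Real.cos_pi_div_four, Real.sin_pi_div_four]
  have h2 : 0 < √2 := by positivity
  rw [abs_lt] at ha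
  refine mul_neg_of_pos_of_neg hε ?_
  nlinarith

theorem lineSlope_sevenEighths {a : ℝ} (ha : |a| < 1) {ε : ℝ} (hε : 0 < ε) :
    0 < lineSlope a (planeCircle n a ε sevenEighths) := by
  rw [planeCircle_apply, lineSlope_planePt a]
  have e : 2 * Real.pi * (sevenEighths : ℝ) = 2 * Real.pi - Real.pi / 4 := by
    simp [sevenEighths]; ring
  rw [e, Real.cos_two_pi_sub, Real.sin_two_pi_sub, Real.cos_pi_div_four, Real.sin_pi_div_four]
  have h2 : 0 < √2 := by positivity
  rw [abs_lt] at ha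
  refine mul_pos hε ?_
  nlinarith

theorem planeCircle_split {T : Set (EuclideanSpace ℝ (Fin (n + 2)))} {G : Type} [Group G]
    {Φ : ∀ ⦃x y : EuclideanSpace ℝ (Fin (n + 2))⦄, Path x y → G} (hΦ : IsRep T Φ) {a ε : ℝ}
    (h : InSet T (planeCircle n a ε)) : Φ (planeCircle n a ε) =
      Φ ((planeCircle n a ε).subpath sevenEighths 1) *
      Φ ((planeCircle n a ε).subpath fiveEighths sevenEighths) *
      Φ ((planeCircle n a ε).subpath 0 fiveEighths) := by
  rw [← path_fun_subpath_zero_one Φ, hΦ.subpath _ h 0 fiveEighths 1,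
    hΦ.subpath _ h fiveEighths sevenEighths 1]

/-- The segments from the pole to the points of the path fill a triangle off the slits. -/
theorem slitCompl_star_value {t : Fin m → ℝ} {G : Type} [Group G]
    {Φ : ∀ ⦃x y : EuclideanSpace ℝ (Fin (n + 2))⦄, Path x y → G}
    (hΦ : IsRep (Metric.closedBall 0 1 ∩ flatCompl n t) Φ) {y z : EuclideanSpace ℝ (Fin (n + 2))}
    (γ : Path y z) (hγ : InSet (Metric.closedBall 0 1) γ) (hγ' : InSet (slitCompl n t) γ) :
    Φ γ = Φ (Path.segment (pole n) z) * (Φ (Path.segment (pole n) y))⁻¹ := by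
  have hp : pole n ∈ Metric.closedBall 0 1 := by simp [norm_pole]
  have h := hΦ.square (fun q => AffineMap.lineMap (pole n) (γ q.1) (q.2 : ℝ))
    (by simp only [AffineMap.lineMap_apply]; fun_prop)
    (fun q => ⟨(convex_closedBall _ _).lineMap_mem hp (hγ q.1) ⟨q.2.2.1, q.2.2.2⟩,
      slitCompl_subset_flatCompl t (lineMap_pole_mem_slitCompl (hγ' q.1) q.2)⟩)
    (Path.refl (pole n)) γ (Path.segment (pole n) y) (Path.segment (pole n) z)
    (fun s => by simp) (fun s => by simp) (fun s => by simp) (fun s => by simp)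
  rw [hΦ.map_refl ⟨hp, mem_flatCompl_of_ne (by simp [pole_one])⟩, mul_one] at h
  rw [← h]; group

theorem convex_segment_value {T D : Set (EuclideanSpace ℝ (Fin (n + 2)))} {G : Type} [Group G]
    {Φ : ∀ ⦃x y : EuclideanSpace ℝ (Fin (n + 2))⦄, Path x y → G}
    (hΦ : IsRep T Φ) (hD : Convex ℝ D) (hDT : D ⊆ T) {l y z : EuclideanSpace ℝ (Fin (n + 2))}
    (hl : l ∈ D) (γ : Path y z) (hγ : InSet D γ) :
    Φ γ = Φ (Path.segment l z) * (Φ (Path.segment l y))⁻¹ := by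
  have hseg : ∀ {p : EuclideanSpace ℝ (Fin (n + 2))}, p ∈ D → InSet D (Path.segment l p) :=
    fun hp s => hD.lineMap_mem hl hp ⟨s.2.1, s.2.2⟩
  have h := hΦ.convex hD (σ := id) continuousOn_id hDT ((Path.segment l y).trans γ)
    (Path.segment l z) ((hseg hγ.source).trans hγ) (hseg hγ.target) _ _ (fun _ => rfl) (fun _ => rfl)
  rw [hΦ.trans _ _ ((hseg hγ.source).mono hDT) (hγ.mono hDT)] at h
  rw [← h]; group

/-- Each circle crosses exactly one slit, once, so the slit count sends it to its generator.
Conversely, a path off the slits has a value determined by its ends, and so does a path near one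
slit. Hence any representation `Φ'` is, up to a function of the endpoints, the image of the slit
count. -/
theorem isFreeBasis_model_pole {t : Fin m → ℝ} (ht : ∀ j, |t j| < 1) {ε : ℝ} (hε : 0 < ε)
    (hsep : ∀ k l, k ≠ l → 8 * ε < |t k - t l|) (hb : ∀ k, |t k| + 2 * ε < 1) :
    (∀ k, InSet (Metric.closedBall 0 1 ∩ flatCompl n t)
      (Path.segment (pole n) (planePt n (t k + ε) 0))) ∧
    (∀ k, InSet (Metric.closedBall 0 1 ∩ flatCompl n t) (planeCircle n (t k) ε)) ∧
    IsFreeBasis (Metric.closedBall 0 1 ∩ flatCompl n t) fun k =>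
      ((Path.segment (pole n) (planePt n (t k + ε) 0)).trans (planeCircle n (t k) ε)).trans
        (Path.segment (pole n) (planePt n (t k + ε) 0)).symm := by
  set T := Metric.closedBall 0 1 ∩ flatCompl n t with hT
  have hpole : pole n ∈ Metric.closedBall 0 1 := by simp [norm_pole]
  have hball := fun k => planeCircle_mem_closedBall (n := n) (hb k) hε
  have harc1 := fun k => planeCircle_arc_one (n := n) ht hε hsep k
  have harc2 := fun k => planeCircle_arc_two (n := n) ht hε k
  have harc3 := fun k => planeCircle_arc_three (n := n) ht hε hsep k
  have hcirc : ∀ k, InSet T (planeCircle n (t k) ε) := by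
    intro k s
    refine ⟨hball k s, ?_⟩
    rw [planeCircle_apply]
    intro j ⟨h0, h1⟩
    rw [planePt_zero] at h0
    rw [planePt_one] at h1
    have hs := (mul_eq_zero.1 h1).resolve_left hε.ne'
    have hc : |Real.cos (2 * Real.pi * s)| = 1 := by
      have := Real.sin_sq_add_cos_sq (2 * Real.pi * s)
      rw [hs] at this
      rw [← sq_eq_sq₀ (abs_nonneg _) zero_le_one, sq_abs]; linarith
    have h2 : |t k - t j| = ε := by
      rw [show t k - t j = - (ε * Real.cos (2 * Real.pi * s)) by linarith, abs_neg, abs_mul, hc,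
        abs_of_pos hε, mul_one]
    by_cases hkj : k = j
    · subst hkj; simp at h2; linarith
    · linarith [hsep k j hkj]
  have he : ∀ k, planePt n (t k + ε) 0 ∈ slitCompl n t := fun k => by
    have := harc1 k 0; simpa using this
  have hstar : ∀ {y}, y ∈ Metric.closedBall 0 1 → y ∈ slitCompl n t →
      InSet T (Path.segment (pole n) y) := fun hy hy' s =>
    ⟨(convex_closedBall _ _).lineMap_mem hpole hy ⟨s.2.1, s.2.2⟩,
      slitCompl_subset_flatCompl t (lineMap_pole_mem_slitCompl hy' s)⟩
  have hseg : ∀ k, InSet T (Path.segment (pole n) (planePt n (t k + ε) 0)) := fun k =>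
    hstar (hball k).source (he k)
  refine ⟨hseg, hcirc, ?_⟩
  obtain ⟨Φ, hΦ, hΦ0, hΦ1⟩ := exists_slit_rep (n := n) hε hsep
  refine ⟨Φ, hΦ, fun k => ((hseg k).trans (hcirc k)).trans (hseg k).symm, fun k => ?_,
    fun G _ Φ' hΦ' γ hγ => ?_⟩
  · rw [hΦ.map_conj _ _ _ (hseg k) (hcirc k) (hseg k),
      hΦ0 _ (hseg k) (fun s => lineMap_pole_mem_slitCompl (he k) s), planeCircle_split hΦ (hcirc k),
      hΦ0 _ ((hcirc k).subpath _ _) (harc1 k), hΦ0 _ ((hcirc k).subpath _ _) (harc3 k),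
      hΦ1 k _ ((hcirc k).subpath _ _) (harc2 k)]
    rw [sideWord, sideWord, if_pos (lineSlope_sevenEighths (ht k) hε),
      if_neg (lineSlope_fiveEighths (ht k) hε).not_gt]
    simp
  classical
  -- The points of the circle on the left and on the right of its slit, where the arcs off the slits
  -- meet the crossing arc.
  let l : Fin m → EuclideanSpace ℝ (Fin (n + 2)) := fun k => planeCircle n (t k) ε fiveEighths
  let r : Fin m → EuclideanSpace ℝ (Fin (n + 2)) := fun k => planeCircle n (t k) ε sevenEighths
  have hl0 : ∀ k, lineSlope (t k) (l k) < 0 := fun k => lineSlope_fiveEighths (ht k) hε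
  have hr0 : ∀ k, 0 < lineSlope (t k) (r k) := fun k => lineSlope_sevenEighths (ht k) hε
  have hlV : ∀ k, l k ∈ slitNhd n (3 * ε) (t k) := fun k => by
    have := harc2 k 0; simpa [l] using this
  have hrV : ∀ k, r k ∈ slitNhd n (3 * ε) (t k) := fun k => by
    have := harc2 k 1; simpa [r] using this
  let σ : EuclideanSpace ℝ (Fin (n + 2)) → G := fun y => Φ' (Path.segment (pole n) y)
  let τ : Fin m → EuclideanSpace ℝ (Fin (n + 2)) → G := fun k y => Φ' (Path.segment (l k) y)
  let D : Fin m → Set (EuclideanSpace ℝ (Fin (n + 2))) := fun k =>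
    Metric.closedBall 0 1 ∩ slitNhd n (3 * ε) (t k)
  have hD : ∀ k, Convex ℝ (D k) := fun k => (convex_closedBall _ _).inter (convex_slitNhd _ _)
  have hDT : ∀ k, D k ⊆ T := fun k => inter_subset_inter_right _ (slitNhd_subset_flatCompl t _ _)
  have hlD : ∀ k, l k ∈ D k := fun k => ⟨hball k _, hlV k⟩
  have hrD : ∀ k, r k ∈ D k := fun k => ⟨hball k _, hrV k⟩
  have hτ : ∀ k {y z} (γ : Path y z), InSet (D k) γ → Φ' γ = τ k z * (τ k y)⁻¹ := fun k y z γ hγ =>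
    convex_segment_value hΦ' (hD k) (hDT k) (hlD k) γ hγ
  have hσ : ∀ {y z} (γ : Path y z), InSet (Metric.closedBall 0 1) γ → InSet (slitCompl n t) γ →
      Φ' γ = σ z * (σ y)⁻¹ := fun γ h h' => slitCompl_star_value hΦ' γ h h'
  let g := fun k => ((Path.segment (pole n) (planePt n (t k + ε) 0)).trans
    (planeCircle n (t k) ε)).trans (Path.segment (pole n) (planePt n (t k + ε) 0)).symm
  let L : FreeGroup (Fin m) →* G := FreeGroup.lift fun k => Φ' (g k)
  have hτl : ∀ k, τ k (l k) = 1 := fun k =>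
    hΦ'.map_const _ (fun s => hDT k ((hD k).lineMap_mem (hlD k) (hlD k) ⟨s.2.1, s.2.2⟩))
      fun s => by simp
  have hL : ∀ k, L (FreeGroup.of k) = (σ (r k))⁻¹ * τ k (r k) * σ (l k) := by
    intro k
    have h1 : Φ' ((planeCircle n (t k) ε).subpath 0 fiveEighths) =
        σ (l k) * (σ (planePt n (t k + ε) 0))⁻¹ :=
      (hσ _ ((hball k).subpath _ _) (harc1 k)).trans
        (congrArg (fun y => σ (l k) * (σ y)⁻¹) (planeCircle n (t k) ε).source)
    have h3 : Φ' ((planeCircle n (t k) ε).subpath sevenEighths 1) =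
        σ (planePt n (t k + ε) 0) * (σ (r k))⁻¹ :=
      (hσ _ ((hball k).subpath _ _) (harc3 k)).trans
        (congrArg (fun y => σ y * (σ (r k))⁻¹) (planeCircle n (t k) ε).target)
    have h2 : Φ' ((planeCircle n (t k) ε).subpath fiveEighths sevenEighths) =
        τ k (r k) * (τ k (l k))⁻¹ := hτ k _ fun s => ⟨(hball k).subpath _ _ s, harc2 k s⟩
    rw [FreeGroup.lift_apply_of, hΦ'.map_conj _ _ _ (hseg k) (hcirc k) (hseg k),
      planeCircle_split hΦ' (hcirc k), h1, h2, h3, hτl]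
    simp only [σ]
    group
  -- Off the slits `Θ` is the value on the segment from the pole. On a slit it is continued from the
  -- left side, matching `sideWord`, which is trivial there.
  let Θ : EuclideanSpace ℝ (Fin (n + 2)) → G := fun y =>
    if y ∈ slitCompl n t then σ y else
      if h : ∃ k, y ∈ slitNhd n (3 * ε) (t k) then τ h.choose y * σ (l h.choose) else 1
  have hside : ∀ k {y z}, y ∈ D k → z ∈ D k →
      (0 < lineSlope (t k) y ∧ 0 < lineSlope (t k) z ∨
        lineSlope (t k) y < 0 ∧ lineSlope (t k) z < 0) →
      τ k z * (τ k y)⁻¹ = σ z * (σ y)⁻¹ := by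
    intro k y z hy hz hyz
    have h1 : InSet (D k) (Path.segment y z) := fun s =>
      (hD k).lineMap_mem hy hz ⟨s.2.1, s.2.2⟩
    rw [← hτ k _ h1]
    refine hσ _ (fun s => (h1 s).1) fun s =>
      mem_slitCompl_of_lineSlope_ne_zero hε hsep (h1 s).2 ?_
    rw [Path.segment_apply, lineSlope_lineMap]
    have hs0 := s.2.1
    have hs1 := s.2.2
    rcases hyz with ⟨h, h'⟩ | ⟨h, h'⟩
    · refine ne_of_gt ?_
      by_cases hs : (s : ℝ) = 0
      · rw [hs]; linarith
      · have := mul_pos (lt_of_le_of_ne hs0 (Ne.symm hs)) h'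
        have := mul_nonneg (sub_nonneg.2 hs1) h.le
        linarith
    · refine ne_of_lt ?_
      by_cases hs : (s : ℝ) = 0
      · rw [hs]; linarith
      · have := mul_neg_of_pos_of_neg (lt_of_le_of_ne hs0 (Ne.symm hs)) h'
        have := mul_nonpos_of_nonneg_of_nonpos (sub_nonneg.2 hs1) h.le
        linarith
  have hkey : ∀ k {y}, y ∈ D k → τ k y = Θ y * L (sideWord t k y) * (σ (l k))⁻¹ := by
    intro k y hy
    by_cases hyS : y ∈ slitCompl n t
    · simp only [Θ, if_pos hyS]
      rcases (lineSlope_ne_zero hyS hy.2).lt_or_gt with h | h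
      · rw [sideWord, if_neg h.not_gt, map_one, mul_one, ← hside k (hlD k) hy (Or.inr ⟨hl0 k, h⟩),
          hτl, inv_one, mul_one]
      · rw [sideWord, if_pos h, hL]
        have := hside k (hrD k) hy (Or.inl ⟨hr0 k, h⟩)
        calc τ k y = τ k y * (τ k (r k))⁻¹ * τ k (r k) := by group
          _ = _ := by rw [this]; group
    · have h0 : lineSlope (t k) y = 0 := by
        by_contra h
        exact hyS (mem_slitCompl_of_lineSlope_ne_zero hε hsep hy.2 h)
      have hex : ∃ k, y ∈ slitNhd n (3 * ε) (t k) := ⟨k, hy.2⟩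
      have hch : hex.choose = k := slitNhd_disjoint hsep hex.choose_spec hy.2
      simp only [Θ, if_neg hyS, dif_pos hex, hch]
      rw [sideWord, if_neg (by rw [h0]; exact lt_irrefl _)]
      simp
  -- The formula is multiplicative in the path, so it suffices to check it off the slits and near a
  -- single slit.
  have hmain : ∀ ⦃y z⦄ (γ : Path y z), InSet T γ → Φ' γ = Θ z * L (Φ γ) * (Θ y)⁻¹ := by
    intro y z γ hγ
    refine path_induction
      (V := fun o : Option (Fin m) => o.elim (slitCompl n t) fun k => slitNhd n (3 * ε) (t k))
      (by rintro (_ | k); exacts [isOpen_slitCompl t, isOpen_slitNhd _ _])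
      (inter_subset_right.trans (flatCompl_subset_iUnion t (by positivity)))
      (fun y z γ => Φ' γ = Θ z * L (Φ γ) * (Θ y)⁻¹) ?_ ?_ ?_ γ hγ
    · intro y z γ γ' _ _ he h
      rw [← he _ Φ hΦ, ← he _ Φ' hΦ', h]
    · intro x y z γ γ' hγ hγ' h h'
      rw [hΦ.trans _ _ hγ hγ', hΦ'.trans _ _ hγ hγ', h, h', map_mul]; group
    · rintro (_ | k) y z γ hγ hi
      · have hy : y ∈ slitCompl n t := InSet.source hi
        have hz : z ∈ slitCompl n t := InSet.target hi
        rw [hΦ0 γ hγ hi, hσ γ (fun s => (hγ s).1) hi]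
        simp [Θ, hy, hz]
      · have hD' : InSet (D k) γ := fun s => ⟨(hγ s).1, hi s⟩
        rw [hΦ1 k γ hγ hi, hτ k γ hD', hkey k hD'.source, hkey k hD'.target, map_mul, map_inv]
        group
  have hpS : pole n ∈ slitCompl n t := fun k => Or.inl (by simp [pole_one])
  have hΘ : Θ (pole n) = 1 := by
    simp only [Θ, if_pos hpS]
    exact hΦ'.map_const _ (hstar hpole hpS) fun s => by simp
  rw [hmain γ hγ, hΘ]
  simp [L, g]

theorem exists_isFreeBasis_model {t : Fin m → ℝ} (ht : ∀ j, |t j| < 1) {ε : ℝ} (hε : 0 < ε)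
    (hsep : ∀ k l, k ≠ l → 8 * ε < |t k - t l|) (hb : ∀ k, |t k| + 2 * ε < 1)
    {x : EuclideanSpace ℝ (Fin (n + 2))} (hx : x ∈ Metric.closedBall 0 1 ∩ flatCompl n t) :
    ∃ p : ∀ k, Path x (planePt n (t k + ε) 0),
      (∀ k, InSet (Metric.closedBall 0 1 ∩ flatCompl n t) (p k)) ∧
      (∀ k, InSet (Metric.closedBall 0 1 ∩ flatCompl n t) (planeCircle n (t k) ε)) ∧
      IsFreeBasis (Metric.closedBall 0 1 ∩ flatCompl n t) fun k =>
        ((p k).trans (planeCircle n (t k) ε)).trans (p k).symm := by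
  obtain ⟨hseg, hcirc, hbas⟩ := isFreeBasis_model_pole (n := n) ht hε hsep hb
  obtain ⟨y, hy, p, hp⟩ := exists_path_to_sphere t hx
  obtain ⟨q, hq⟩ := exists_path_to_pole t ht hy
  have hq' : InSet (Metric.closedBall 0 1 ∩ flatCompl n t) q :=
    hq.mono (inter_subset_inter_left _ Metric.sphere_subset_closedBall)
  have hu := (hq'.trans hp).symm
  refine ⟨fun k => (q.trans p).symm.trans (Path.segment (pole n) (planePt n (t k + ε) 0)),
    fun k => hu.trans (hseg k), hcirc,
    (hbas.baseChange (q.trans p).symm hu).congr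
      (fun k => ((hu.trans (hseg k)).trans (hcirc k)).trans (hu.trans (hseg k)).symm)
      fun k G _ Φ hΦ => ?_⟩
  have hc := ((hseg k).trans (hcirc k)).trans (hseg k).symm
  rw [hΦ.map_conj _ _ _ hu hc hu, hΦ.map_conj _ _ _ (hseg k) (hcirc k) (hseg k),
    hΦ.map_conj _ _ _ (hu.trans (hseg k)) (hcirc k) (hu.trans (hseg k)), hΦ.trans _ _ hu (hseg k)]
  group

end ModelBasis

/-! ### The three-sphere minus an unlink detects the four-ball minus flat disks. -/

section ModelFaithful

variable {m : ℕ}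

/-- Rotation of the last two coordinates. -/
noncomputable def rot (a : ℝ) (x : EuclideanSpace ℝ (Fin (1 + 1 + 2))) :
    EuclideanSpace ℝ (Fin (1 + 1 + 2)) :=
  WithLp.toLp 2 ![x 0, x 1, Real.cos a * x 2 - Real.sin a * x 3,
    Real.sin a * x 2 + Real.cos a * x 3]

theorem rot_zero_apply (a : ℝ) (x : EuclideanSpace ℝ (Fin (1 + 1 + 2))) : rot a x 0 = x 0 := rfl

theorem rot_one_apply (a : ℝ) (x : EuclideanSpace ℝ (Fin (1 + 1 + 2))) : rot a x 1 = x 1 := rfl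

theorem rot_two_apply (a : ℝ) (x : EuclideanSpace ℝ (Fin (1 + 1 + 2))) :
    rot a x 2 = Real.cos a * x 2 - Real.sin a * x 3 := rfl

theorem rot_three_apply (a : ℝ) (x : EuclideanSpace ℝ (Fin (1 + 1 + 2))) :
    rot a x 3 = Real.sin a * x 2 + Real.cos a * x 3 := rfl

theorem four_ext {x y : EuclideanSpace ℝ (Fin (1 + 1 + 2))} (h0 : x 0 = y 0) (h1 : x 1 = y 1)
    (h2 : x 2 = y 2) (h3 : x 3 = y 3) : x = y := by
  ext i
  fin_cases i
  exacts [h0, h1, h2, h3]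

theorem norm_sq_four (x : EuclideanSpace ℝ (Fin (1 + 1 + 2))) :
    ‖x‖ ^ 2 = x 0 ^ 2 + x 1 ^ 2 + x 2 ^ 2 + x 3 ^ 2 := by
  rw [EuclideanSpace.real_norm_sq_eq]
  exact Fin.sum_univ_four _

theorem continuous_rot : Continuous fun q : ℝ × EuclideanSpace ℝ (Fin (1 + 1 + 2)) =>
    rot q.1 q.2 := by
  refine (PiLp.continuous_toLp 2 _).comp (continuous_pi fun i => ?_)
  fin_cases i <;> simp <;> fun_prop

theorem rot_angle_zero (x : EuclideanSpace ℝ (Fin (1 + 1 + 2))) : rot 0 x = x := by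
  apply four_ext
  · rfl
  · rfl
  · simp [rot_two_apply]
  · simp [rot_three_apply]

theorem norm_rot (a : ℝ) (x : EuclideanSpace ℝ (Fin (1 + 1 + 2))) : ‖rot a x‖ = ‖x‖ := by
  rw [← sq_eq_sq₀ (norm_nonneg _) (norm_nonneg _), norm_sq_four, norm_sq_four, rot_zero_apply,
    rot_one_apply, rot_two_apply, rot_three_apply]
  linear_combination (x 2 ^ 2 + x 3 ^ 2) * Real.sin_sq_add_cos_sq a

theorem rot_mem {t : Fin m → ℝ} (a : ℝ) {x : EuclideanSpace ℝ (Fin (1 + 1 + 2))}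
    (hx : x ∈ Metric.sphere 0 1 ∩ flatCompl (1 + 1) t) :
    rot a x ∈ Metric.sphere 0 1 ∩ flatCompl (1 + 1) t := by
  refine ⟨?_, hx.2⟩
  have := hx.1
  rw [mem_sphere_zero_iff_norm] at this ⊢
  rw [norm_rot, this]

theorem rot_eq_self (a : ℝ) {x : EuclideanSpace ℝ (Fin (1 + 1 + 2))} (h2 : x 2 = 0) (h3 : x 3 = 0) :
    rot a x = x := by
  apply four_ext
  · rfl
  · rfl
  · simp [rot_two_apply, h2, h3]
  · simp [rot_three_apply, h2, h3]

theorem rot_sphereSection {θ : ℝ} {y : EuclideanSpace ℝ (Fin (1 + 1 + 2))}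
    (hy : y ∈ Metric.sphere 0 1) {r : ℝ} (hr : 0 ≤ r) (h2 : y 2 = r * Real.cos θ)
    (h3 : y 3 = r * Real.sin θ) : rot θ (sphereSection y) = y := by
  have h := mem_sphere_iff_norm_sq.1 hy
  have hs : √(1 - y 0 ^ 2 - y 1 ^ 2) = r := by
    rw [← Real.sqrt_sq hr]
    congr 1
    rw [norm_sq_four, h2, h3] at h
    linear_combination -h + r ^ 2 * Real.sin_sq_add_cos_sq θ
  have e2 : sphereSection y 2 = √(1 - y 0 ^ 2 - y 1 ^ 2) := rfl
  have e3 : sphereSection y 3 = 0 := rfl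
  apply four_ext
  · rfl
  · rfl
  · rw [rot_two_apply, e2, e3, hs, h2]; ring
  · rw [rot_three_apply, e2, e3, hs, h3]; ring

/-- The path that rotates the section over the first two coordinates to the given point. -/
noncomputable def rotPath {θ : ℝ} {y : EuclideanSpace ℝ (Fin (1 + 1 + 2))}
    (h : rot θ (sphereSection y) = y) : Path (sphereSection y) y where
  toFun s := rot (s * θ) (sphereSection y)
  continuous_toFun := continuous_rot.comp (f := fun s : unitInterval => ((s : ℝ) * θ, sphereSection y))
    (by fun_prop)
  source' := by simp [rot_angle_zero]
  target' := by simp [h]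

theorem rotPath_apply {θ : ℝ} {y : EuclideanSpace ℝ (Fin (1 + 1 + 2))}
    (h : rot θ (sphereSection y) = y) (s : unitInterval) :
    rotPath h s = rot (s * θ) (sphereSection y) := rfl

/-- Rotating the path `q` about the fixed point `e` sweeps out a square with one constant side,
which contracts the rotation track. -/
theorem IsRep.rotPath_eq {t : Fin m → ℝ} {G : Type} [Group G]
    {Φ : ∀ ⦃x y : EuclideanSpace ℝ (Fin (1 + 1 + 2))⦄, Path x y → G}
    (hΦ : IsRep (Metric.sphere 0 1 ∩ flatCompl (1 + 1) t) Φ) {θ : ℝ}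
    {y e : EuclideanSpace ℝ (Fin (1 + 1 + 2))}
    (h : rot θ (sphereSection y) = y) (he2 : e 2 = 0) (he3 : e 3 = 0) (q : Path (sphereSection y) e)
    (hq : InSet (Metric.sphere 0 1 ∩ flatCompl (1 + 1) t) q) (q' : Path y e)
    (hq' : ∀ s, q' s = rot θ (q s)) : Φ (rotPath h) = (Φ q')⁻¹ * Φ q := by
  have hsq := hΦ.square (fun p => rot (p.1 * θ) (q p.2))
    (continuous_rot.comp (f := fun p : unitInterval × unitInterval => ((p.1 : ℝ) * θ, q p.2))
      (by fun_prop)) (fun p => rot_mem _ (hq _)) (rotPath h) (Path.refl e) q q'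
    (fun s => by simp [rotPath_apply]) (fun s => by simp [rot_eq_self _ he2 he3])
    (fun s => by simp [rot_angle_zero]) (fun s => by simp [hq'])
  rw [hΦ.map_refl hq.target, one_mul] at hsq
  rw [hsq]; group

/-- Full turns have trivial value, since every orbit contracts to a pole, which is fixed by the
rotations. So the value does not depend on the choice of the angle. -/
theorem IsRep.rotPath_congr {t : Fin m → ℝ} {G : Type} [Group G]
    {Φ : ∀ ⦃x y : EuclideanSpace ℝ (Fin (1 + 1 + 2))⦄, Path x y → G}
    (hΦ : IsRep (Metric.sphere 0 1 ∩ flatCompl (1 + 1) t) Φ) {θ θ' : ℝ}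
    (hrot : rot θ = rot θ') {y : EuclideanSpace ℝ (Fin (1 + 1 + 2))}
    (hy : y ∈ Metric.sphere 0 1 ∩ flatCompl (1 + 1) t)
    (h : rot θ (sphereSection y) = y) (h' : rot θ' (sphereSection y) = y) :
    Φ (rotPath h) = Φ (rotPath h') := by
  have hs := sphereSection_mapsTo (n := 1) t ⟨Metric.sphere_subset_closedBall hy.1, hy.2⟩
  obtain ⟨c, hc, hyc⟩ : ∃ c : ℝ, (c = 1 ∨ c = -1) ∧ 0 ≤ c * sphereSection (n := 1) y 1 := by
    rcases le_total 0 (sphereSection (n := 1) y 1) with h | h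
    exacts [⟨1, Or.inl rfl, by linarith⟩, ⟨-1, Or.inr rfl, by linarith⟩]
  obtain ⟨q, hq⟩ := exists_arc t hs hc hyc
  have e2 : (c • pole (1 + 1)) 2 = 0 := by
    rw [PiLp.smul_apply, pole, PiLp.single_apply, if_neg (by decide), smul_zero]
  have e3 : (c • pole (1 + 1)) 3 = 0 := by
    rw [PiLp.smul_apply, pole, PiLp.single_apply, if_neg (by decide), smul_zero]
  let q' : Path y (c • pole (1 + 1)) := ⟨⟨fun s => rot θ (q s), continuous_rot.comp
    (f := fun s : unitInterval => (θ, q s)) (by fun_prop)⟩, by simp [h], by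
      simp [rot_eq_self _ e2 e3]⟩
  rw [hΦ.rotPath_eq h e2 e3 q hq q' (fun _ => rfl),
    hΦ.rotPath_eq h' e2 e3 q hq q' (fun s => by rw [← hrot]; rfl)]

/-- The path along which a point is rotated from the section. -/
noncomputable def argPath {y : EuclideanSpace ℝ (Fin (1 + 1 + 2))} (hy : y ∈ Metric.sphere 0 1) :
    Path (sphereSection y) y :=
  rotPath (θ := Complex.arg ⟨y 2, y 3⟩) (rot_sphereSection hy (norm_nonneg (⟨y 2, y 3⟩ : ℂ))
    (Complex.norm_mul_cos_arg ⟨y 2, y 3⟩).symm (Complex.norm_mul_sin_arg ⟨y 2, y 3⟩).symm)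

theorem rot_congr {θ θ' : ℝ} (hc : Real.cos θ = Real.cos θ') (hs : Real.sin θ = Real.sin θ') :
    rot θ = rot θ' := by
  funext x; simp only [rot, hc, hs]

/-- The representation `Φ` is determined on paths in `U` by its values on the section. -/
theorem IsRep.rot_sector {t : Fin m → ℝ} {G : Type} [Group G]
    {Φ : ∀ ⦃x y : EuclideanSpace ℝ (Fin (1 + 1 + 2))⦄, Path x y → G}
    (hΦ : IsRep (Metric.sphere 0 1 ∩ flatCompl (1 + 1) t) Φ)
    {U : Set (EuclideanSpace ℝ (Fin (1 + 1 + 2)))} {θ : EuclideanSpace ℝ (Fin (1 + 1 + 2)) → ℝ}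
    (hθ : ContinuousOn θ U) {y z : EuclideanSpace ℝ (Fin (1 + 1 + 2))} (γ : Path y z)
    (hγ : InSet (Metric.sphere 0 1 ∩ flatCompl (1 + 1) t) γ) (hU : InSet U γ)
    (hrot : ∀ s, rot (θ (γ s)) (sphereSection (γ s)) = γ s)
    (δ : Path (sphereSection y) (sphereSection z)) (hδ : ∀ s, δ s = sphereSection (γ s))
    (hy : rot (θ y) (sphereSection y) = y) (hz : rot (θ z) (sphereSection z) = z) :
    Φ γ = Φ (rotPath hz) * Φ δ * (Φ (rotPath hy))⁻¹ := by
  have hθc : Continuous fun s => θ (γ s) := hθ.comp_continuous γ.continuous hU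
  have hsq := hΦ.square (fun p => rot (p.2 * θ (γ p.1)) (sphereSection (γ p.1)))
    (continuous_rot.comp (f := fun p : unitInterval × unitInterval =>
      ((p.2 : ℝ) * θ (γ p.1), sphereSection (γ p.1)))
      (((by fun_prop : Continuous fun p : unitInterval × unitInterval => (p.2 : ℝ)).mul
        (hθc.comp continuous_fst)).prodMk
        (continuous_sphereSection.comp (γ.continuous.comp continuous_fst))))
    (fun p => rot_mem _ (sphereSection_mapsTo (n := 1) t
      ⟨Metric.sphere_subset_closedBall (hγ _).1, (hγ _).2⟩)) δ γ (rotPath hy) (rotPath hz)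
    (fun s => by simp [hδ, rot_angle_zero]) (fun s => by simp [hrot])
    (fun s => by simp [rotPath_apply]) (fun s => by simp [rotPath_apply])
  rw [← hsq]; group

/-- The normalized segment. -/
noncomputable def coneMap (e x : EuclideanSpace ℝ (Fin (1 + 1 + 2))) (r : ℝ) :
    EuclideanSpace ℝ (Fin (1 + 1 + 2)) := toSphere (AffineMap.lineMap x e r)

theorem rot_add (a : ℝ) (x y : EuclideanSpace ℝ (Fin (1 + 1 + 2))) :
    rot a (x + y) = rot a x + rot a y := by
  apply four_ext
  · rfl
  · rfl
  · simp only [rot_two_apply, PiLp.add_apply]; ring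
  · simp only [rot_three_apply, PiLp.add_apply]; ring

theorem rot_smul (a r : ℝ) (x : EuclideanSpace ℝ (Fin (1 + 1 + 2))) :
    rot a (r • x) = r • rot a x := by
  apply four_ext
  · rfl
  · rfl
  · simp only [rot_two_apply, PiLp.smul_apply, smul_eq_mul]; ring
  · simp only [rot_three_apply, PiLp.smul_apply, smul_eq_mul]; ring

theorem rot_coneMap (a : ℝ) {e : EuclideanSpace ℝ (Fin (1 + 1 + 2))} (he2 : e 2 = 0) (he3 : e 3 = 0)
    (x : EuclideanSpace ℝ (Fin (1 + 1 + 2))) (r : ℝ) :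
    rot a (coneMap e x r) = coneMap e (rot a x) r := by
  have hlin : AffineMap.lineMap (rot a x) e r = rot a (AffineMap.lineMap x e r) := by
    rw [AffineMap.lineMap_apply_module, AffineMap.lineMap_apply_module, rot_add, rot_smul, rot_smul,
      rot_eq_self a he2 he3]
  rw [coneMap, coneMap, hlin, toSphere, toSphere, norm_rot, rot_smul]

/-- Near the fixed points of the rotations no continuous angle exists. There the paths are
contracted along a cone to a fixed point `e`; the cone commutes with rotations, so it also evaluates
the rotation tracks. -/
theorem IsRep.rot_cone {t : Fin m → ℝ} {G : Type} [Group G]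
    {Φ : ∀ ⦃x y : EuclideanSpace ℝ (Fin (1 + 1 + 2))⦄, Path x y → G}
    (hΦ : IsRep (Metric.sphere 0 1 ∩ flatCompl (1 + 1) t) Φ)
    {U : Set (EuclideanSpace ℝ (Fin (1 + 1 + 2)))} {e : EuclideanSpace ℝ (Fin (1 + 1 + 2))}
    (he : ‖e‖ = 1) (he2 : e 2 = 0) (he3 : e 3 = 0)
    (hcone : ∀ x ∈ Metric.sphere 0 1 ∩ flatCompl (1 + 1) t, x ∈ U → ∀ r ∈ Icc (0 : ℝ) 1,
      AffineMap.lineMap x e r ≠ 0 ∧ coneMap e x r ∈ flatCompl (1 + 1) t)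
    {y z : EuclideanSpace ℝ (Fin (1 + 1 + 2))} (γ : Path y z)
    (hγ : InSet (Metric.sphere 0 1 ∩ flatCompl (1 + 1) t) γ) (hU : InSet U γ)
    (hsU : ∀ x ∈ U, sphereSection x ∈ U)
    (δ : Path (sphereSection y) (sphereSection z)) (hδ : ∀ s, δ s = sphereSection (γ s))
    {α β : ℝ} (hy : rot α (sphereSection y) = y) (hz : rot β (sphereSection z) = z) :
    Φ γ = Φ (rotPath hz) * Φ δ * (Φ (rotPath hy))⁻¹ := by
  set T := Metric.sphere 0 1 ∩ flatCompl (1 + 1) t with hT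
  have hsT : ∀ {x}, x ∈ T → sphereSection x ∈ T := fun hx =>
    sphereSection_mapsTo (n := 1) t ⟨Metric.sphere_subset_closedBall hx.1, hx.2⟩
  have hmem : ∀ x ∈ T, x ∈ U → ∀ r ∈ Icc (0 : ℝ) 1, coneMap e x r ∈ T := fun x hx hxU r hr =>
    ⟨toSphere_mem (hcone x hx hxU r hr).1, (hcone x hx hxU r hr).2⟩
  have hzero : ∀ x ∈ T, coneMap e x 0 = x := fun x hx => by
    simp only [coneMap, AffineMap.lineMap_apply_zero]
    exact toSphere_of_norm (mem_sphere_zero_iff_norm.1 hx.1)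
  have hone : ∀ x, coneMap e x 1 = e := fun x => by
    simp only [coneMap, AffineMap.lineMap_apply_one]
    exact toSphere_of_norm he
  have hcont : ∀ {X : Type} [TopologicalSpace X] (f : X → EuclideanSpace ℝ (Fin (1 + 1 + 2)))
      (k : X → ℝ), Continuous f → Continuous k → (∀ p, f p ∈ T) → (∀ p, f p ∈ U) →
      (∀ p, k p ∈ Icc (0 : ℝ) 1) → Continuous fun p => coneMap e (f p) (k p) := by
    intro X _ f k hf hk hfT hfU hkI
    have hl : Continuous fun p => AffineMap.lineMap (f p) e (k p) := by
      simp only [AffineMap.lineMap_apply]; fun_prop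
    exact (hl.norm.inv₀ fun p => norm_ne_zero_iff.2 (hcone _ (hfT p) (hfU p) _ (hkI p)).1).smul hl
  have hex : ∀ x, x ∈ T → x ∈ U → ∃ p : Path x e, ∀ r, p r = coneMap e x r := fun x hx hxU =>
    ⟨⟨⟨fun r => coneMap e x r, hcont (fun _ : unitInterval => x) (fun r => (r : ℝ)) continuous_const
      continuous_subtype_val (fun _ => hx) (fun _ => hxU) fun r => r.2⟩,
      hzero x hx, hone x⟩, fun _ => rfl⟩
  choose arc harc using hex
  have key : ∀ {y z} (γ : Path y z) (hγ : InSet T γ) (hU : InSet U γ),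
      Φ γ = (Φ (arc z hγ.target hU.target))⁻¹ * Φ (arc y hγ.source hU.source) := by
    intro y z γ hγ hU
    have hsq := hΦ.square (fun p => coneMap e (γ p.1) p.2)
      (hcont _ _ (γ.continuous.comp continuous_fst) (continuous_subtype_val.comp continuous_snd)
        (fun p => hγ _) (fun p => hU _) fun p => p.2.2)
      (fun p => hmem _ (hγ _) (hU _) _ p.2.2) γ (Path.refl e) (arc y hγ.source hU.source)
      (arc z hγ.target hU.target) (fun s => by simp [hzero _ (hγ s)]) (fun s => by simp [hone])
      (fun s => by simp [harc]) (fun s => by simp [harc])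
    rw [hΦ.map_refl (by rw [← hone y]; exact hmem y hγ.source hU.source 1 ⟨zero_le_one, le_rfl⟩),
      one_mul] at hsq
    rw [hsq]; group
  have hrotcone := fun a x r => rot_coneMap a he2 he3 x r
  have hang : ∀ {y} (hyT : y ∈ T) (hyU : y ∈ U) {α : ℝ} (h : rot α (sphereSection y) = y),
      Φ (rotPath h) = (Φ (arc y hyT hyU))⁻¹ * Φ (arc _ (hsT hyT) (hsU y hyU)) := by
    intro y hyT hyU α h
    refine hΦ.rotPath_eq h he2 he3 (arc _ (hsT hyT) (hsU y hyU)) (fun r => ?_) (arc y hyT hyU)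
      fun r => ?_
    · rw [harc]
      exact hmem _ (hsT hyT) (hsU y hyU) _ r.2
    · rw [harc, harc, hrotcone, h]
  have hδT : InSet T δ := fun s => by rw [hδ]; exact hsT (hγ s)
  have hδU : InSet U δ := fun s => by rw [hδ]; exact hsU _ (hU s)
  rw [key γ hγ hU, key δ hδT hδU, hang hγ.source hU.source hy, hang hγ.target hU.target hz]
  group

theorem coneMap_one_apply_ne {c : ℝ} (hc : c = 1 ∨ c = -1)
    {x : EuclideanSpace ℝ (Fin (1 + 1 + 2))} (hx : 0 < c * x 1) {r : ℝ} (hr : r ∈ Icc (0 : ℝ) 1) :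
    AffineMap.lineMap x (c • pole (1 + 1)) r ≠ 0 ∧ coneMap (c • pole (1 + 1)) x r 1 ≠ 0 := by
  have hcc : c * c = 1 := by rcases hc with rfl | rfl <;> norm_num
  have h1 : c * (AffineMap.lineMap x (c • pole (1 + 1)) r) 1 = (1 - r) * (c * x 1) + r := by
    rw [lineMap_one_apply, PiLp.smul_apply, pole_one, smul_eq_mul]
    linear_combination r * hcc
  have h2 : (AffineMap.lineMap x (c • pole (1 + 1)) r) 1 ≠ 0 := by
    intro h
    rw [h, mul_zero] at h1
    have h3 := mul_nonneg (sub_nonneg.2 hr.2) hx.le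
    have h4 : r = 0 := by linarith [hr.1]
    rw [h4] at h1
    linarith
  have h3 : AffineMap.lineMap x (c • pole (1 + 1)) r ≠ 0 := fun h => h2 (by rw [h]; rfl)
  refine ⟨h3, ?_⟩
  rw [coneMap, toSphere, PiLp.smul_apply, smul_eq_mul]
  exact mul_ne_zero (inv_ne_zero (norm_ne_zero_iff.2 h3)) h2

/-- The chord keeps `c * x 0` above `τ` and has norm at most `1`, so normalizing can only increase
this coordinate. -/
theorem lt_coneMap_zero_apply {c τ : ℝ} (hc : c = 1 ∨ c = -1) (hτ : 0 ≤ τ) (hτ1 : τ < 1)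
    {x : EuclideanSpace ℝ (Fin (1 + 1 + 2))} (hx1 : ‖x‖ = 1) (hx : τ < c * x 0) {r : ℝ}
    (hr : r ∈ Icc (0 : ℝ) 1) :
    AffineMap.lineMap x (c • EuclideanSpace.single (0 : Fin (1 + 1 + 2)) (1 : ℝ)) r ≠ 0 ∧
      τ < c * coneMap (c • EuclideanSpace.single (0 : Fin (1 + 1 + 2)) (1 : ℝ)) x r 0 := by
  have hcc : c * c = 1 := by rcases hc with rfl | rfl <;> norm_num
  set e := c • EuclideanSpace.single (0 : Fin (1 + 1 + 2)) (1 : ℝ) with he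
  have hen : ‖e‖ = 1 := by
    rw [he, norm_smul, PiLp.norm_single]; rcases hc with rfl | rfl <;> simp
  have h1 : c * (AffineMap.lineMap x e r) 0 = (1 - r) * (c * x 0) + r := by
    rw [AffineMap.lineMap_apply_module, PiLp.add_apply, PiLp.smul_apply, PiLp.smul_apply, he,
      PiLp.smul_apply, PiLp.single_apply, if_pos rfl]
    simp only [smul_eq_mul]
    linear_combination r * hcc
  have h2 : τ < c * (AffineMap.lineMap x e r) 0 := by
    rw [h1]
    rcases hr.2.eq_or_lt with h | h
    · rw [h]; linarith
    · nlinarith [hr.1]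
  have h3 : AffineMap.lineMap x e r ≠ 0 := fun h => by
    rw [h] at h2
    simp at h2
    linarith
  have h4 : ‖AffineMap.lineMap x e r‖ ≤ 1 := by
    have := (convex_closedBall (0 : EuclideanSpace ℝ (Fin (1 + 1 + 2))) 1).lineMap_mem
      (mem_closedBall_zero_iff.2 hx1.le) (mem_closedBall_zero_iff.2 hen.le) hr
    exact mem_closedBall_zero_iff.1 this
  refine ⟨h3, ?_⟩
  rw [coneMap, toSphere, PiLp.smul_apply, smul_eq_mul, mul_left_comm]
  have h5 := one_le_inv_iff₀.2 ⟨norm_pos_iff.2 h3, h4⟩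
  nlinarith

/-- Two paths in the sphere that agree for all representations of the four-ball off the flat disks
agree for all representations of the sphere off their boundaries. -/
theorem IsRep.eq_of_repEq_model {t : Fin m → ℝ} (ht : ∀ j, |t j| < 1) {G : Type} [Group G]
    {Φ : ∀ ⦃x y : EuclideanSpace ℝ (Fin (1 + 1 + 2))⦄, Path x y → G}
    (hΦ : IsRep (Metric.sphere 0 1 ∩ flatCompl (1 + 1) t) Φ)
    {y z : EuclideanSpace ℝ (Fin (1 + 1 + 2))} (γ γ' : Path y z)
    (hγ : InSet (Metric.sphere 0 1 ∩ flatCompl (1 + 1) t) γ)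
    (hγ' : InSet (Metric.sphere 0 1 ∩ flatCompl (1 + 1) t) γ')
    (h : RepEq (Metric.closedBall 0 1 ∩ flatCompl (1 + 1) t) γ γ') : Φ γ = Φ γ' := by
  classical
  obtain ⟨Ψ, hΨ, hΨΦ⟩ := hΦ.exists_pullback (continuous_sphereSection (n := 1)).continuousOn
    (sphereSection_mapsTo (n := 1) t)
  have hsub : Metric.sphere 0 1 ∩ flatCompl (1 + 1) t ⊆
      Metric.closedBall 0 1 ∩ flatCompl (1 + 1) t :=
    inter_subset_inter_left _ Metric.sphere_subset_closedBall
  set T := Metric.sphere 0 1 ∩ flatCompl (1 + 1) t with hT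
  -- The boundary circles of the disks are orbits of the rotations, and `Ψ`, pulled back along the
  -- section, is defined on the whole ball complement. Up to the values of rotation tracks, `Φ`
  -- equals `Ψ`, which cannot separate the two paths.
  let B : EuclideanSpace ℝ (Fin (1 + 1 + 2)) → G := fun y =>
    if hy : y ∈ Metric.sphere 0 1 then Φ (argPath hy) else 1
  have hB : ∀ {y} (hy : y ∈ Metric.sphere 0 1), B y = Φ (argPath hy) := fun hy => dif_pos hy
  let P : ∀ ⦃y z : EuclideanSpace ℝ (Fin (1 + 1 + 2))⦄, Path y z → Prop := fun y z γ =>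
    Φ γ = B z * Ψ γ * (B y)⁻¹
  have hmap : ∀ {y z} (γ : Path y z), InSet T γ → Ψ γ = Φ (γ.map continuous_sphereSection) :=
    fun γ hγ => hΨΦ γ (hγ.mono hsub) _ fun _ => rfl
  obtain ⟨τ, hτ0, hτ1, hτ⟩ := exists_bound_lt_one t ht
  have hsector : ∀ (U : Set (EuclideanSpace ℝ (Fin (1 + 1 + 2))))
      (θ : EuclideanSpace ℝ (Fin (1 + 1 + 2)) → ℝ), ContinuousOn θ U →
      (∀ x ∈ U, Real.cos (θ x) = Real.cos (Complex.arg ⟨x 2, x 3⟩) ∧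
        Real.sin (θ x) = Real.sin (Complex.arg ⟨x 2, x 3⟩)) →
      ∀ ⦃y z⦄ (γ : Path y z), InSet T γ → InSet U γ → P γ := by
    intro U θ hθ hU y z γ hγ hγU
    have hr : ∀ x ∈ U, x ∈ Metric.sphere 0 1 → rot (θ x) (sphereSection x) = x := fun x hx hxS => by
      rw [rot_congr (hU x hx).1 (hU x hx).2]
      exact rot_sphereSection hxS (norm_nonneg (⟨x 2, x 3⟩ : ℂ))
        (Complex.norm_mul_cos_arg ⟨x 2, x 3⟩).symm (Complex.norm_mul_sin_arg ⟨x 2, x 3⟩).symm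
    have hy := hγU.source
    have hz := hγU.target
    show Φ γ = B z * Ψ γ * (B y)⁻¹
    rw [hB hγ.source.1, hB hγ.target.1, hmap γ hγ, argPath, argPath,
      ← hΦ.rotPath_congr (rot_congr (hU y hy).1 (hU y hy).2) hγ.source (hr y hy hγ.source.1),
      ← hΦ.rotPath_congr (rot_congr (hU z hz).1 (hU z hz).2) hγ.target (hr z hz hγ.target.1)]
    exact hΦ.rot_sector hθ γ hγ hγU (fun s => hr _ (hγU s) (hγ s).1) _ (fun _ => rfl) _ _
  have hconeP : ∀ (U : Set (EuclideanSpace ℝ (Fin (1 + 1 + 2))))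
      (e : EuclideanSpace ℝ (Fin (1 + 1 + 2))), ‖e‖ = 1 → e 2 = 0 → e 3 = 0 →
      (∀ x ∈ T, x ∈ U → ∀ r ∈ Icc (0 : ℝ) 1,
        AffineMap.lineMap x e r ≠ 0 ∧ coneMap e x r ∈ flatCompl (1 + 1) t) →
      (∀ x ∈ U, sphereSection x ∈ U) → ∀ ⦃y z⦄ (γ : Path y z), InSet T γ → InSet U γ → P γ := by
    intro U e he he2 he3 hcone hsU y z γ hγ hγU
    show Φ γ = B z * Ψ γ * (B y)⁻¹
    rw [hB hγ.source.1, hB hγ.target.1, hmap γ hγ, argPath, argPath]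
    exact hΦ.rot_cone he he2 he3 hcone γ hγ hγU hsU _ (fun _ => rfl) _ _
  have hv : Continuous fun x : EuclideanSpace ℝ (Fin (1 + 1 + 2)) => (⟨x 2, x 3⟩ : ℂ) := by
    have : (fun x : EuclideanSpace ℝ (Fin (1 + 1 + 2)) => (⟨x 2, x 3⟩ : ℂ)) = fun x =>
      ((x 2 : ℝ) : ℂ) + ((x 3 : ℝ) : ℂ) * Complex.I := by
      funext x; apply Complex.ext <;> simp
    rw [this]; fun_prop
  -- The cover consists of all open sets on which the claim holds; it remains to find one around
  -- each point.
  let ι := {U : Set (EuclideanSpace ℝ (Fin (1 + 1 + 2))) //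
    IsOpen U ∧ ∀ ⦃y z⦄ (γ : Path y z), InSet T γ → InSet U γ → P γ}
  have hcover : T ⊆ ⋃ i : ι, i.1 := by
    intro x hx
    suffices ∃ U : Set (EuclideanSpace ℝ (Fin (1 + 1 + 2))), IsOpen U ∧ x ∈ U ∧
        ∀ ⦃y z⦄ (γ : Path y z), InSet T γ → InSet U γ → P γ by
      obtain ⟨U, hU, hxU, h⟩ := this
      exact mem_iUnion.2 ⟨⟨U, hU, h⟩, hxU⟩
    have hpole : ∀ c : ℝ, c = 1 ∨ c = -1 → 0 < c * x 1 →
        ∃ U : Set (EuclideanSpace ℝ (Fin (1 + 1 + 2))), IsOpen U ∧ x ∈ U ∧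
        ∀ ⦃y z⦄ (γ : Path y z), InSet T γ → InSet U γ → P γ := by
      intro c hc hxc
      refine ⟨{x | 0 < c * x 1}, isOpen_lt continuous_const (by fun_prop), hxc,
        hconeP _ (c • pole (1 + 1)) (mem_sphere_zero_iff_norm.1 (pole_mem t hc).1) ?_ ?_ ?_ ?_⟩
      · rw [PiLp.smul_apply, pole, PiLp.single_apply, if_neg (by decide), smul_zero]
      · rw [PiLp.smul_apply, pole, PiLp.single_apply, if_neg (by decide), smul_zero]
      · intro x _ hxU r hr
        have := coneMap_one_apply_ne hc hxU hr
        exact ⟨this.1, mem_flatCompl_of_ne this.2⟩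
      · exact fun x hx => hx
    rcases lt_trichotomy (x 1) 0 with h1 | h1 | h1
    · exact hpole (-1) (Or.inr rfl) (by linarith)
    swap
    · exact hpole 1 (Or.inl rfl) (by linarith)
    by_cases hx0 : (⟨x 2, x 3⟩ : ℂ) = 0
    · obtain ⟨h2, h3⟩ := Complex.ext_iff.1 hx0
      have hn := mem_sphere_iff_norm_sq.1 hx.1
      rw [norm_sq_four, h1, show x 2 = 0 from h2, show x 3 = 0 from h3] at hn
      obtain ⟨c, hc, hxc⟩ : ∃ c : ℝ, (c = 1 ∨ c = -1) ∧ c * x 0 = 1 := by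
        rcases mul_self_eq_one_iff.1 (show x 0 * x 0 = 1 by linarith [sq (x 0)]) with h | h
        exacts [⟨1, Or.inl rfl, by linarith⟩, ⟨-1, Or.inr rfl, by linarith⟩]
      -- With `x 1 = x 2 = x 3 = 0` the point is a unit vector on the axis of `x 0`. The cap around
      -- it beyond all `t j` is coned to it.
      refine ⟨{x | τ < c * x 0}, isOpen_lt continuous_const (by fun_prop),
        by rw [mem_ofPred_eq, hxc]; exact hτ1,
        hconeP _ (c • EuclideanSpace.single (0 : Fin (1 + 1 + 2)) (1 : ℝ)) ?_ ?_ ?_ ?_ ?_⟩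
      · rw [norm_smul, PiLp.norm_single]; rcases hc with rfl | rfl <;> simp
      · rw [PiLp.smul_apply, PiLp.single_apply, if_neg (by decide), smul_zero]
      · rw [PiLp.smul_apply, PiLp.single_apply, if_neg (by decide), smul_zero]
      · intro x hx hxU r hr
        have := lt_coneMap_zero_apply hc hτ0 hτ1 (mem_sphere_zero_iff_norm.1 hx.1) hxU hr
        refine ⟨this.1, fun j hj => ?_⟩
        have h5 := this.2
        rw [hj.1] at h5
        have h6 : c * t j ≤ |t j| := by
          rcases hc with rfl | rfl
          · simpa using le_abs_self (t j)
          · simpa using neg_le_abs (t j)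
        linarith [hτ j]
      · exact fun x hx => hx
    by_cases hsl : (⟨x 2, x 3⟩ : ℂ) ∈ Complex.slitPlane
    · exact ⟨_, Complex.isOpen_slitPlane.preimage hv, hsl, hsector _
        (fun x => Complex.arg ⟨x 2, x 3⟩) (fun x hx =>
          (ContinuousAt.comp (f := fun x : EuclideanSpace ℝ (Fin (1 + 1 + 2)) => (⟨x 2, x 3⟩ : ℂ))
            (Complex.continuousAt_arg hx) hv.continuousAt).continuousWithinAt)
        fun _ _ => ⟨rfl, rfl⟩⟩
    -- On the negative real axis the angle is measured from the opposite direction; adding `π` gives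
    -- the same rotation.
    · refine ⟨_, Complex.isOpen_slitPlane.preimage hv.neg,
        (Complex.mem_slitPlane_or_neg_mem_slitPlane hx0).resolve_left hsl, hsector _
        (fun x => Complex.arg (-⟨x 2, x 3⟩) + Real.pi) (fun x hx =>
          ((ContinuousAt.comp (f := fun x : EuclideanSpace ℝ (Fin (1 + 1 + 2)) => -(⟨x 2, x 3⟩ : ℂ))
            (Complex.continuousAt_arg hx) hv.neg.continuousAt).add
            continuousAt_const).continuousWithinAt) fun x hx => ?_⟩
      have hne : -(⟨x 2, x 3⟩ : ℂ) ≠ 0 := Complex.slitPlane_ne_zero hx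
      have hne' : (⟨x 2, x 3⟩ : ℂ) ≠ 0 := neg_ne_zero.1 hne
      rw [Real.cos_add_pi, Real.sin_add_pi, Complex.cos_arg hne, Complex.cos_arg hne',
        Complex.sin_arg, Complex.sin_arg, norm_neg]
      simp [neg_div]
  have hall : ∀ {y z} (γ : Path y z), InSet T γ → P γ := fun γ hγ =>
    path_induction (V := fun i : ι => i.1) (fun i => i.2.1) hcover P
      (fun y z γ γ' hγ hγ' he h => by
        show Φ γ' = B z * Ψ γ' * (B y)⁻¹
        rw [← he _ Φ hΦ, ← he _ Ψ (hΨ.mono hsub)]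
        exact h)
      (fun x y z γ γ' hγ hγ' h h' => by
        show Φ (γ.trans γ') = B z * Ψ (γ.trans γ') * (B x)⁻¹
        rw [hΦ.trans _ _ hγ hγ', hΨ.trans _ _ (hγ.mono hsub) (hγ'.mono hsub),
          show Φ γ = B y * Ψ γ * (B x)⁻¹ from h, show Φ γ' = B z * Ψ γ' * (B y)⁻¹ from h']
        group)
      (fun i y z γ hγ hi => i.2.2 γ hγ hi) γ hγ
  rw [show Φ γ = _ from hall γ hγ, show Φ γ' = _ from hall γ' hγ', h _ Ψ hΨ]

end ModelFaithful

/-! ### Transport along homeomorphisms between subsets. -/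

section Transport

variable {A' A : Type} [TopologicalSpace A'] [TopologicalSpace A]

/-- `f` and `g` restrict to mutually inverse homeomorphisms between `D` and `X`. -/
structure IsHomeoOn (f : A' → A) (g : A → A') (D : Set A') (X : Set A) : Prop where
  cont : ContinuousOn f D
  cont_inv : ContinuousOn g X
  mapsTo : MapsTo f D X
  mapsTo_inv : MapsTo g X D
  left : ∀ x ∈ D, g (f x) = x
  right : ∀ y ∈ X, f (g y) = y

namespace IsHomeoOn

variable {f : A' → A} {g : A → A'} {D : Set A'} {X : Set A}

theorem symm (h : IsHomeoOn f g D X) : IsHomeoOn g f X D :=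
  ⟨h.cont_inv, h.cont, h.mapsTo_inv, h.mapsTo, h.right, h.left⟩

theorem image (h : IsHomeoOn f g D X) {S : Set A'} (hS : S ⊆ D) : IsHomeoOn f g S (f '' S) := by
  have hX : f '' S ⊆ X := by rintro _ ⟨x, hx, rfl⟩; exact h.mapsTo (hS hx)
  refine ⟨h.cont.mono hS, h.cont_inv.mono hX, mapsTo_image _ _, ?_, fun x hx => h.left x (hS hx),
    fun y hy => h.right y (hX hy)⟩
  rintro _ ⟨x, hx, rfl⟩
  rw [h.left x (hS hx)]; exact hx

/-- The image of a path in `D`. -/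
noncomputable def mapPath (h : IsHomeoOn f g D X) {x y : A'} (γ : Path x y) (hγ : InSet D γ) :
    Path (f x) (f y) :=
  γ.map' (h.cont.mono (by rintro _ ⟨t, rfl⟩; exact hγ t))

theorem inSet_mapPath (h : IsHomeoOn f g D X) {x y : A'} (γ : Path x y) (hγ : InSet D γ) :
    InSet X (h.mapPath γ hγ) := fun s => h.mapsTo (hγ s)

theorem exists_lift (h : IsHomeoOn f g D X) {x y : A} (γ : Path x y) (hγ : InSet X γ) :
    ∃ δ : Path (g x) (g y), InSet D δ ∧ ∀ s, γ s = f (δ s) :=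
  ⟨h.symm.mapPath γ hγ, h.symm.inSet_mapPath γ hγ, fun s => (h.right _ (hγ s)).symm⟩

/-- Representations of `X` and of `D` correspond. -/
theorem exists_push (h : IsHomeoOn f g D X) {G : Type} [Group G]
    {Φ : ∀ ⦃x y : A'⦄, Path x y → G} (hΦ : IsRep D Φ) :
    ∃ Ψ : ∀ ⦃x y : A⦄, Path x y → G, IsRep X Ψ ∧ ∀ ⦃x y : A'⦄ (δ : Path x y), InSet D δ →
      ∀ ⦃x' y' : A⦄ (γ : Path x' y'), (∀ s, γ s = f (δ s)) → Ψ γ = Φ δ := by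
  obtain ⟨Ψ, hΨ, hΨΦ⟩ := hΦ.exists_pullback h.cont_inv h.mapsTo_inv
  refine ⟨Ψ, hΨ, fun x y δ hδ x' y' γ hγ => hΨΦ γ (fun s => ?_) δ fun s => ?_⟩
  · rw [hγ]; exact h.mapsTo (hδ s)
  · rw [hγ, h.left _ (hδ s)]

theorem exists_pull (h : IsHomeoOn f g D X) {G : Type} [Group G]
    {Φ : ∀ ⦃x y : A⦄, Path x y → G} (hΦ : IsRep X Φ) :
    ∃ Ψ : ∀ ⦃x y : A'⦄, Path x y → G, IsRep D Ψ ∧ ∀ ⦃x y : A'⦄ (δ : Path x y), InSet D δ →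
      ∀ ⦃x' y' : A⦄ (γ : Path x' y'), (∀ s, γ s = f (δ s)) → Ψ δ = Φ γ :=
  hΦ.exists_pullback h.cont h.mapsTo

theorem repEq (h : IsHomeoOn f g D X) {x y : A'} {δ δ' : Path x y} (hδ : InSet D δ)
    (hδ' : InSet D δ') {x' y' : A} {γ γ' : Path x' y'} (hγ : ∀ s, γ s = f (δ s))
    (hγ' : ∀ s, γ' s = f (δ' s)) (he : RepEq D δ δ') : RepEq X γ γ' := by
  intro G _ Φ hΦ
  obtain ⟨Ψ, hΨ, hΨΦ⟩ := h.exists_pull hΦ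
  rw [← hΨΦ δ hδ γ hγ, ← hΨΦ δ' hδ' γ' hγ', he G Ψ hΨ]

theorem isFull (h : IsHomeoOn f g D X) {S : Set A'} (hS : S ⊆ D) (hf : IsFull S D) :
    IsFull (f '' S) X := by
  intro x y γ hx hy hγ
  obtain ⟨δ, hδ, hγδ⟩ := h.exists_lift γ hγ
  have hi := h.image hS
  obtain ⟨η, hη, he⟩ := hf δ (hi.mapsTo_inv hx) (hi.mapsTo_inv hy) hδ
  have hxx := hi.right x hx
  have hyy := hi.right y hy
  refine ⟨(hi.mapPath η hη).cast hxx.symm hyy.symm, fun s => hi.inSet_mapPath η hη s, ?_⟩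
  exact h.repEq (fun s => hS (hη s)) hδ (fun s => rfl) hγδ he

theorem isFreeBasis (h : IsHomeoOn f g D X) {m : ℕ} {x : A'} {l : Fin m → Path x x}
    (hl : IsFreeBasis D l) {y : A} (l' : Fin m → Path y y) (hl' : ∀ k s, l' k s = f (l k s))
    (hx : x ∈ D) (hy : y = f x) : IsFreeBasis X l' := by
  obtain ⟨Φ, hΦ, hlD, hone, hgen⟩ := hl
  obtain ⟨Ψ, hΨ, hΨΦ⟩ := h.exists_push hΦ
  refine ⟨Ψ, hΨ, fun k s => by rw [hl']; exact h.mapsTo (hlD k s),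
    fun k => by rw [hΨΦ (l k) (hlD k) (l' k) (hl' k), hone], fun G _ Φ' hΦ' γ hγ => ?_⟩
  have hxy : g y = x := by rw [hy, h.left x hx]
  obtain ⟨Ψ', hΨ', hΨΦ'⟩ := h.exists_pull hΦ'
  obtain ⟨δ, hδ, hγδ⟩ := h.exists_lift γ hγ
  have hδ' : InSet D (δ.cast hxy.symm hxy.symm) := fun s => hδ s
  rw [← hΨΦ' (δ.cast hxy.symm hxy.symm) hδ' γ hγδ, hgen G Ψ' hΨ' _ hδ', hΨΦ _ hδ' γ hγδ]
  congr 2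
  funext k
  exact hΨΦ' (l k) (hlD k) (l' k) (hl' k)

theorem eq_of_repEq (h : IsHomeoOn f g D X) {S : Set A'} (hS : S ⊆ D)
    (hfaith : ∀ (G : Type) [Group G] (Φ : ∀ ⦃x y : A'⦄, Path x y → G), IsRep S Φ →
      ∀ ⦃x y : A'⦄ (γ γ' : Path x y), InSet S γ → InSet S γ' → RepEq D γ γ' → Φ γ = Φ γ')
    {G : Type} [Group G] {Φ : ∀ ⦃x y : A⦄, Path x y → G} (hΦ : IsRep (f '' S) Φ) {x y : A}
    (γ γ' : Path x y) (hγ : InSet (f '' S) γ) (hγ' : InSet (f '' S) γ') (he : RepEq X γ γ') :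
    Φ γ = Φ γ' := by
  have hi := h.image hS
  obtain ⟨Ψ, hΨ, hΨΦ⟩ := hi.exists_pull hΦ
  obtain ⟨δ, hδ, hγδ⟩ := hi.exists_lift γ hγ
  obtain ⟨δ', hδ', hγδ'⟩ := hi.exists_lift γ' hγ'
  have hSX : f '' S ⊆ X := by rintro _ ⟨x, hx, rfl⟩; exact h.mapsTo (hS hx)
  rw [← hΨΦ δ hδ γ hγδ, ← hΨΦ δ' hδ' γ' hγδ']
  refine hfaith G Ψ hΨ δ δ' hδ hδ' (h.symm.repEq (hγ.mono hSX) (hγ'.mono hSX) (fun s => ?_)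
    (fun s => ?_) he)
  · rw [hγδ, h.left _ (hS (hδ s))]
  · rw [hγδ', h.left _ (hS (hδ' s))]

theorem isCollared (h : IsHomeoOn f g D X) [T2Space A] (hD : IsCompact D) {Z' S : Set A'}
    {Z : Set A} (hSD : S ⊆ D) (hZ : ∀ x ∈ D, f x ∈ Z ↔ x ∈ Z') (hc : IsCollared Z' D S) :
    IsCollared Z X (f '' S) := by
  obtain ⟨core, H, hcore, hcD, hdisj, hcont, hH⟩ := hc
  have hmem : ∀ y ∈ (X ∩ Z) \ f '' core, g y ∈ (D ∩ Z') \ core := fun y hy => by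
    have hgy := h.mapsTo_inv hy.1.1
    refine ⟨⟨hgy, (hZ _ hgy).1 (by rw [h.right y hy.1.1]; exact hy.1.2)⟩, fun hgc => hy.2 ?_⟩
    exact ⟨g y, hgc, h.right y hy.1.1⟩
  -- The core is compact as a closed subset of `D`, so its image is closed.
  refine ⟨f '' core, fun p => f (H (p.1, g p.2)),
    ((hD.of_isClosed_subset hcore hcD).image_of_continuousOn (h.cont.mono hcD)).isClosed, ?_, ?_,
    ?_, ?_⟩
  · rintro _ ⟨x, hx, rfl⟩; exact h.mapsTo (hcD hx)
  · rw [Set.disjoint_left]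
    rintro _ ⟨x, hx, rfl⟩ ⟨y, hy, hxy⟩
    have : y = x := by rw [← h.left y (hSD hy), hxy, h.left x (hcD hx)]
    exact Set.disjoint_left.1 hdisj hx (this ▸ hy)
  · refine h.cont.comp (hcont.comp (f := fun p : unitInterval × A => (p.1, g p.2)) ?_ ?_) ?_
    · exact continuousOn_fst.prodMk (h.cont_inv.comp continuousOn_snd fun p hp => hp.2.1.1)
    · exact fun p hp => ⟨trivial, hmem _ hp.2⟩
    · exact fun p hp => ((hH _ (hmem _ hp.2)).2.1 p.1).1
  · intro y hy
    obtain ⟨h1, h2, h3, h4⟩ := hH _ (hmem y hy)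
    refine ⟨⟨_, h1, rfl⟩, fun s => ⟨h.mapsTo (h2 s).1, (hZ _ (h2 s).1).2 (h2 s).2⟩, ?_, ?_⟩
    · simp only [h3, h.right y hy.1.1]
    · rintro ⟨x, hx, rfl⟩ s
      rw [h.left x (hSD hx)] at h4
      simp only [h.left x (hSD hx), h4 hx s]

end IsHomeoOn

end Transport

/-! ### Parametrized balls with flat disks. -/

section FlatPair

variable {A : Type} [TopologicalSpace A]

/-- `F` parametrizes a ball `X` with boundary `bd`, such that the preimage of the complement of `Z`
is a collection of parallel flat disks. -/
structure IsFlatPair (n : ℕ) {m : ℕ} (Z X bd : Set A) (F : EuclideanSpace ℝ (Fin (n + 2)) → A)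
    (t : Fin m → ℝ) : Prop where
  cont : ContinuousOn F (Metric.closedBall 0 1)
  inj : InjOn F (Metric.closedBall 0 1)
  image_ball : F '' Metric.closedBall 0 1 = X
  image_sphere : F '' Metric.sphere 0 1 = bd
  inj_param : Function.Injective t
  param_lt : ∀ j, |t j| < 1
  mem_iff : ∀ x ∈ Metric.closedBall 0 1, F x ∈ Z ↔ x ∈ flatCompl n t

/-- A ball `X` with boundary `bd` behaves, relative to the complement `Z` of a trivial collection of
disks, like a handlebody with its boundary. -/
structure IsTame (Z X bd : Set A) : Prop where
  isClosed : IsClosed X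
  subset : bd ⊆ X
  nonempty : (bd ∩ Z).Nonempty
  collared : IsCollared Z X bd
  join : ∀ y ∈ X ∩ Z, ∃ x ∈ bd ∩ Z, ∃ p : Path x y, InSet (X ∩ Z) p
  joined : ∀ x ∈ bd ∩ Z, ∀ y ∈ bd ∩ Z, ∃ p : Path x y, InSet (bd ∩ Z) p
  full : IsFull (bd ∩ Z) (X ∩ Z)

namespace IsFlatPair

variable {n m : ℕ} {Z X bd : Set A} {t : Fin m → ℝ}

section

variable {F : EuclideanSpace ℝ (Fin (n + 2)) → A}

theorem isClosed [T2Space A] (h : IsFlatPair n Z X bd F t) : IsClosed X := by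
  rw [← h.image_ball]
  exact ((isCompact_closedBall 0 1).image_of_continuousOn h.cont).isClosed

theorem exists_isHomeoOn [T2Space A] (h : IsFlatPair n Z X bd F t) :
    ∃ g, IsHomeoOn F g (Metric.closedBall 0 1) X := by
  have hmaps : MapsTo F (Metric.closedBall 0 1) X := by
    rw [← h.image_ball]; exact mapsTo_image _ _
  let g := Function.invFunOn F (Metric.closedBall 0 1)
  have hg : ∀ y ∈ X, g y ∈ Metric.closedBall 0 1 ∧ F (g y) = y := by
    intro y hy
    rw [← h.image_ball] at hy
    exact ⟨Function.invFunOn_mem hy, Function.invFunOn_eq hy⟩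
  refine ⟨g, h.cont, ?_, hmaps, fun y hy => (hg y hy).1, fun x hx => ?_, fun y hy => (hg y hy).2⟩
  -- The inverse is continuous because closed subsets of the compact ball have closed images.
  · rw [continuousOn_iff_isClosed]
    intro s hs
    refine ⟨F '' (s ∩ Metric.closedBall 0 1), (((isCompact_closedBall 0 1).inter_left
      hs).image_of_continuousOn (h.cont.mono inter_subset_right)).isClosed, ?_⟩
    ext y
    constructor
    · rintro ⟨hy, hyX⟩
      exact ⟨⟨g y, ⟨hy, (hg y hyX).1⟩, (hg y hyX).2⟩, hyX⟩
    · rintro ⟨⟨x, ⟨hx, hxb⟩, rfl⟩, hyX⟩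
      refine ⟨?_, hyX⟩
      have := h.inj (hg _ hyX).1 hxb (hg _ hyX).2
      show g (F x) ∈ s
      rwa [this]
  · exact h.inj (hg _ (hmaps hx)).1 hx (hg _ (hmaps hx)).2

theorem image_inter (h : IsFlatPair n Z X bd F t) {S : Set (EuclideanSpace ℝ (Fin (n + 2)))}
    (hS : S ⊆ Metric.closedBall 0 1) : F '' (S ∩ flatCompl n t) = F '' S ∩ Z := by
  ext y
  constructor
  · rintro ⟨x, ⟨hx, hx'⟩, rfl⟩
    exact ⟨⟨x, hx, rfl⟩, (h.mem_iff x (hS hx)).2 hx'⟩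
  · rintro ⟨⟨x, hx, rfl⟩, hy⟩
    exact ⟨x, ⟨hx, (h.mem_iff x (hS hx)).1 hy⟩, rfl⟩

theorem exists_isHomeoOn_inter [T2Space A] (h : IsFlatPair n Z X bd F t) :
    ∃ g, IsHomeoOn F g (Metric.closedBall 0 1) X ∧
      IsHomeoOn F g (Metric.closedBall 0 1 ∩ flatCompl n t) (X ∩ Z) := by
  obtain ⟨g, hg⟩ := h.exists_isHomeoOn
  refine ⟨g, hg, ?_⟩
  have := hg.image (inter_subset_left (t := flatCompl n t))
  rwa [h.image_inter subset_rfl, h.image_ball] at this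

theorem sphere_image (h : IsFlatPair n Z X bd F t) :
    F '' (Metric.sphere 0 1 ∩ flatCompl n t) = bd ∩ Z := by
  rw [h.image_inter Metric.sphere_subset_closedBall, h.image_sphere]

theorem subset (h : IsFlatPair n Z X bd F t) : bd ⊆ X := by
  rw [← h.image_ball, ← h.image_sphere]
  exact image_mono Metric.sphere_subset_closedBall

/-- Loops around the disks, together with arcs to them, form a free basis. -/
theorem exists_isFreeBasis [T2Space A] (h : IsFlatPair n Z X bd F t) {ε : ℝ} (hε : 0 < ε)
    (hsep : ∀ k l, k ≠ l → 8 * ε < |t k - t l|) (hb : ∀ k, |t k| + 2 * ε < 1) {x : A}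
    (hx : x ∈ X ∩ Z) :
    ∃ (y : Fin m → A) (p : ∀ k, Path x (y k)) (μ : ∀ k, Path (y k) (y k)),
      (∀ k, InSet (X ∩ Z) (p k)) ∧ (∀ k, InSet (X ∩ Z) (μ k)) ∧
      (∀ k s, μ k s = F (planePt n (t k + ε * Real.cos (2 * Real.pi * s))
        (ε * Real.sin (2 * Real.pi * s)))) ∧
      IsFreeBasis (X ∩ Z) fun k => ((p k).trans (μ k)).trans (p k).symm := by
  obtain ⟨g, hg, hgZ⟩ := h.exists_isHomeoOn_inter
  obtain ⟨p, hp, hμ, hbas⟩ := exists_isFreeBasis_model h.param_lt hε hsep hb (hgZ.mapsTo_inv hx)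
  have hxx := hgZ.right x hx
  refine ⟨fun k => F (planePt n (t k + ε) 0), fun k => (hgZ.mapPath (p k) (hp k)).cast hxx.symm rfl,
    fun k => hgZ.mapPath _ (hμ k), fun k s => hgZ.inSet_mapPath (p k) (hp k) s,
    fun k => hgZ.inSet_mapPath _ (hμ k), fun k s => rfl,
    hgZ.isFreeBasis hbas _ (fun k s => ?_) (hgZ.mapsTo_inv hx) hxx.symm⟩
  simp only [Path.trans_apply, Path.symm_apply]
  split_ifs <;> rfl

end

section

variable {F : EuclideanSpace ℝ (Fin (n + 1 + 2)) → A}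

theorem isTame [T2Space A] (h : IsFlatPair (n + 1) Z X bd F t) : IsTame Z X bd := by
  obtain ⟨g, hg, hgZ⟩ := h.exists_isHomeoOn_inter
  have hsub : Metric.sphere 0 1 ∩ flatCompl (n + 1) t ⊆
      Metric.closedBall 0 1 ∩ flatCompl (n + 1) t :=
    inter_subset_inter_left _ Metric.sphere_subset_closedBall
  have hS := hgZ.image hsub
  refine ⟨h.isClosed, h.subset, ?_, ?_, ?_, ?_, ?_⟩
  · rw [← h.sphere_image]
    have := pole_mem (n := n + 1) t (Or.inl rfl : (1 : ℝ) = 1 ∨ (1 : ℝ) = -1)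
    exact ⟨_, _, this, rfl⟩
  · rw [← h.image_sphere]
    exact hg.isCollared (isCompact_closedBall 0 1) Metric.sphere_subset_closedBall h.mem_iff
      (isCollared_model t h.param_lt)
  · intro y hy
    obtain ⟨x, hx, p, hp⟩ := exists_path_to_sphere t (hgZ.mapsTo_inv hy)
    refine ⟨F x, by rw [← h.sphere_image]; exact ⟨x, hx, rfl⟩,
      (hgZ.mapPath p hp).cast rfl (hgZ.right y hy).symm, fun s => hgZ.inSet_mapPath p hp s⟩
  · rw [← h.sphere_image]
    rintro _ ⟨x, hx, rfl⟩ _ ⟨y, hy, rfl⟩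
    obtain ⟨p, hp⟩ := exists_path_to_pole t h.param_lt hx
    obtain ⟨q, hq⟩ := exists_path_to_pole t h.param_lt hy
    exact ⟨hS.mapPath (p.symm.trans q) (hp.symm.trans hq), hS.inSet_mapPath _ _⟩
  · rw [← h.sphere_image]
    exact hgZ.isFull hsub (isFull_model t h.param_lt)

end

theorem eq_of_repEq [T2Space A] {F : EuclideanSpace ℝ (Fin (2 + 2)) → A}
    (h : IsFlatPair 2 Z X bd F t) {G : Type} [Group G] {Φ : ∀ ⦃x y : A⦄, Path x y → G}
    (hΦ : IsRep (bd ∩ Z) Φ) {x y : A} (γ γ' : Path x y) (hγ : InSet (bd ∩ Z) γ)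
    (hγ' : InSet (bd ∩ Z) γ') (he : RepEq (X ∩ Z) γ γ') : Φ γ = Φ γ' := by
  obtain ⟨g, hg, hgZ⟩ := h.exists_isHomeoOn_inter
  rw [← h.sphere_image] at hΦ hγ hγ'
  exact hgZ.eq_of_repEq (inter_subset_inter_left _ Metric.sphere_subset_closedBall)
    (fun G _ Φ hΦ x y γ γ' hγ hγ' he =>
      IsRep.eq_of_repEq_model h.param_lt hΦ γ γ' hγ hγ' he) hΦ γ γ' hγ hγ' he

end IsFlatPair

end FlatPair

/-! ### From representations to presentations of the fundamental group. -/

section Universal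

theorem fundamentalGroup_mul {Y : Type} [TopologicalSpace Y] {x : Y} (p q : Path x x) :
    FundamentalGroup.fromPath (Path.Homotopic.Quotient.mk q) *
      FundamentalGroup.fromPath (Path.Homotopic.Quotient.mk p) =
    FundamentalGroup.fromPath (Path.Homotopic.Quotient.mk (p.trans q)) := rfl

variable {Y : Type} [TopologicalSpace Y]

/-- The representation of the fundamental groupoid in the fundamental group that is given by a
choice of paths from the base point. -/
noncomputable def loopRep {x₀ : Y} (c : ∀ y, Path x₀ y) ⦃x y : Y⦄ (γ : Path x y) :
    FundamentalGroup Y x₀ :=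
  FundamentalGroup.fromPath (Path.Homotopic.Quotient.mk (((c x).trans γ).trans (c y).symm))

open Path.Homotopic in
theorem isRep_loopRep {x₀ : Y} (c : ∀ y, Path x₀ y) : IsRep univ (loopRep c) := by
  refine ⟨fun x y z γ γ' _ _ => ?_, fun x y γ γ' F _ => ?_⟩
  · rw [loopRep, loopRep, loopRep, fundamentalGroup_mul]
    congr 1
    simp only [Quotient.mk_trans, Quotient.mk_symm, Quotient.trans_assoc]
    simp [← Quotient.trans_assoc]
  · rw [loopRep, loopRep]
    congr 1
    rw [Quotient.mk_trans, Quotient.mk_trans, Quotient.mk_trans, Quotient.mk_trans,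
      show Path.Homotopic.Quotient.mk γ = Path.Homotopic.Quotient.mk γ' from
        Path.Homotopic.Quotient.eq.2 ⟨F⟩]

theorem IsRep.exists_hom {G : Type} [Group G] {Φ : ∀ ⦃x y : Y⦄, Path x y → G} (hΦ : IsRep univ Φ)
    (x₀ : Y) : ∃ e : FundamentalGroup Y x₀ →* G, ∀ γ : Path x₀ x₀,
      e (FundamentalGroup.fromPath (Path.Homotopic.Quotient.mk γ)) = Φ γ := by
  let e : FundamentalGroup Y x₀ → G := fun q => Quotient.lift (s := Path.Homotopic.setoid x₀ x₀)
    (fun γ => Φ γ) (fun γ γ' h => hΦ.hom γ γ' h.some fun _ => trivial) (FundamentalGroup.toPath q)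
  have he : ∀ γ : Path x₀ x₀,
      e (FundamentalGroup.fromPath (Path.Homotopic.Quotient.mk γ)) = Φ γ := fun _ => rfl
  refine ⟨MonoidHom.mk' e fun p q => ?_, he⟩
  induction p using Path.Homotopic.Quotient.ind with | mk p => ?_
  induction q using Path.Homotopic.Quotient.ind with | mk q => ?_
  exact (he (q.trans p)).trans (hΦ.trans q p (fun _ => trivial) fun _ => trivial)

theorem exists_isHomeoOn_subtype {A : Type} [TopologicalSpace A] {Z : Set A} (x₀ : Z) :
    ∃ g : A → Z, IsHomeoOn Subtype.val g univ Z := by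
  classical
  let g : A → Z := fun y => if h : y ∈ Z then ⟨y, h⟩ else x₀
  have hg : ∀ y (h : y ∈ Z), g y = ⟨y, h⟩ := fun y h => dif_pos h
  refine ⟨g, continuous_subtype_val.continuousOn, ?_, fun x _ => x.2, fun _ _ => trivial,
    fun x _ => hg x x.2, fun y hy => by rw [hg y hy]⟩
  rw [continuousOn_iff_continuous_domRestrict]
  convert (continuous_id : Continuous fun x : Z => x) using 1
  funext x
  exact hg x x.2

variable {A : Type} [TopologicalSpace A] {Z : Set A}

/-- A path in the subspace `Z`. -/
def liftPath {x y : A} (γ : Path x y) (hγ : InSet Z γ) :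
    Path (⟨x, hγ.source⟩ : Z) ⟨y, hγ.target⟩ where
  toFun s := ⟨γ s, hγ s⟩
  continuous_toFun := by fun_prop
  source' := by simp
  target' := by simp

/-- A presentation of the fundamental group of `Z` from a free basis of a subset `P` that carries
the fundamental group. -/
theorem exists_presentation {P : Set A} {p q : ℕ} {s : A} {g : Fin p → Path s s} (hsZ : s ∈ Z)
    (hP : P ⊆ Z) (hg : IsFreeBasis P g) (hs : s ∈ P) (hfull : IsFull P Z)
    (r : Fin q → FreeGroup (Fin p))
    (hrel : ∀ (G : Type) [Group G] (Φ : ∀ ⦃x y : A⦄, Path x y → G), IsRep Z Φ →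
      ∀ k, FreeGroup.lift (fun l => Φ (g l)) (r k) = 1)
    (hrep : ∃ Φ : ∀ ⦃x y : A⦄, Path x y → PresentedGroup (range r), IsRep Z Φ ∧
      ∀ l, Φ (g l) = PresentedGroup.of l)
    (x₀ : Z) (hpc : ∀ y : Z, Nonempty (Path x₀ y)) (a : Path x₀ ⟨s, hsZ⟩) :
    ∃ e : PresentedGroup (range r) ≃* FundamentalGroup Z x₀, ∀ l (l' : Path (⟨s, hsZ⟩ : Z) ⟨s, hsZ⟩),
      (∀ u, (l' u : A) = g l u) → e (PresentedGroup.of l) =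
        FundamentalGroup.fromPath (Path.Homotopic.Quotient.mk ((a.trans l').trans a.symm)) := by
  classical
  obtain ⟨ret, hh⟩ := exists_isHomeoOn_subtype x₀
  -- The path to `s` must be the given `a`, so that a generator goes to its loop conjugated by
  -- exactly this path.
  let c : ∀ y, Path x₀ y := Function.update (fun y => (hpc y).some) ⟨s, hsZ⟩ a
  have hc : c ⟨s, hsZ⟩ = a := Function.update_self ..
  have hU := isRep_loopRep c
  obtain ⟨V, hV, hVU⟩ := hh.exists_push hU
  obtain ⟨ΦP, hΦP, hgP, hone, hgen⟩ := hg
  let f : PresentedGroup (range r) →* FundamentalGroup Z x₀ :=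
    PresentedGroup.toGroup (f := fun l => V (g l)) (by rintro _ ⟨k, rfl⟩; exact hrel _ V hV k)
  have hf : ∀ l, f (PresentedGroup.of l) = V (g l) := fun l => PresentedGroup.toGroup.of _
  have hfmk : ∀ w, f (PresentedGroup.mk _ w) = FreeGroup.lift (fun l => V (g l)) w := fun _ => rfl
  obtain ⟨Ω, hΩ, hΩg⟩ := hrep
  obtain ⟨Ω', hΩ', hΩΩ'⟩ := hh.exists_pull hΩ
  obtain ⟨ev, hev⟩ := hΩ'.exists_hom x₀
  -- The representation `Ω` in the presented group induces a left inverse of `f`, up to conjugation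
  -- by its value on `a`.
  have hinj : Function.Injective f := by
    have : ((MulAut.conj (Ω' a)).toMonoidHom.comp (ev.comp f)) = MonoidHom.id _ := by
      refine PresentedGroup.ext fun l => ?_
      simp only [MonoidHom.comp_apply, hf, MonoidHom.id_apply]
      rw [hVU (liftPath (g l) ((hgP l).mono hP)) (fun _ => trivial) (g l) fun _ => rfl, loopRep, hev,
        hc, hΩ'.map_conj a _ a (fun _ => trivial) (fun _ => trivial) (fun _ => trivial),
        hΩΩ' (liftPath (g l) ((hgP l).mono hP)) (fun _ => trivial) (g l) fun _ => rfl, hΩg]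
      simp [mul_assoc]
    intro x y hxy
    have h1 := DFunLike.congr_fun this x
    have h2 := DFunLike.congr_fun this y
    simp only [MonoidHom.comp_apply, MonoidHom.id_apply] at h1 h2
    rw [← h1, ← h2, hxy]
  -- Moved to `s`, a loop is equivalent to a loop in `P`, hence to a word in the basis.
  have hsurj : Function.Surjective f := by
    intro x
    induction x using Path.Homotopic.Quotient.ind with | mk γ => ?_
    let γ' : Path (⟨s, hsZ⟩ : Z) ⟨s, hsZ⟩ := (a.symm.trans γ).trans a
    let γA : Path s s := γ'.map continuous_subtype_val
    obtain ⟨δ, hδ, he⟩ := hfull γA hs hs (fun u => (γ' u).2)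
    refine ⟨PresentedGroup.mk _ (ΦP δ), ?_⟩
    rw [hfmk, ← hgen _ V (hV.mono hP) δ hδ, he _ V hV, hVU γ' (fun _ => trivial) γA fun _ => rfl,
      loopRep, hc]
    show FundamentalGroup.fromPath _ = FundamentalGroup.fromPath (Path.Homotopic.Quotient.mk γ)
    congr 1
    simp only [γ', Path.Homotopic.Quotient.mk_trans, Path.Homotopic.Quotient.mk_symm,
      Path.Homotopic.Quotient.trans_assoc]
    simp [← Path.Homotopic.Quotient.trans_assoc]
  refine ⟨MulEquiv.ofBijective f ⟨hinj, hsurj⟩, fun l l' hl' => ?_⟩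
  show f (PresentedGroup.of l) = _
  rw [hf, hVU l' (fun _ => trivial) (g l) fun u => (hl' u).symm, loopRep,
    hc]

end Universal

/-! ### Relations for a union of three pieces. -/

section ThreePieces

variable {A : Type} [TopologicalSpace A]

/-- Representations of `S` do not distinguish more paths than representations of `T`. -/
def IsFaithful (S T : Set A) : Prop :=
  ∀ (G : Type) [Group G] (Φ : ∀ ⦃x y : A⦄, Path x y → G), IsRep S Φ →
    ∀ ⦃x y : A⦄ (γ γ' : Path x y), InSet S γ → InSet S γ' → RepEq T γ γ' → Φ γ = Φ γ'

theorem IsTame.isFull_union {Z C B S : Set A} (hC : IsClosed C) (hB : IsTame Z B S)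
    (hS : C ∩ B = S) : IsFull (C ∩ Z) ((C ∪ B) ∩ Z) := by
  subst hS
  exact IsFull.attach hC hB.isClosed hB.collared hB.join hB.full

theorem IsTame.exists_rep_union {Z C B S : Set A} (hC : IsClosed C) (hB : IsTame Z B S)
    (hS : C ∩ B = S) {G : Type} [Group G] {Φ : ∀ ⦃x y : A⦄, Path x y → G} (hΦ : IsRep (C ∩ Z) Φ)
    (hker : ∀ ⦃x y : A⦄ (γ γ' : Path x y), InSet (S ∩ Z) γ → InSet (S ∩ Z) γ' →
      RepEq (B ∩ Z) γ γ' → Φ γ = Φ γ') :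
    ∃ Ψ : ∀ ⦃x y : A⦄, Path x y → G, IsRep ((C ∪ B) ∩ Z) Ψ ∧
      ∀ ⦃x y : A⦄ (γ : Path x y), InSet (C ∩ Z) γ → Ψ γ = Φ γ := by
  subst hS
  exact hΦ.exists_attach hC hB.isClosed hB.collared hB.join hB.full hker

theorem normalClosure_range_comp_le {G H : Type} [Group G] [Group H] {q : ℕ} (r : Fin q → G)
    (ψ : G →* H) :
    Subgroup.normalClosure (range r) ≤ (Subgroup.normalClosure (range fun k => ψ (r k))).comap ψ := by
  refine Subgroup.normalClosure_le_normal ?_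
  rintro _ ⟨k, rfl⟩
  exact Subgroup.subset_normalClosure ⟨k, rfl⟩

/-- Only the attachment of `Q ∩ R` to `P` imposes relations. Its identifications of paths in the
central sphere hold in `Q` as well, so they are controlled by the kernel of the surjection `φ`
between free groups. Faithfulness makes the attachments of `Q` and `R` unconditional. -/
theorem exists_relations {Z P Q R : Set A} {b p q : ℕ} (hP : IsClosed P)
    (hPQ : IsClosed (P ∩ Q)) (hQR : IsTame Z (Q ∩ R) (P ∩ Q ∩ R))
    (hQ : IsTame Z Q (P ∩ Q ∪ Q ∩ R)) (hR : IsTame Z R (P ∩ R ∪ Q ∩ R))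
    (hQf : IsFaithful ((P ∩ Q ∪ Q ∩ R) ∩ Z) (Q ∩ Z))
    (hRf : IsFaithful ((P ∩ R ∪ Q ∩ R) ∩ Z) (R ∩ Z))
    (hcover : P ∪ Q ∪ R = univ) {s : A} (hs : s ∈ P ∩ Q ∩ R ∩ Z)
    {g : Fin p → Path s s} (hg : IsFreeBasis (P ∩ Z) g)
    {g' : Fin q → Path s s} (hg' : IsFreeBasis (Q ∩ Z) g')
    {h : Fin b → Path s s} (hh : IsFreeBasis (P ∩ Q ∩ Z) h) :
    q ≤ b ∧ IsFull (P ∩ Z) Z ∧ ∃ r : Fin (b - q) → FreeGroup (Fin p),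
      (∀ (G : Type) [Group G] (Φ : ∀ ⦃x y : A⦄, Path x y → G), IsRep Z Φ →
        ∀ k, FreeGroup.lift (fun l => Φ (g l)) (r k) = 1) ∧
      ∃ Φ : ∀ ⦃x y : A⦄, Path x y → PresentedGroup (range r), IsRep Z Φ ∧
        ∀ l, Φ (g l) = PresentedGroup.of l := by
  obtain ⟨Φp, hΦp, hgP, honep, hgenp⟩ := hg
  obtain ⟨Φq, hΦq, hgQ, honeq, hgenq⟩ := hg'
  obtain ⟨Φh, hΦh, hhH, honeh, hgenh⟩ := hh
  have sHP : P ∩ Q ∩ Z ⊆ P ∩ Z := fun x hx => ⟨hx.1.1, hx.2⟩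
  have sHQ : P ∩ Q ∩ Z ⊆ Q ∩ Z := fun x hx => ⟨hx.1.2, hx.2⟩
  let φ : FreeGroup (Fin b) →* FreeGroup (Fin q) := FreeGroup.lift fun l => Φq (h l)
  let ψ : FreeGroup (Fin b) →* FreeGroup (Fin p) := FreeGroup.lift fun l => Φp (h l)
  have hφ : ∀ γ : Path s s, InSet (P ∩ Q ∩ Z) γ → Φq γ = φ (Φh γ) := fun γ hγ =>
    hgenh _ Φq (hΦq.mono sHQ) γ hγ
  have hψ : ∀ γ : Path s s, InSet (P ∩ Q ∩ Z) γ → Φp γ = ψ (Φh γ) := fun γ hγ =>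
    hgenh _ Φp (hΦp.mono sHP) γ hγ
  -- A path in `Q` is pushed into the boundary of `Q`, which is `P ∩ Q` with `Q ∩ R` attached, and
  -- then into `P ∩ Q`. This gives surjectivity of `φ`.
  have hfullQ : IsFull (P ∩ Q ∩ Z) (Q ∩ Z) := by
    refine IsFull.trans (S := (P ∩ Q ∪ Q ∩ R) ∩ Z) (fun x hx => ⟨Or.inl hx.1, hx.2⟩)
      (fun x hx => ⟨hQ.subset hx.1, hx.2⟩) (hQR.isFull_union hPQ ?_) hQ.full
    ext x; simp only [mem_inter_iff]; tauto
  have hφs : Function.Surjective φ := by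
    rw [← MonoidHom.range_eq_top, eq_top_iff, ← FreeGroup.closure_range_of, Subgroup.closure_le]
    rintro _ ⟨k, rfl⟩
    obtain ⟨δ, hδ, he⟩ := hfullQ (g' k) ⟨hs.1.1, hs.2⟩ ⟨hs.1.1, hs.2⟩ (hgQ k)
    exact ⟨Φh δ, by rw [← hφ δ hδ, he _ Φq hΦq, honeq]⟩
  obtain ⟨hqb, r, hr⟩ := exists_ker_eq_normalClosure_of_freeGroup_surjective φ hφs
  have hC1 : IsClosed (P ∪ Q ∩ R) := hP.union hQR.isClosed
  have hC2 : IsClosed (P ∪ Q ∩ R ∪ Q) := hC1.union hQ.isClosed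
  have e1 : P ∩ (Q ∩ R) = P ∩ Q ∩ R := (inter_assoc _ _ _).symm
  have e2 : (P ∪ Q ∩ R) ∩ Q = P ∩ Q ∪ Q ∩ R := by
    ext x; simp only [mem_inter_iff, mem_union]; tauto
  have e3 : (P ∪ Q ∩ R ∪ Q) ∩ R = P ∩ R ∪ Q ∩ R := by
    ext x; simp only [mem_inter_iff, mem_union]; tauto
  have e4 : (P ∪ Q ∩ R ∪ Q ∪ R) ∩ Z = Z := by
    rw [inter_eq_right]
    intro x _
    have : x ∈ P ∪ Q ∪ R := hcover ▸ mem_univ x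
    simp only [mem_union] at this ⊢
    tauto
  refine ⟨hqb, ?_, fun k => ψ (r k), ?_, ?_⟩
  · have f1 := hQR.isFull_union hP e1
    have f2 := hQ.isFull_union hC1 e2
    have f3 := hR.isFull_union hC2 e3
    rw [e4] at f3
    exact (f1.trans (inter_subset_inter_left _ subset_union_left) inter_subset_right
      ((f2.trans (inter_subset_inter_left _ subset_union_left) inter_subset_right f3)))
  · intro G _ Φ hΦ k
    -- A loop in `P ∩ Q` has the same value in `Z` whether it is expanded in the basis of `P` or in
    -- that of `Q`.
    have h1 : (FreeGroup.lift fun l => Φ (g l)).comp ψ =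
        (FreeGroup.lift fun l => Φ (g' l)).comp φ := by
      refine FreeGroup.ext_hom _ _ fun l => ?_
      simp only [MonoidHom.comp_apply, ψ, φ, FreeGroup.lift_apply_of]
      rw [← hgenp _ Φ (hΦ.mono inter_subset_right) _ ((hhH l).mono sHP),
        ← hgenq _ Φ (hΦ.mono inter_subset_right) _ ((hhH l).mono sHQ)]
    have h2 : φ (r k) = 1 := by
      rw [← MonoidHom.mem_ker, hr]
      exact Subgroup.subset_normalClosure ⟨k, rfl⟩
    have h3 := DFunLike.congr_fun h1 (r k)
    rw [MonoidHom.comp_apply, MonoidHom.comp_apply, h2, map_one] at h3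
    exact h3
  · set rels := range fun k => ψ (r k) with hrels
    let Φ0 : ∀ ⦃x y : A⦄, Path x y → PresentedGroup rels := fun x y γ =>
      PresentedGroup.mk rels (Φp γ)
    have hΦ0 : IsRep (P ∩ Z) Φ0 :=
      ⟨fun x y z γ γ' hγ hγ' => by simp only [Φ0, hΦp.trans _ _ hγ hγ', map_mul],
        fun x y γ γ' F hF => by simp only [Φ0, hΦp.hom _ _ F hF]⟩
    have sS : P ∩ Q ∩ R ∩ Z ⊆ P ∩ Q ∩ Z := fun x hx => ⟨hx.1.1, hx.2⟩
    have sT : P ∩ Q ∩ R ∩ Z ⊆ Q ∩ R ∩ Z := fun x hx => ⟨⟨hx.1.1.2, hx.1.2⟩, hx.2⟩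
    have s3Q : Q ∩ R ∩ Z ⊆ Q ∩ Z := fun x hx => ⟨hx.1.1, hx.2⟩
    -- Paths in the sphere are closed up at `s` by common arcs. If they agree in `Q ∩ R`, their
    -- words in the basis of `P ∩ Q` differ by an element of `ker φ`, which `ψ` maps into the normal
    -- closure of the relations.
    obtain ⟨Φ1, hΦ1, h01⟩ := hQR.exists_rep_union hP e1 hΦ0 (by
      intro x y γ γ' hγ hγ' he
      obtain ⟨u, hu⟩ := hQR.joined s hs x hγ.source
      obtain ⟨v, hv⟩ := hQR.joined s hs y hγ.target
      have hloop : ∀ δ : Path x y, InSet (P ∩ Q ∩ R ∩ Z) δ →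
          InSet (P ∩ Q ∩ R ∩ Z) ((u.trans δ).trans v.symm) := fun δ hδ => (hu.trans hδ).trans hv.symm
      have hval : ∀ {G : Type} [Group G] {Φ : ∀ ⦃x y : A⦄, Path x y → G},
          IsRep (P ∩ Q ∩ R ∩ Z) Φ → ∀ δ : Path x y, InSet (P ∩ Q ∩ R ∩ Z) δ →
          Φ δ = Φ v * Φ ((u.trans δ).trans v.symm) * (Φ u)⁻¹ := fun hΦ δ hδ => by
        rw [hΦ.map_conj u δ v hu hδ hv]; group
      rw [hval (hΦ0.mono (sS.trans sHP)) γ hγ, hval (hΦ0.mono (sS.trans sHP)) γ' hγ']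
      congr 2
      show PresentedGroup.mk rels (Φp _) = PresentedGroup.mk rels (Φp _)
      rw [hψ _ ((hloop γ hγ).mono sS), hψ _ ((hloop γ' hγ').mono sS)]
      set w := Φh ((u.trans γ).trans v.symm) with hw
      set w' := Φh ((u.trans γ').trans v.symm) with hw'
      have h1 : φ w = φ w' := by
        rw [hw, hw', ← hφ _ ((hloop γ hγ).mono sS), ← hφ _ ((hloop γ' hγ').mono sS),
          hΦq.map_conj _ _ _ (hu.mono (sS.trans sHQ)) (hγ.mono (sS.trans sHQ))
            (hv.mono (sS.trans sHQ)),
          hΦq.map_conj _ _ _ (hu.mono (sS.trans sHQ)) (hγ'.mono (sS.trans sHQ))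
            (hv.mono (sS.trans sHQ)), he _ Φq (hΦq.mono s3Q)]
      have h2 : w⁻¹ * w' ∈ φ.ker := by
        rw [MonoidHom.mem_ker, map_mul, map_inv, h1, inv_mul_cancel]
      rw [hr] at h2
      have h3 := normalClosure_range_comp_le r ψ h2
      rw [Subgroup.mem_comap, map_mul, map_inv] at h3
      exact (QuotientGroup.eq.2 h3))
    obtain ⟨Φ2, hΦ2, h12⟩ := hQ.exists_rep_union hC1 e2 hΦ1 (fun x y γ γ' hγ hγ' he =>
      hQf _ Φ1 (hΦ1.mono (by rw [← e2]; exact inter_subset_inter_left _ inter_subset_left))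
        γ γ' hγ hγ' he)
    obtain ⟨Φ3, hΦ3, h23⟩ := hR.exists_rep_union hC2 e3 hΦ2 (fun x y γ γ' hγ hγ' he =>
      hRf _ Φ2 (hΦ2.mono (by rw [← e3]; exact inter_subset_inter_left _ inter_subset_left))
        γ γ' hγ hγ' he)
    rw [e4] at hΦ3
    refine ⟨Φ3, hΦ3, fun l => ?_⟩
    have hl1 : InSet ((P ∪ Q ∩ R) ∩ Z) (g l) := (hgP l).mono
      (inter_subset_inter_left _ subset_union_left)
    have hl2 : InSet ((P ∪ Q ∩ R ∪ Q) ∩ Z) (g l) := hl1.mono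
      (inter_subset_inter_left _ subset_union_left)
    rw [h23 _ hl2, h12 _ hl1, h01 _ (hgP l)]
    show PresentedGroup.mk rels (Φp (g l)) = _
    rw [honep]
    rfl

end ThreePieces

/-! ### Curves in the image of a smooth embedding. -/

section Immersions

variable {E₁ E₂ H₁ H₂ : Type*} [NormedAddCommGroup E₁] [NormedSpace ℝ E₁]
  [NormedAddCommGroup E₂] [NormedSpace ℝ E₂] [TopologicalSpace H₁] [TopologicalSpace H₂]
  {I : ModelWithCorners ℝ E₁ H₁} {J : ModelWithCorners ℝ E₂ H₂}
  {M N : Type*} [TopologicalSpace M] [ChartedSpace H₁ M] [TopologicalSpace N] [ChartedSpace H₂ N]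
  {f : M → N} {m : M}

-- In the charts of an immersion the map is an inclusion of a factor; projecting to this factor
-- gives the inverse.
open Manifold in
theorem Manifold.IsImmersionAt.exists_local_left_inverse [I.Boundaryless] (h : IsImmersionAt I J ∞ f m) :
    ∃ g : N → M, MDifferentiableAt J I g (f m) ∧ ∀ᶠ x in nhds m, g (f x) = x := by
  let φ := h.domChart.extend I
  let ψ := h.codChart.extend J
  have hψ : MDifferentiableAt J 𝓘(ℝ, E₂) ψ (f m) :=
    (h.codChart.contMDiffAt_extend h.codChart_mem_maximalAtlas h.mem_codChart_source).mdifferentiableAt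
      (by simp)
  have hleft : ∀ x ∈ h.domChart.source, (h.equiv.symm (ψ (f x))).1 = φ x := by
    intro x hx
    have hx' : x ∈ φ.source := by rwa [OpenPartialHomeomorph.extend_source]
    have := h.writtenInCharts (φ.map_source hx')
    simp only [Function.comp_apply] at this
    rw [φ.left_inv hx'] at this
    rw [show ψ (f x) = _ from this]
    simp
  have hm := h.mem_domChart_source
  have hm' : m ∈ φ.source := by rwa [OpenPartialHomeomorph.extend_source]
  have hφ : MDifferentiableAt 𝓘(ℝ, E₁) I φ.symm (φ m) := by
    have h1 := contMDiffOn_extend_symm h.domChart_mem_maximalAtlas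
    refine (h1.contMDiffAt ?_).mdifferentiableAt (by simp)
    rw [I.image_eq, I.range_eq_univ, inter_univ]
    refine (h.domChart.open_target.preimage I.continuous_symm).mem_nhds ?_
    rw [mem_preimage, show φ m = I (h.domChart m) from rfl, I.left_inv]
    exact h.domChart.map_source hm
  refine ⟨fun y => φ.symm (h.equiv.symm (ψ y)).1, ?_, ?_⟩
  · have h3 : MDifferentiableAt J 𝓘(ℝ, E₁) (fun y => (h.equiv.symm (ψ y)).1) (f m) := by
      have h4 : MDifferentiableAt 𝓘(ℝ, E₂) 𝓘(ℝ, E₁)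
          (fun v => (h.equiv.symm v).1) (ψ (f m)) := by
        rw [mdifferentiableAt_iff_differentiableAt]
        exact (differentiable_fst.comp h.equiv.symm.differentiable).differentiableAt
      exact h4.comp (f m) hψ
    refine MDifferentiableAt.comp (f m) (g := φ.symm) ?_ h3
    rw [hleft m hm]
    exact hφ
  · filter_upwards [h.domChart.open_source.mem_nhds hm] with x hx
    rw [hleft x hx]
    exact φ.left_inv (by rwa [OpenPartialHomeomorph.extend_source])

-- As `f` is a topological embedding, points of the curve near `f m` come from points near `m`. So
-- the curve equals `f ∘ g ∘ c` for a local left inverse `g`, and the chain rule applies.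
open Manifold in
theorem Manifold.IsSmoothEmbedding.mem_range_mfderiv [IsManifold I ∞ M] [IsManifold J ∞ N] [I.Boundaryless]
    (hf : IsSmoothEmbedding I J ∞ f)
    {c : ℝ → N} {c' : TangentSpace 𝓘(ℝ, ℝ) (0 : ℝ) →L[ℝ] TangentSpace J (c 0)}
    (hc : HasMFDerivAt 𝓘(ℝ, ℝ) J c 0 c') (hcr : ∀ᶠ s in nhds (0 : ℝ), c s ∈ range f)
    (h0 : c 0 = f m) : ∃ w : E₁, (mfderiv I J f m : E₁ → E₂) w = (c' : ℝ → E₂) 1 := by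
  obtain ⟨g, hg, hgf⟩ := (hf.isImmersion.isImmersionAt m).exists_local_left_inverse
  have hfm : MDifferentiableAt I J f m :=
    ((hf.isImmersion.isImmersionAt m).contMDiffAt).mdifferentiableAt (by simp)
  rw [hf.isEmbedding.nhds_eq_comap, Filter.eventually_comap] at hgf
  have hgm : g (f m) = m := hgf.self_of_nhds m rfl
  have hcc : c =ᶠ[nhds 0] f ∘ g ∘ c := by
    have := hc.continuousAt
    rw [ContinuousAt, h0] at this
    filter_upwards [this hgf, hcr] with s hs hsr
    obtain ⟨x, hx⟩ := hsr
    simp only [Function.comp_apply]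
    rw [← hx, hs x hx]
  rw [← h0] at hg
  have hgc := hg.hasMFDerivAt.comp (0 : ℝ) hc
  have hm : ∀ m', (g ∘ c) 0 = m' → MDifferentiableAt I J f m' →
      ∃ w : E₁, (mfderiv I J f m' : E₁ → E₂) w = (c' : ℝ → E₂) 1 := by
    rintro _ rfl hfg
    have h1 := (hfg.hasMFDerivAt.comp (0 : ℝ) hgc).congr_of_eventuallyEq hcc
    have h2 := hasMFDerivAt_unique hc h1
    exact ⟨_, (congrArg (fun l : ℝ →L[ℝ] E₂ => l 1) h2).symm⟩
  exact hm m (by rw [Function.comp_apply, h0, hgm]) hfm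

end Immersions

/-! ### Small flat disks across the surface are meridian disks. -/

section MeridianDisks

/-- The scaled inclusion of the plane of the first two coordinates. -/
noncomputable def planeMap (n : ℕ) (ε : ℝ) :
    EuclideanSpace ℝ (Fin 2) →L[ℝ] EuclideanSpace ℝ (Fin (n + 2)) :=
  LinearMap.toContinuousLinearMap
    { toFun := fun u => planePt n (ε * u 0) (ε * u 1)
      map_add' := fun u v => by simp only [planePt_eq, PiLp.add_apply]; module
      map_smul' := fun r u => by
        simp only [planePt_eq, PiLp.smul_apply, smul_eq_mul, RingHom.id_apply]; module }

theorem planeMap_apply (n : ℕ) (ε : ℝ) (u : EuclideanSpace ℝ (Fin 2)) :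
    planeMap n ε u = planePt n (ε * u 0) (ε * u 1) := rfl

/-- The plane around the point `(a, 0)`. -/
noncomputable def planeChart (n : ℕ) (a ε : ℝ) (u : EuclideanSpace ℝ (Fin 2)) :
    EuclideanSpace ℝ (Fin (n + 2)) := planePt n (a + ε * u 0) (ε * u 1)

theorem planeChart_eq (n : ℕ) (a ε : ℝ) (u : EuclideanSpace ℝ (Fin 2)) :
    planeChart n a ε u = planePt n a 0 + planeMap n ε u := by
  simp only [planeChart, planeMap_apply, planePt_eq]; module

theorem hasFDerivAt_planeChart (n : ℕ) (a ε : ℝ) (u : EuclideanSpace ℝ (Fin 2)) :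
    HasFDerivAt (planeChart n a ε) (planeMap n ε) u := by
  have : planeChart n a ε = fun u => planePt n a 0 + planeMap n ε u :=
    funext (planeChart_eq n a ε)
  rw [this]
  exact (planeMap n ε).hasFDerivAt.const_add _

theorem contDiff_planeChart (n : ℕ) (a ε : ℝ) : ContDiff ℝ ∞ (planeChart n a ε) := by
  have : planeChart n a ε = fun u => planePt n a 0 + planeMap n ε u :=
    funext (planeChart_eq n a ε)
  rw [this]
  exact contDiff_const.add (planeMap n ε).contDiff

theorem planeMap_injective (n : ℕ) {ε : ℝ} (hε : 0 < ε) : Function.Injective (planeMap n ε) := by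
  intro u v h
  have h0 : ε * u 0 = ε * v 0 := congrArg (fun x : EuclideanSpace ℝ (Fin (n + 2)) => x 0) h
  have h1 : ε * u 1 = ε * v 1 := congrArg (fun x : EuclideanSpace ℝ (Fin (n + 2)) => x 1) h
  ext i
  fin_cases i
  · exact mul_left_cancel₀ hε.ne' h0
  · exact mul_left_cancel₀ hε.ne' h1

theorem planeChart_injective (n : ℕ) (a : ℝ) {ε : ℝ} (hε : 0 < ε) :
    Function.Injective (planeChart n a ε) := fun u v h =>
  planeMap_injective n hε (by simpa only [planeChart_eq, add_right_inj] using h)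

theorem norm_planeMap (n : ℕ) {ε : ℝ} (hε : 0 < ε) (u : EuclideanSpace ℝ (Fin 2)) :
    ‖planeMap n ε u‖ = ε * ‖u‖ := by
  rw [← sq_eq_sq₀ (norm_nonneg _) (by positivity), planeMap_apply, norm_planePt_sq, mul_pow, mul_pow, mul_pow,
    EuclideanSpace.real_norm_sq_eq, Fin.sum_univ_two]
  ring

theorem planeChart_mem_ball (n : ℕ) {a ε : ℝ} (hε : 0 < ε) (ha : |a| + 2 * ε < 1)
    {u : EuclideanSpace ℝ (Fin 2)} (hu : u ∈ Metric.ball 0 2) :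
    planeChart n a ε u ∈ Metric.ball 0 1 := by
  rw [mem_ball_zero_iff] at hu ⊢
  rw [planeChart_eq]
  have h1 : ‖planePt n a 0‖ = |a| := by
    rw [← sq_eq_sq₀ (norm_nonneg _) (abs_nonneg _), norm_planePt_sq, sq_abs]; ring
  calc ‖planePt n a 0 + planeMap n ε u‖ ≤ ‖planePt n a 0‖ + ‖planeMap n ε u‖ := norm_add_le _ _
    _ = |a| + ε * ‖u‖ := by rw [h1, norm_planeMap n hε]
    _ < 1 := by nlinarith

variable {M : Type*} [TopologicalSpace M] [ChartedSpace (EuclideanSpace ℝ (Fin 2)) M]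
  [IsManifold (𝓡 2) ∞ M] {f : M → S4}

/-- The derivative of `F` at the center is an isomorphism. It takes the plane of the first two
coordinates to the tangent plane of the disk, and the complementary directions to velocities of
curves in the surface, which are tangent to it. -/
theorem isMeridianDisk_planeChart (hf : Manifold.IsSmoothEmbedding (𝓡 2) (𝓡 4) ∞ f) {c : ℕ}
    {F : EuclideanSpace ℝ (Fin (2 + 2)) → S4} {t : Fin c → ℝ}
    (hinj : InjOn F (Metric.closedBall 0 1))
    (hsm : ∀ x ∈ Metric.ball 0 1,
      ContMDiffAt 𝓘(ℝ, EuclideanSpace ℝ (Fin (2 + 2))) (𝓡 4) ∞ F x ∧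
      Function.Injective (mfderiv 𝓘(ℝ, EuclideanSpace ℝ (Fin (2 + 2))) (𝓡 4) F x))
    (hK : ∀ x ∈ Metric.closedBall 0 1, F x ∈ range f ↔ ∃ j, x 0 = t j ∧ x 1 = 0)
    {ε : ℝ} (hε : 0 < ε) (hsep : ∀ k l, k ≠ l → 8 * ε < |t k - t l|)
    (hb : ∀ k, |t k| + 2 * ε < 1) (k : Fin c) :
    IsMeridianDisk f fun u => F (planeChart 2 (t k) ε u) := by
  have hball : ∀ {u}, u ∈ Metric.ball 0 2 → planeChart 2 (t k) ε u ∈ Metric.ball 0 1 :=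
    planeChart_mem_ball 2 hε (hb k)
  have hder : ∀ {u}, u ∈ Metric.ball 0 2 →
      HasMFDerivAt 𝓘(ℝ, EuclideanSpace ℝ (Fin 2)) (𝓡 4) (fun u => F (planeChart 2 (t k) ε u)) u
        ((mfderiv 𝓘(ℝ, EuclideanSpace ℝ (Fin (2 + 2))) (𝓡 4) F (planeChart 2 (t k) ε u)).comp
          (planeMap 2 ε)) := fun {u} hu =>
    HasMFDerivAt.comp u (((hsm _ (hball hu)).1.mdifferentiableAt (by simp)).hasMFDerivAt)
      (hasFDerivAt_planeChart 2 (t k) ε u).hasMFDerivAt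
  have h0 : (0 : EuclideanSpace ℝ (Fin 2)) ∈ Metric.ball 0 2 := by simp
  have hiff : ∀ u ∈ Metric.ball (0 : EuclideanSpace ℝ (Fin 2)) 2,
      F (planeChart 2 (t k) ε u) ∈ range f ↔ u = 0 := by
    intro u hu
    rw [hK _ (Metric.ball_subset_closedBall (hball hu))]
    constructor
    · rintro ⟨j, hj0, hj1⟩
      have hj0' : t k + ε * u 0 = t j := hj0
      have hj1' : ε * u 1 = 0 := hj1
      have hu1 := (mul_eq_zero.1 hj1').resolve_left hε.ne'
      have hkj : k = j := by
        by_contra hkj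
        have := hsep k j hkj
        rw [show t k - t j = -(ε * u 0) by linarith, abs_neg, abs_mul, abs_of_pos hε] at this
        have h2 : |u 0| ≤ ‖u‖ := by
          rw [← Real.norm_eq_abs]; exact PiLp.norm_apply_le u 0
        rw [mem_ball_zero_iff] at hu
        nlinarith
      subst hkj
      have hu0 : u 0 = 0 := by
        have : ε * u 0 = 0 := by linarith
        exact (mul_eq_zero.1 this).resolve_left hε.ne'
      ext i
      fin_cases i
      exacts [hu0, hu1]
    · rintro rfl
      exact ⟨k, by simp [planeChart, planePt_zero], by simp [planeChart, planePt_one]⟩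
  refine ⟨?_, ?_, ?_, hiff, ?_⟩
  · exact fun u hu => (ContMDiffAt.comp u (hsm _ (hball hu)).1
      (contDiff_planeChart 2 (t k) ε).contMDiff.contMDiffAt).contMDiffWithinAt
  · exact fun u hu v hv h => planeChart_injective 2 (t k) hε
      (hinj (Metric.ball_subset_closedBall (hball hu)) (Metric.ball_subset_closedBall (hball hv)) h)
  · intro u hu
    rw [(hder hu).mfderiv]
    exact (hsm _ (hball hu)).2.comp (planeMap_injective 2 hε)
  · obtain ⟨m, hm⟩ := (hiff 0 h0).2 rfl
    refine ⟨m, hm, ?_⟩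
    rw [(hder h0).mfderiv]
    set x₀ := planeChart 2 (t k) ε 0 with hx₀
    let L : EuclideanSpace ℝ (Fin (2 + 2)) →L[ℝ] EuclideanSpace ℝ (Fin 4) :=
      mfderiv 𝓘(ℝ, EuclideanSpace ℝ (Fin (2 + 2))) (𝓡 4) F x₀
    have hLi : Function.Injective L := (hsm x₀ (hball h0)).2
    have hLs : Function.Surjective L := LinearMap.injective_iff_surjective (f := L.toLinearMap).1 hLi
    have hx0 : x₀ 0 = t k := by simp [hx₀, planeChart, planePt_zero]
    have hx1 : x₀ 1 = 0 := by simp [hx₀, planeChart, planePt_one]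
    intro A B
    rw [eq_top_iff]
    intro y _
    obtain ⟨w, rfl⟩ := hLs y
    -- The component along the flat disk; the line through the center in direction `v` stays in that
    -- disk.
    let v := w - planePt 2 (w 0) (w 1)
    have hv0 : v 0 = 0 := by simp [v, planePt_zero]
    have hv1 : v 1 = 0 := by simp [v, planePt_one]
    have hw : w = planeMap 2 ε (!₂[w 0 / ε, w 1 / ε]) + v := by
      have : planeMap 2 ε (!₂[w 0 / ε, w 1 / ε]) = planePt 2 (w 0) (w 1) := by
        rw [planeMap_apply]
        congr 1
        · simp; field_simp
        · simp; field_simp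
      rw [this]
      simp [v]
    rw [hw, map_add]
    refine Submodule.add_mem_sup ⟨!₂[w 0 / ε, w 1 / ε], rfl⟩ ?_
    have hline : ∀ x', x₀ + (0 : ℝ) • v = x' → x' ∈ Metric.ball 0 1 →
        HasMFDerivAt 𝓘(ℝ, ℝ) (𝓡 4) (fun s : ℝ => F (x₀ + s • v)) 0
          ((mfderiv 𝓘(ℝ, EuclideanSpace ℝ (Fin (2 + 2))) (𝓡 4) F x').comp
            ((1 : ℝ →L[ℝ] ℝ).smulRight v)) := by
      rintro _ rfl hx'
      refine HasMFDerivAt.comp (0 : ℝ) (((hsm _ hx').1.mdifferentiableAt (by simp)).hasMFDerivAt) ?_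
      have : HasFDerivAt (fun s : ℝ => x₀ + s • v) ((1 : ℝ →L[ℝ] ℝ).smulRight v) 0 :=
        (((1 : ℝ →L[ℝ] ℝ).smulRight v).hasFDerivAt).const_add x₀
      exact this.hasMFDerivAt
    obtain ⟨z, hz⟩ := hf.mem_range_mfderiv (m := m) (hline x₀ (by simp) (hball h0)) (by
      have hcont : Filter.Tendsto (fun s : ℝ => x₀ + s • v) (nhds 0) (nhds x₀) := by
        have : Continuous fun s : ℝ => x₀ + s • v := by fun_prop
        simpa using this.tendsto 0
      filter_upwards [hcont (Metric.isOpen_ball.mem_nhds (hball h0))] with s hs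
      refine (hK _ (Metric.ball_subset_closedBall hs)).2 ⟨k, ?_, ?_⟩
      · simp [hx0, hv0]
      · simp [hx1, hv1]) (by rw [zero_smul, add_zero]; exact hm.symm)
    refine ⟨z, hz.trans ?_⟩
    show L ((1 : ℝ) • v) = L v
    rw [one_smul]

end MeridianDisks

/-! ### Bridge trisections. -/

section BridgeTrisections

theorem IsTrivialDiskCollection.exists_isFlatPair {n m : ℕ} {K X bd corner : Set S4}
    (h : IsTrivialDiskCollection n m K X bd corner) :
    ∃ (F : EuclideanSpace ℝ (Fin (n + 2)) → S4) (t : Fin m → ℝ), IsFlatPair n Kᶜ X bd F t := by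
  obtain ⟨F, t, hc, hi, hX, hbd, -, hinj, ht, hK⟩ := h
  refine ⟨F, t, hc, hi, hX, hbd, hinj, ht, fun x hx => ?_⟩
  rw [mem_compl_iff, hK x hx, not_exists]
  rfl

theorem IsTrivialDiskCollection.isTame {n m : ℕ} {K X bd corner : Set S4}
    (h : IsTrivialDiskCollection (n + 1) m K X bd corner) : IsTame Kᶜ X bd := by
  obtain ⟨F, t, hF⟩ := h.exists_isFlatPair
  exact hF.isTame

theorem IsTrivialDiskCollection.isFaithful {m : ℕ} {K X bd corner : Set S4}
    (h : IsTrivialDiskCollection 2 m K X bd corner) : IsFaithful (bd ∩ Kᶜ) (X ∩ Kᶜ) := by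
  obtain ⟨F, t, hF⟩ := h.exists_isFlatPair
  exact fun G _ Φ hΦ x y γ γ' hγ hγ' he => hF.eq_of_repEq hΦ γ γ' hγ hγ' he

theorem IsTrivialDiskCollection.exists_isFreeBasis {n m : ℕ} {K X bd corner : Set S4}
    (h : IsTrivialDiskCollection n m K X bd corner) {s : S4} (hs : s ∈ X ∩ Kᶜ) :
    ∃ g : Fin m → Path s s, IsFreeBasis (X ∩ Kᶜ) g := by
  obtain ⟨F, t, hF⟩ := h.exists_isFlatPair
  obtain ⟨ε, hε, hsep, hb⟩ := exists_separation t hF.inj_param hF.param_lt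
  obtain ⟨y, p, μ, -, -, -, hbas⟩ := hF.exists_isFreeBasis hε hsep hb hs
  exact ⟨_, hbas⟩

variable {M : Type*} [TopologicalSpace M] [ChartedSpace (EuclideanSpace ℝ (Fin 2)) M]
  [IsManifold (𝓡 2) ∞ M] {f : M → S4}

/-- The fundamental group of the complement of a trivial disk system is free on meridians. -/
theorem IsTrivialDiskCollection.exists_meridian_basis
    (hf : Manifold.IsSmoothEmbedding (𝓡 2) (𝓡 4) ∞ f) {c : ℕ} {X bd corner : Set S4}
    (h : IsTrivialDiskCollection 2 c (range f) X bd corner) (hcorner : corner ⊆ bd) {s : S4}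
    (hs : s ∈ X ∩ (range f)ᶜ) :
    ∃ (y : Fin c → S4) (p : ∀ k, Path s (y k)) (μ : ∀ k, Path (y k) (y k)),
      (∀ k, InSet (X ∩ (range f)ᶜ) (p k)) ∧ (∀ k, InSet (X ∩ (range f)ᶜ) (μ k)) ∧
      (∀ k, ∃ d : EuclideanSpace ℝ (Fin 2) → S4, IsMeridianDisk f d ∧ ∀ u : unitInterval,
        μ k u = d !₂[Real.cos (2 * Real.pi * u), Real.sin (2 * Real.pi * u)]) ∧
      IsFreeBasis (X ∩ (range f)ᶜ) fun k => ((p k).trans (μ k)).trans (p k).symm := by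
  obtain ⟨F, t, hc, hi, hX, hbd, hsm, hinj, ht, hK⟩ := h
  have hF : IsFlatPair 2 (range f)ᶜ X bd F t := by
    refine ⟨hc, hi, hX, hbd, hinj, ht, fun x hx => ?_⟩
    rw [mem_compl_iff, hK x hx, not_exists]
    rfl
  obtain ⟨ε, hε, hsep, hb⟩ := exists_separation t hinj ht
  obtain ⟨y, p, μ, hp, hμ, hμF, hbas⟩ := hF.exists_isFreeBasis hε hsep hb hs
  refine ⟨y, p, μ, hp, hμ, fun k => ⟨fun u => F (planeChart 2 (t k) ε u),
    isMeridianDisk_planeChart hf hi (fun x hx => ?_) hK hε hsep hb k, fun u => hμF k u⟩, hbas⟩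
  have hxb := Metric.ball_subset_closedBall hx
  have hnhds : Metric.closedBall 0 1 ∈ nhds x :=
    Filter.mem_of_superset (Metric.isOpen_ball.mem_nhds hx) Metric.ball_subset_closedBall
  -- Corners lie in the boundary, which is the image of the sphere, so by injectivity interior
  -- points avoid them and `F` is smooth there.
  have hxc : F x ∉ corner := by
    intro hxc
    have := hcorner hxc
    rw [← hbd] at this
    obtain ⟨z, hz, hzx⟩ := this
    have hzx' := hi (Metric.sphere_subset_closedBall hz) hxb hzx
    rw [hzx', mem_sphere_zero_iff_norm] at hz
    rw [mem_ball_zero_iff] at hx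
    exact hx.ne hz
  obtain ⟨h1, h2⟩ := hsm x hxb hxc
  rw [mfderivWithin_of_mem_nhds hnhds] at h2
  exact ⟨h1.contMDiffAt hnhds, h2⟩

theorem iUnion_standardSector : ⋃ i, standardSector i = univ := by
  refine eq_univ_of_forall fun x => ?_
  obtain ⟨i, hi⟩ := Finite.exists_max fun k : Fin 3 =>
    x.1 0 * Real.cos (2 * Real.pi * (k : ℕ) / 3) + x.1 1 * Real.sin (2 * Real.pi * (k : ℕ) / 3)
  exact mem_iUnion.2 ⟨i, hi⟩

theorem IsGenusZeroTrisection.iUnion_eq {X : Fin 3 → Set S4} (h : IsGenusZeroTrisection X) :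
    ⋃ i, X i = univ := by
  obtain ⟨Φ, hΦ⟩ := h
  simp_rw [hΦ, ← image_iUnion, iUnion_standardSector, image_univ]
  exact Φ.surjective.range_eq

theorem exists_third {i j : Fin 3} (hij : i ≠ j) :
    ∃ k, k ≠ i ∧ k ≠ j ∧ ∀ l, l = i ∨ l = j ∨ l = k := by
  revert i j; decide

theorem path_conj_assoc {Y : Type} [TopologicalSpace Y] {x y z : Y} (a : Path x y) (p : Path y z)
    (μ : Path z z) :
    Path.Homotopic.Quotient.mk ((a.trans ((p.trans μ).trans p.symm)).trans a.symm) =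
      Path.Homotopic.Quotient.mk (((a.trans p).trans μ).trans (a.trans p).symm) := by
  rw [Path.trans_symm]
  simp only [Path.Homotopic.Quotient.mk_trans, Path.Homotopic.Quotient.trans_assoc]

end BridgeTrisections

end

open Set in
theorem proposition1p7 {M : Type*} [TopologicalSpace M] [CompactSpace M]
    [ChartedSpace (EuclideanSpace ℝ (Fin 2)) M] [IsManifold (𝓡 2) ∞ M]
    (f : M → S4) (hf : Manifold.IsSmoothEmbedding (𝓡 2) (𝓡 4) ∞ f)
    (b : ℕ) (c : Fin 3 → ℕ) (X : Fin 3 → Set S4)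
    (hX : IsBridgeTrisection (Set.range f) b c X)
    (x₀ : ↥(Set.range f)ᶜ) (i j : Fin 3) (hij : i ≠ j) :
    c j ≤ b ∧ HasMeridionalPresentation f x₀ (c i) (b - c j) := by
  obtain ⟨k, hki, hkj, hall⟩ := exists_third hij
  have hI : ⋂ l, X l = X i ∩ X j ∩ X k := by
    ext x
    simp only [mem_iInter, mem_inter_iff]
    refine ⟨fun h => ⟨⟨h i, h j⟩, h k⟩, fun h l => ?_⟩
    rcases hall l with rfl | rfl | rfl
    exacts [h.1.1, h.1.2, h.2]
  have hbd : ∀ u v w : Fin 3, v ≠ u → w ≠ u → (∀ l, l = u ∨ l = v ∨ l = w) →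
      ⋃ l ∈ {l | l ≠ u}, X u ∩ X l = X u ∩ X v ∪ X u ∩ X w := by
    intro u v w hvu hwu hl
    ext x
    simp only [mem_iUnion, mem_union, exists_prop, mem_ofPred_eq]
    constructor
    · rintro ⟨l, hlu, hx⟩
      rcases hl l with rfl | rfl | rfl
      exacts [absurd rfl hlu, Or.inl hx, Or.inr hx]
    · rintro (hx | hx)
      exacts [⟨v, hvu, hx⟩, ⟨w, hwu, hx⟩]
  have hcov : ∀ x, x ∈ X i ∨ x ∈ X j ∨ x ∈ X k := by
    intro x
    obtain ⟨l, hl⟩ := mem_iUnion.1 (hX.trisection.iUnion_eq ▸ mem_univ x)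
    rcases hall l with rfl | rfl | rfl
    exacts [Or.inl hl, Or.inr (Or.inl hl), Or.inr (Or.inr hl)]
  have hdi := hX.disks i
  have hdj := hX.disks j
  have hdk := hX.disks k
  have hti := hX.tangles i j hij
  have htj := hX.tangles j k hkj.symm
  rw [hI] at hdi hdj hdk hti htj
  rw [hbd i j k hij.symm hki hall] at hdi
  rw [hbd j i k hij hkj fun l => by rcases hall l with h | h | h <;> simp [h],
    inter_comm (X j) (X i)] at hdj
  rw [hbd k i j hki.symm hkj.symm fun l => by rcases hall l with h | h | h <;> simp [h],
    inter_comm (X k) (X i), inter_comm (X k) (X j)] at hdk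
  have hTi : IsTame (range f)ᶜ (X i) _ := hdi.isTame
  have hTj : IsTame (range f)ᶜ (X j) _ := hdj.isTame
  have hTk : IsTame (range f)ᶜ (X k) _ := hdk.isTame
  have hTij : IsTame (range f)ᶜ (X i ∩ X j) _ := hti.isTame (n := 0)
  have hTjk : IsTame (range f)ᶜ (X j ∩ X k) _ := htj.isTame (n := 0)
  -- The central sphere meets the complement of the surface; a common base point for all pieces is
  -- taken there.
  obtain ⟨s, hs⟩ := hTjk.nonempty
  obtain ⟨y, p, μ, hp, hμ, hmer, hbas⟩ := hdi.exists_meridian_basis hf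
    (fun x hx => Or.inl hx.1) ⟨hs.1.1.1, hs.2⟩
  obtain ⟨g', hg'⟩ := hdj.exists_isFreeBasis ⟨hs.1.1.2, hs.2⟩
  obtain ⟨h, hh⟩ := hti.exists_isFreeBasis ⟨hs.1.1, hs.2⟩
  obtain ⟨hcb, hfull, r, hrel, hrep⟩ := exists_relations hTi.isClosed hTij.isClosed hTjk hTj hTk
    hdj.isFaithful hdk.isFaithful
    (eq_univ_of_forall fun x => by rcases hcov x with h | h | h <;> simp [h]) hs hbas hg' hh
  refine ⟨hcb, r, ?_⟩
  -- The complement is connected through the boundaries of the three pieces, all of which contain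
  -- `s`. This allows an arbitrary base point `x₀`.
  have hjoin : ∀ z ∈ (range f)ᶜ, ∃ q : Path s z, InSet (range f)ᶜ q := by
    have key : ∀ {Y bd : Set S4}, IsTame (range f)ᶜ Y bd → s ∈ bd → ∀ z ∈ Y ∩ (range f)ᶜ,
        ∃ q : Path s z, InSet (range f)ᶜ q := by
      intro Y bd hY hsY z hz
      obtain ⟨x, hx, q, hq⟩ := hY.join z hz
      obtain ⟨q', hq'⟩ := hY.joined s ⟨hsY, hs.2⟩ x hx
      exact ⟨q'.trans q, (hq'.mono inter_subset_right).trans (hq.mono inter_subset_right)⟩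
    intro z hz
    rcases hcov z with h | h | h
    · exact key hTi (Or.inl hs.1.1) z ⟨h, hz⟩
    · exact key hTj (Or.inl hs.1.1) z ⟨h, hz⟩
    · exact key hTk (Or.inl ⟨hs.1.1.1, hs.1.2⟩) z ⟨h, hz⟩
  have hpath : ∀ z : ↥(range f)ᶜ, Nonempty (Path (⟨s, hs.2⟩ : ↥(range f)ᶜ) z) := fun z => by
    obtain ⟨q, hq⟩ := hjoin z z.2
    exact ⟨liftPath q hq⟩
  obtain ⟨a'⟩ := hpath x₀
  obtain ⟨e, he⟩ := exists_presentation hs.2 inter_subset_right hbas ⟨hs.1.1.1, hs.2⟩ hfull r hrel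
    hrep x₀ (fun z => ⟨a'.symm.trans (hpath z).some⟩) a'.symm
  refine ⟨e, fun l => ?_⟩
  obtain ⟨d, hd, hμd⟩ := hmer l
  have hpl := (hp l).mono (inter_subset_right : X i ∩ (range f)ᶜ ⊆ (range f)ᶜ)
  have hμl := (hμ l).mono (inter_subset_right : X i ∩ (range f)ᶜ ⊆ (range f)ᶜ)
  -- The path to the meridian circle absorbs both the change of base point and the arc from `s`.
  refine ⟨d, hd, _, a'.symm.trans (liftPath (p l) hpl), liftPath (μ l) hμl, hμd, ?_⟩
  rw [he l (((liftPath (p l) hpl).trans (liftPath (μ l) hμl)).trans (liftPath (p l) hpl).symm) ?_,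
    path_conj_assoc]
  intro u
  simp only [Path.trans_apply, Path.symm_apply]
  split_ifs <;> rfl
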